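/- Let $n\ge 1$, $\mathbb R^n_+=\{x: x_1>0,\dots,x_n>0\}$, $\overline{\mathbb R}{}^n_+=\{x: x_1\ge0,\dots,x_n\ge0\}$, $\gamma=(\gamma_1,\dots,\gamma_n)$ with all $\gamma_i>0$, $|\gamma|=\sum_i\gamma_i$, $x^\gamma=\prod_i x_i^{\gamma_i}$. Write $B_\nu=\frac{d^2}{ds^2}+\frac{\nu}{s}\frac{d}{ds}$ and $\Delta_\gamma=\sum_{i=1}^n (B_{\gamma_i})_{x_i}$. Let ${}^\gamma T^y={}^{\gamma_1}T^{y_1}_{x_1}\cdots{}^{\gamma_n}T^{y_n}_{x_n}$, where $${}^{\gamma_i}T^{y_i}_{x_i}f(x)=\frac{\Gamma(\frac{\gamma_i+1}2)}{\Gamma(\frac{\gamma_i}2)\Gamma(\frac12)}\int_0^\pi f\Big(x_1,\dots,x_{i-1},\sqrt{x_i^2+y_i^2-2x_iy_i\cos\alpha},x_{i+1},\dots,x_n\Big)\sin^{\gamma_i-1}\alpha\,d\alpha .$$ With $S_1^+(n)=\{\theta\in\mathbb R^n_+:|\theta|=1\}$ and $B_1^+(n)=\{y\in\mathbb R^n_+:|y|\le1\}$,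 the weighted spherical mean is $$M^\gamma_t[f](x)=\frac{1}{|S_1^+(n)|_\gamma}\int_{S_1^+(n)}{}^\gamma T^{t\theta}f(x)\,\theta^\gamma\,dS,\qquad |S_1^+(n)|_\gamma=\frac{\prod_{i}\Gamma(\frac{\gamma_i+1}2)}{2^{n-1}\Gamma(\frac{n+|\gamma|}2)} .$$ For $k\in\mathbb R$ consider the Cauchy problem $$(B_k)_t u=(\Delta_\gamma)_x u\quad (x\in\mathbb R^n_+,\ t>0),\qquad u(x,0)=f(x),\quad u_t(x,0)=0 .$$ By a solution we mean a function $u\in C^2(\overline{\mathbb R}{}^n_+\times[0,\infty))$, even with respect to each $x_i$ (that is, $\partial u/\partial x_i=0$ where $x_i=0$), that satisfies the equation and the initial conditions. Theorem 3.1. Let $f\in C^2(\overline{\mathbb R}{}^n_+)$ be real-valued and even with respect to each variable, i.e. $\partial f/\partial x_i=0$ where $x_i=0$, $i=1,\dots,n$. Then: 1. For $k=n+|\gamma|-1$ the solution of the Cauchy problem is $u(x,t)=M^\gamma_t[f](x)$. 2. For every real $k>n+|\gamma|-1$ the solution of the Cauchy problem is $$u(x,t)=\frac{2^n\Gamma(\frac{k+1}2)}{\Gamma(\frac{k-n-|\gamma|+1}2)\prod_{i=1}^n\Gamma(\frac{\gamma_i+1}2)}\int_{B_1^+(n)}{}^\gamma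 T^{ty}f(x)\,(1-|y|^2)^{\frac{k-n-|\gamma|-1}2}\,y^\gamma\,dy .$$ In both cases the integral over $S_1^+(n)$, respectively $B_1^+(n)$, converges absolutely for all $x\in\overline{\mathbb R}{}^n_+$, $t\ge0$, and the solution is unique in the stated class. -/

import Mathlib

open MeasureTheory Set

noncomputable section

namespace EPD

/-- The open orthant `x_1 > 0, …, x_n > 0` of Euclidean space. -/
def orthant (n : ℕ) : Set (EuclideanSpace ℝ (Fin n)) := {x | ∀ i, 0 < x i}

/-- The closed orthant `x_1 ≥ 0, …, x_n ≥ 0`. -/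
def closedOrthant (n : ℕ) : Set (EuclideanSpace ℝ (Fin n)) := {x | ∀ i, 0 ≤ x i}

/-- The point `x` with its `i`-th coordinate replaced by `s`. -/
def setCoord {n : ℕ} (x : EuclideanSpace ℝ (Fin n)) (i : Fin n) (s : ℝ) :
    EuclideanSpace ℝ (Fin n) :=
  WithLp.toLp 2 (Function.update (WithLp.ofLp x) i s)

/-- Evenness in each variable of a `C^2` function on the closed orthant: the only odd
derivatives of order at most two, the (one-sided) `∂g/∂x_i`, vanish on the faces `x_i = 0`. -/
def EvenInEach {n : ℕ} (g : EuclideanSpace ℝ (Fin n) → ℝ) : Prop :=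
  ∀ i, ∀ x ∈ closedOrthant n, derivWithin (fun s => g (setCoord x i s)) (Ici 0) 0 = 0

/-- The class `C^2_ev`: twice continuously differentiable up to the boundary of the orthant,
and even with respect to each variable. -/
def IsC2Even {n : ℕ} (g : EuclideanSpace ℝ (Fin n) → ℝ) : Prop :=
  ContDiffOn ℝ 2 g (closedOrthant n) ∧ EvenInEach g

/-- The singular Bessel operator `B_ν = d²/ds² + (ν/s) d/ds`. -/
def besselOp (ν : ℝ) (g : ℝ → ℝ) (s : ℝ) : ℝ := deriv (deriv g) s + ν / s * deriv g s

/-- The Laplace–Bessel operator `∑ i, (B_{γ_i})_{x_i}`. -/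
def laplaceBessel {n : ℕ} (γ : Fin n → ℝ) (g : EuclideanSpace ℝ (Fin n) → ℝ)
    (x : EuclideanSpace ℝ (Fin n)) : ℝ :=
  ∑ i, besselOp (γ i) (fun s => g (setCoord x i s)) (x i)

/-- The weight `x^γ = ∏ x_i^{γ_i}`. -/
def weight {n : ℕ} (γ : Fin n → ℝ) (x : EuclideanSpace ℝ (Fin n)) : ℝ := ∏ i, x i ^ γ i

/-- The one-dimensional generalized translation with parameter `a` and step `s`, acting on the
`i`-th variable. -/
def translate₁ {n : ℕ} (a : ℝ) (i : Fin n) (s : ℝ) (g : EuclideanSpace ℝ (Fin n) → ℝ)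
    (x : EuclideanSpace ℝ (Fin n)) : ℝ :=
  Real.Gamma ((a + 1) / 2) / (Real.Gamma (a / 2) * Real.Gamma (1 / 2)) *
    ∫ α in (0 : ℝ)..Real.pi,
      g (setCoord x i (Real.sqrt (x i ^ 2 + s ^ 2 - 2 * x i * s * Real.cos α))) *
        Real.sin α ^ (a - 1)

/-- The multidimensional generalized translation: the composition
`T_{x_1}^{y_1} ⋯ T_{x_n}^{y_n}` of the one-dimensional ones. -/
def translate {n : ℕ} (γ : Fin n → ℝ) (y : EuclideanSpace ℝ (Fin n))
    (g : EuclideanSpace ℝ (Fin n) → ℝ) : EuclideanSpace ℝ (Fin n) → ℝ :=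
  (List.finRange n).foldr (fun i h => translate₁ (γ i) i (y i) h) g

/-- The part of the unit sphere in the open orthant. -/
def spherePart (n : ℕ) : Set (Metric.sphere (0 : EuclideanSpace ℝ (Fin n)) 1) :=
  {θ | (θ : EuclideanSpace ℝ (Fin n)) ∈ orthant n}

/-- The surface measure on the unit sphere (counting measure on two points if `n = 1`). -/
def surfaceMeasure (n : ℕ) : Measure (Metric.sphere (0 : EuclideanSpace ℝ (Fin n)) 1) :=
  (volume : Measure (EuclideanSpace ℝ (Fin n))).toSphere

/-- The part of the closed unit ball in the open orthant. -/
def ballPart (n : ℕ) : Set (EuclideanSpace ℝ (Fin n)) := {y | y ∈ orthant n ∧ ‖y‖ ≤ 1}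

/-- The constant `∏ Γ((γ_i+1)/2) / (2^{n-1} Γ((n+|γ|)/2))`, the weighted area of the
spherical part. -/
def weightedArea {n : ℕ} (γ : Fin n → ℝ) : ℝ :=
  (∏ i, Real.Gamma ((γ i + 1) / 2)) /
    ((2 : ℝ) ^ ((n : ℝ) - 1) * Real.Gamma (((n : ℝ) + ∑ i, γ i) / 2))

/-- The integrand `θ ↦ T^{tθ} f(x) θ^γ` of the weighted spherical mean. -/
def meanIntegrand {n : ℕ} (γ : Fin n → ℝ) (f : EuclideanSpace ℝ (Fin n) → ℝ)
    (x : EuclideanSpace ℝ (Fin n)) (t : ℝ)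
    (θ : Metric.sphere (0 : EuclideanSpace ℝ (Fin n)) 1) : ℝ :=
  translate γ (t • (θ : EuclideanSpace ℝ (Fin n))) f x *
    weight γ (θ : EuclideanSpace ℝ (Fin n))

/-- The weighted spherical mean `M^γ_t[f](x)`. -/
def sphericalMean {n : ℕ} (γ : Fin n → ℝ) (f : EuclideanSpace ℝ (Fin n) → ℝ)
    (x : EuclideanSpace ℝ (Fin n)) (t : ℝ) : ℝ :=
  1 / weightedArea γ * ∫ θ in spherePart n, meanIntegrand γ f x t θ ∂(surfaceMeasure n)

/-- The integrand `y ↦ T^{ty} f(x) (1-|y|²)^{(k-n-|γ|-1)/2} y^γ`. -/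
def ballIntegrand {n : ℕ} (γ : Fin n → ℝ) (k : ℝ) (f : EuclideanSpace ℝ (Fin n) → ℝ)
    (x : EuclideanSpace ℝ (Fin n)) (t : ℝ) (y : EuclideanSpace ℝ (Fin n)) : ℝ :=
  translate γ (t • y) f x * (1 - ‖y‖ ^ 2) ^ ((k - n - ∑ i, γ i - 1) / 2) * weight γ y

/-- The explicit integral over the ball part, with its normalizing constant. -/
def ballFormula {n : ℕ} (γ : Fin n → ℝ) (k : ℝ) (f : EuclideanSpace ℝ (Fin n) → ℝ)
    (x : EuclideanSpace ℝ (Fin n)) (t : ℝ) : ℝ :=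
  2 ^ n * Real.Gamma ((k + 1) / 2) /
      (Real.Gamma ((k - n - ∑ i, γ i + 1) / 2) * ∏ i, Real.Gamma ((γ i + 1) / 2)) *
    ∫ y in ballPart n, ballIntegrand γ k f x t y

/-- `u` is a classical solution of the Cauchy problem `(B_k)_t u = (Δ_γ)_x u` on
`orthant × (0, ∞)`, `u(x,0) = f(x)`, `u_t(x,0) = 0`, of class `C^2` up to the boundary and even in
each variable `x_i`. -/
structure IsSolution {n : ℕ} (γ : Fin n → ℝ) (k : ℝ) (f : EuclideanSpace ℝ (Fin n) → ℝ)
    (u : EuclideanSpace ℝ (Fin n) → ℝ → ℝ) : Prop where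
  contDiffOn : ContDiffOn ℝ 2 (fun p : EuclideanSpace ℝ (Fin n) × ℝ => u p.1 p.2)
    (closedOrthant n ×ˢ Ici (0 : ℝ))
  even : ∀ t, 0 ≤ t → EvenInEach (fun x => u x t)
  equation : ∀ x ∈ orthant n, ∀ t, 0 < t →
    besselOp k (u x) t = laplaceBessel γ (fun x' => u x' t) x
  initial_value : ∀ x ∈ closedOrthant n, u x 0 = f x
  initial_deriv : ∀ x ∈ closedOrthant n, derivWithin (u x) (Ici 0) 0 = 0

/-- `u` is the solution of the Cauchy problem: it is a solution, and every solution agrees with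
it on the closed orthant for all `t ≥ 0`. -/
def IsTheSolution {n : ℕ} (γ : Fin n → ℝ) (k : ℝ) (f : EuclideanSpace ℝ (Fin n) → ℝ)
    (u : EuclideanSpace ℝ (Fin n) → ℝ → ℝ) : Prop :=
  IsSolution γ k f u ∧
    ∀ v, IsSolution γ k f v → ∀ x ∈ closedOrthant n, ∀ t, 0 ≤ t → v x t = u x t

end EPD

end

/-! Existence and uniqueness for the Cauchy problem `(B_k)_t u = Δ_γ u`, `u(·, 0) = f`,
`u_t(·, 0) = 0`, with weighted spherical and ball means of generalized translations.

*Regularity.* A `C²` function on the orthant with vanishing normal derivatives on the faces becomes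
a `C²` function of `(a, b)` on the whole space under `x_i = √(a_i² + b_i²)`
(`contDiff_two_comp_sqrt`). The generalized translation evaluates `f` at planar distances
`√((x_i - y_i cos α_i)² + (y_i sin α_i)²)`, so it is an average over the angles of functions that
are `C²` in `(x, y, α)` (`translate_eq_transMean`, `contDiff_transMean`). All differentiations
under integral signs follow from this.

*Intertwining.* In polar coordinates `(s, α)` about a point of the plane, the difference between
`B_a` in `s` applied to `g(triDist x s α)` and `(B_a g)(triDist x s α)`, times `sin^{a-1} α`, is an
exact derivative in `α` (`hasDerivAt_angular_flux`), whose integral over `(0, π)` vanishes. Hence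
`B_{γ_i}` in the step `y_i` can be moved onto `f`, and, the translation being symmetric in `x` and
`y`, can also be exchanged for `B_{γ_i}` in `x_i` (`besselOp_transMean_right`,
`besselOp_transMean_left`).

*Darboux identities.* Write `N = n + |γ|`. Integrating `Δ_γ w` by parts against radial test
functions (`integral_laplaceBessel_radial`) and passing to polar coordinates shows that the
spherical means of an even function `w` satisfy `B_{N-1} M_t[w] = M_t[Δ_γ w]`
(`hasDarbouxIdentity_sphMeasure`). A ball mean is a radial average of spherical means with density
proportional to `ρ^{N-1} (1 - ρ²)^{q-1}`; one integration by parts in `ρ` turns the identity into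
the one with parameter `N - 1 + 2q` (`hasDarbouxIdentity_ballMeasure`), which covers every
`k > N - 1`. Applied to `w(y) = T^y f(x)`, and with `Δ_γ` moved from `y` to `x`, these identities
are the equation (`isSolution_of_hasDarbouxIdentity`). The normalizing constants come from a
Gaussian integral (`integral_weight_sphere`) and the Beta integral (`ballFormula_eq`).

*Uniqueness.* The spherical means `M_r[u(·, t)](x)` of a solution, as a function of `(t, r)`, satisfy
`B_k` in `t` equals `B_{N-1}` in `r` (`IsSolution.besselOp_meanProfile`). For the difference of two
solutions a weighted energy on the backward characteristic triangle starts at zero and does not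
increase, because `k ≥ 0` (`eq_zero_of_besselOp_eq`). So the difference of the means vanishes at
`r = 0`, where the mean is the value at `x`. -/

noncomputable section

set_option linter.unusedSectionVars false

open Filter Topology

namespace EPD

/-! ### The substitution `s = √(a² + b²)` in one variable -/

section RadialLift

variable {P : Type} [NormedAddCommGroup P] [NormedSpace ℝ P]

/-- The Euclidean length of the last two coordinates of a point of `P × ℝ × ℝ`. -/
def pairNorm (q : P × ℝ × ℝ) : ℝ := Real.sqrt (q.2.1 ^ 2 + q.2.2 ^ 2)

/-- The polar map `(p, a, b) ↦ (p, √(a² + b²))`. -/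
def polarMap (q : P × ℝ × ℝ) : P × ℝ := (q.1, pairNorm q)

/-- The first of the two planar coordinates, as a continuous linear functional. -/
def coordA : P × ℝ × ℝ →L[ℝ] ℝ :=
  (ContinuousLinearMap.fst ℝ ℝ ℝ).comp (ContinuousLinearMap.snd ℝ P (ℝ × ℝ))

/-- The second of the two planar coordinates, as a continuous linear functional. -/
def coordB : P × ℝ × ℝ →L[ℝ] ℝ :=
  (ContinuousLinearMap.snd ℝ ℝ ℝ).comp (ContinuousLinearMap.snd ℝ P (ℝ × ℝ))

/-- The derivative of `pairNorm`. Where `pairNorm` vanishes the divisions give the value `0`. -/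
def pairNormDeriv (q : P × ℝ × ℝ) : P × ℝ × ℝ →L[ℝ] ℝ :=
  (q.2.1 / pairNorm q) • coordA + (q.2.2 / pairNorm q) • coordB

lemma coordA_apply (q : P × ℝ × ℝ) : coordA q = q.2.1 := rfl
lemma coordB_apply (q : P × ℝ × ℝ) : coordB q = q.2.2 := rfl

lemma pairNorm_nonneg (q : P × ℝ × ℝ) : 0 ≤ pairNorm q := Real.sqrt_nonneg _

lemma continuous_pairNorm : Continuous (pairNorm : P × ℝ × ℝ → ℝ) := by
  unfold pairNorm; fun_prop

lemma continuous_polarMap : Continuous (polarMap : P × ℝ × ℝ → P × ℝ) :=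
  continuous_fst.prodMk continuous_pairNorm

lemma abs_coordA_le (q : P × ℝ × ℝ) : |coordA q| ≤ pairNorm q :=
  Real.abs_le_sqrt (by rw [coordA_apply]; nlinarith [sq_nonneg q.2.2])

lemma abs_coordB_le (q : P × ℝ × ℝ) : |coordB q| ≤ pairNorm q :=
  Real.abs_le_sqrt (by rw [coordB_apply]; nlinarith [sq_nonneg q.2.1])

lemma abs_div_pairNorm_le {c x : ℝ} (h : |x| ≤ c) : |x / c| ≤ 1 := by
  rw [abs_div]
  exact div_le_one_of_le₀ (h.trans (le_abs_self _)) (abs_nonneg _)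

lemma norm_pairNormDeriv_le (q : P × ℝ × ℝ) : ‖pairNormDeriv q‖ ≤ ‖(coordA : P × ℝ × ℝ →L[ℝ] ℝ)‖ +
    ‖(coordB : P × ℝ × ℝ →L[ℝ] ℝ)‖ := by
  refine (norm_add_le _ _).trans (add_le_add ?_ ?_)
  · rw [norm_smul]
    exact mul_le_of_le_one_left (norm_nonneg _) (abs_div_pairNorm_le (abs_coordA_le q))
  · rw [norm_smul]
    exact mul_le_of_le_one_left (norm_nonneg _) (abs_div_pairNorm_le (abs_coordB_le q))

lemma pairNormDeriv_of_eq_zero {q : P × ℝ × ℝ} (h : pairNorm q = 0) : pairNormDeriv q = 0 := by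
  simp [pairNormDeriv, h]

lemma hasFDerivAt_pairNorm {q : P × ℝ × ℝ} (h : pairNorm q ≠ 0) :
    HasFDerivAt pairNorm (pairNormDeriv q) q := by
  have h0 : q.2.1 ^ 2 + q.2.2 ^ 2 ≠ 0 := by
    intro h'; apply h; simp [pairNorm, h']
  have hA : HasFDerivAt (fun q : P × ℝ × ℝ => q.2.1) coordA q :=
    (coordA (P := P)).hasFDerivAt
  have hB : HasFDerivAt (fun q : P × ℝ × ℝ => q.2.2) coordB q :=
    (coordB (P := P)).hasFDerivAt
  have := ((hA.pow 2).add (hB.pow 2)).sqrt h0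
  refine this.congr_fderiv ?_
  ext v <;> simp [pairNormDeriv, pairNorm] <;> field_simp

lemma continuousAt_pairNormDeriv {q : P × ℝ × ℝ} (h : pairNorm q ≠ 0) :
    ContinuousAt (pairNormDeriv : P × ℝ × ℝ → _) q := by
  have hc : ContinuousAt (pairNorm : P × ℝ × ℝ → ℝ) q := continuous_pairNorm.continuousAt
  unfold pairNormDeriv
  have h1 : ContinuousAt (fun q : P × ℝ × ℝ => q.2.1 / pairNorm q) q :=
    ContinuousAt.div (by fun_prop) hc h
  have h2 : ContinuousAt (fun q : P × ℝ × ℝ => q.2.2 / pairNorm q) q :=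
    ContinuousAt.div (by fun_prop) hc h
  exact (h1.smul continuousAt_const).add (h2.smul continuousAt_const)

lemma hasFDerivAt_polarMap {q : P × ℝ × ℝ} (h : pairNorm q ≠ 0) :
    HasFDerivAt polarMap ((ContinuousLinearMap.fst ℝ P (ℝ × ℝ)).prod (pairNormDeriv q)) q :=
  hasFDerivAt_fst.prodMk (hasFDerivAt_pairNorm h)

lemma mapsTo_polarMap (S : Set P) :
    MapsTo polarMap (S ×ˢ (univ : Set (ℝ × ℝ))) (S ×ˢ Ici (0 : ℝ)) :=
  fun q hq => ⟨hq.1, pairNorm_nonneg q⟩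

variable {G : Type} [NormedAddCommGroup G] [NormedSpace ℝ G]

/-- The chain rule for `h ∘ polarMap` holds also where the planar radius vanishes, although `polarMap`
is not differentiable there: it is Lipschitz, and the vanishing normal derivative of `h` removes
the radial component. -/
lemma hasFDerivWithinAt_comp_polarMap {S : Set P} {h : P × ℝ → G}
    {h' : P × ℝ → (P × ℝ →L[ℝ] G)}
    (hd : ∀ z ∈ S ×ˢ Ici (0 : ℝ), HasFDerivWithinAt h (h' z) (S ×ˢ Ici (0 : ℝ)) z)
    (h0 : ∀ p ∈ S, h' (p, 0) (0, 1) = 0) {q : P × ℝ × ℝ} (hq : q ∈ S ×ˢ (univ : Set (ℝ × ℝ))) :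
    HasFDerivWithinAt (fun q => h (polarMap q))
      ((h' (polarMap q)).comp ((ContinuousLinearMap.fst ℝ P (ℝ × ℝ)).prod (pairNormDeriv q)))
      (S ×ˢ (univ : Set (ℝ × ℝ))) q := by
  have hmem := mapsTo_polarMap S hq
  by_cases hr : pairNorm q = 0
  · have hd' := hd _ hmem
    rw [pairNormDeriv_of_eq_zero hr]
    have hpm : polarMap q = (q.1, 0) := by simp [polarMap, hr]
    have ht : Tendsto polarMap (𝓝[S ×ˢ (univ : Set (ℝ × ℝ))] q)
        (𝓝[S ×ˢ Ici (0 : ℝ)] (polarMap q)) :=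
      tendsto_nhdsWithin_iff.2 ⟨continuous_polarMap.continuousAt.continuousWithinAt,
        eventually_mem_nhdsWithin.mono fun x hx => mapsTo_polarMap S hx⟩
    -- the first order expansion of `h` at `(p, 0)`, composed with the Lipschitz map `polarMap`
    have h1 := hd'.isLittleO.comp_tendsto ht
    have hq2 : q.2.1 = 0 ∧ q.2.2 = 0 := by
      have e1 := abs_coordA_le q
      have e2 := abs_coordB_le q
      rw [hr] at e1 e2
      exact ⟨abs_nonpos_iff.1 e1, abs_nonpos_iff.1 e2⟩
    have h2 : (fun x : P × ℝ × ℝ => polarMap x - polarMap q) =O[𝓝[S ×ˢ (univ : Set (ℝ × ℝ))] q]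
        (fun x => x - q) := by
      refine Asymptotics.IsBigO.of_bound 2 (Eventually.of_forall fun x => ?_)
      have e1 : ‖x.1 - q.1‖ ≤ ‖x - q‖ := norm_fst_le (x - q)
      have e2 : ‖x.2 - q.2‖ ≤ ‖x - q‖ := norm_snd_le (x - q)
      have e3 : |x.2.1 - q.2.1| ≤ ‖x.2 - q.2‖ := norm_fst_le (x.2 - q.2)
      have e4 : |x.2.2 - q.2.2| ≤ ‖x.2 - q.2‖ := norm_snd_le (x.2 - q.2)
      rw [hq2.1, sub_zero] at e3
      rw [hq2.2, sub_zero] at e4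
      have e5 : pairNorm x ≤ 2 * ‖x - q‖ := by
        refine Real.sqrt_le_iff.2 ⟨by positivity, ?_⟩
        have := sq_le_sq' (by linarith [abs_nonneg x.2.1, norm_nonneg (x - q)]) (e3.trans e2)
        have := sq_le_sq' (by linarith [abs_nonneg x.2.2, norm_nonneg (x - q)]) (e4.trans e2)
        simp only [sq_abs] at *
        nlinarith
      rw [Prod.norm_def]
      refine max_le ?_ ?_
      · simp only [polarMap, Prod.fst_sub]
        linarith [norm_nonneg (x - q)]
      · simp only [polarMap, Prod.snd_sub, hr, sub_zero, Real.norm_eq_abs,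
          abs_of_nonneg (pairNorm_nonneg x)]
        exact e5
    refine HasFDerivWithinAt.of_isLittleO ((h1.trans_isBigO h2).congr_left fun x => ?_)
    have hlin : h' (polarMap q) (polarMap x - polarMap q) = h' (polarMap q) (x.1 - q.1, 0) := by
      have : polarMap x - polarMap q = (x.1 - q.1, 0) + (pairNorm x) • ((0 : P), (1 : ℝ)) := by
        simp [polarMap, hr]
      rw [this, map_add, map_smul, hpm, h0 _ hq.1, smul_zero, add_zero]
    simp only [Function.comp]
    rw [hlin]
    simp
  · exact (hd _ hmem).comp q (hasFDerivAt_polarMap hr).hasFDerivWithinAt (mapsTo_polarMap S)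

lemma uniqueDiffOn_prod_univ {S : Set P} (hS : UniqueDiffOn ℝ S) :
    UniqueDiffOn ℝ (S ×ˢ (univ : Set (ℝ × ℝ))) := hS.prod uniqueDiffOn_univ

lemma tendsto_zero_smul_of_bounded {α : Type} {l : Filter α} {F : Type} [NormedAddCommGroup F]
    [NormedSpace ℝ F] {c : α → ℝ} {X : α → F} {C : ℝ} (hc : ∀ x, |c x| ≤ C)
    (hX : Tendsto X l (𝓝 0)) : Tendsto (fun x => c x • X x) l (𝓝 0) := by
  have h1 : Tendsto (fun x => C * ‖X x‖) l (𝓝 0) := by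
    simpa using hX.norm.const_mul C
  refine squeeze_zero_norm (fun x => ?_) h1
  rw [norm_smul]
  exact mul_le_mul_of_nonneg_right (hc x) (norm_nonneg _)

/-- A `C¹` function of `(p, s)`, `s ≥ 0`, with vanishing normal derivative at `s = 0` becomes a `C¹`
function of `(p, a, b)` after the substitution `s = √(a² + b²)`. -/
lemma contDiffOn_one_comp_polarMap {S : Set P} (hS : UniqueDiffOn ℝ S) {h : P × ℝ → G}
    (hh : ContDiffOn ℝ 1 h (S ×ˢ Ici (0 : ℝ)))
    (h0 : ∀ p ∈ S, fderivWithin ℝ h (S ×ˢ Ici (0 : ℝ)) (p, 0) (0, 1) = 0) :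
    ContDiffOn ℝ 1 (fun q => h (polarMap q)) (S ×ˢ (univ : Set (ℝ × ℝ))) := by
  have hD : UniqueDiffOn ℝ (S ×ˢ Ici (0 : ℝ)) := hS.prod (uniqueDiffOn_Ici 0)
  set h' := fderivWithin ℝ h (S ×ˢ Ici (0 : ℝ)) with hh'
  have hd : ∀ z ∈ S ×ˢ Ici (0 : ℝ), HasFDerivWithinAt h (h' z) (S ×ˢ Ici (0 : ℝ)) z := fun z hz =>
    (hh.differentiableOn one_ne_zero z hz).hasFDerivWithinAt
  have hc : ContinuousOn h' (S ×ˢ Ici (0 : ℝ)) := hh.continuousOn_fderivWithin hD le_rfl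
  have hT := uniqueDiffOn_prod_univ hS
  rw [show (1 : WithTop ℕ∞) = 0 + 1 by rfl,
    contDiffOn_succ_iff_hasFDerivWithinAt_of_uniqueDiffOn hT]
  refine ⟨by simp, _, ?_, fun q hq => hasFDerivWithinAt_comp_polarMap hd h0 hq⟩
  rw [contDiffOn_zero]
  intro q hq
  have hcq : ContinuousWithinAt (fun q => h' (polarMap q)) (S ×ˢ (univ : Set (ℝ × ℝ))) q :=
    (hc _ (mapsTo_polarMap S hq)).comp continuous_polarMap.continuousAt.continuousWithinAt
      (mapsTo_polarMap S)
  -- Where the radius vanishes `pairNormDeriv` is only bounded, but it is multiplied by the normal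
  -- derivative of `h`, which tends to zero.
  by_cases hr : pairNorm q = 0
  · have e : ∀ x : P × ℝ × ℝ, (h' (polarMap x)).comp
        ((ContinuousLinearMap.fst ℝ P (ℝ × ℝ)).prod (pairNormDeriv x)) =
        (h' (polarMap x)).comp ((ContinuousLinearMap.inl ℝ P ℝ).comp
          (ContinuousLinearMap.fst ℝ P (ℝ × ℝ))) +
        (pairNormDeriv x).smulRight (h' (polarMap x) (0, 1)) := by
      intro x
      refine ContinuousLinearMap.ext fun v => ?_
      have : (v.1, pairNormDeriv x v) = (v.1, 0) + pairNormDeriv x v • ((0 : P), (1 : ℝ)) := by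
        simp
      simp only [ContinuousLinearMap.comp_apply, ContinuousLinearMap.prod_apply,
        add_apply, ContinuousLinearMap.smulRight_apply,
        ContinuousLinearMap.coe_fst', ContinuousLinearMap.inl_apply]
      rw [this, map_add, map_smul]
    refine (ContinuousWithinAt.add (hcq.clm_comp continuousWithinAt_const) ?_).congr
      (fun x _ => e x) (e q)
    rw [ContinuousWithinAt, pairNormDeriv_of_eq_zero hr]
    have hz : Tendsto (fun x => h' (polarMap x) (0, 1)) (𝓝[S ×ˢ (univ : Set (ℝ × ℝ))] q) (𝓝 0) := by
      have h3 : ContinuousWithinAt (fun x => h' (polarMap x) (0, 1))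
          (S ×ˢ (univ : Set (ℝ × ℝ))) q := hcq.clm_apply continuousWithinAt_const
      have h4 : h' (polarMap q) (0, 1) = 0 := by
        have hpm : polarMap q = (q.1, 0) := by simp [polarMap, hr]
        rw [hpm, h0 _ hq.1]
      rw [ContinuousWithinAt, h4] at h3
      exact h3
    have hn := hz.norm.const_mul (‖(coordA : P × ℝ × ℝ →L[ℝ] ℝ)‖ +
      ‖(coordB : P × ℝ × ℝ →L[ℝ] ℝ)‖)
    simp only [norm_zero, mul_zero] at hn
    have : (ContinuousLinearMap.smulRight (0 : P × ℝ × ℝ →L[ℝ] ℝ) (h' (polarMap q) (0, 1))) = 0 := by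
      ext <;> simp
    rw [this]
    refine squeeze_zero_norm (fun x => ?_) hn
    rw [ContinuousLinearMap.norm_smulRight_apply]
    exact mul_le_mul_of_nonneg_right (norm_pairNormDeriv_le x) (norm_nonneg _)
  · refine hcq.clm_comp ?_
    have e : (fun x : P × ℝ × ℝ => (ContinuousLinearMap.fst ℝ P (ℝ × ℝ)).prod (pairNormDeriv x)) =
        fun x => (ContinuousLinearMap.inl ℝ P ℝ).comp (ContinuousLinearMap.fst ℝ P (ℝ × ℝ)) +
          (ContinuousLinearMap.inr ℝ P ℝ).comp (pairNormDeriv x) := by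
      funext x
      refine ContinuousLinearMap.ext fun v => ?_
      simp
    rw [e]
    exact (continuousAt_const.add (continuousAt_const.clm_comp
      (continuousAt_pairNormDeriv hr))).continuousWithinAt

end RadialLift

section RadialLiftTwo

variable {P : Type} [NormedAddCommGroup P] [NormedSpace ℝ P]

/-- The quotient `h(p, s) / s`, completed at `s = 0` by the normal derivative of `h`. -/
def normalQuot (h : P × ℝ → ℝ) (h' : P × ℝ → (P × ℝ →L[ℝ] ℝ)) (z : P × ℝ) : ℝ :=
  if z.2 = 0 then h' z (0, 1) else h z / z.2

/-- Continuity at `s = 0` is the mean value inequality for `τ ↦ h(p, τ) - c τ` on `[0, s]`, where `c`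
is the normal derivative at the limit point. -/
lemma continuousOn_normalQuot {S : Set P} {h : P × ℝ → ℝ} {h' : P × ℝ → (P × ℝ →L[ℝ] ℝ)}
    (hd : ∀ z ∈ S ×ˢ Ici (0 : ℝ), HasFDerivWithinAt h (h' z) (S ×ˢ Ici (0 : ℝ)) z)
    (hc : ContinuousOn h' (S ×ˢ Ici (0 : ℝ))) (h0 : ∀ p ∈ S, h (p, 0) = 0) :
    ContinuousOn (normalQuot h h') (S ×ˢ Ici (0 : ℝ)) := by
  intro z hz
  by_cases hs : z.2 = 0
  · rw [ContinuousWithinAt, Metric.tendsto_nhdsWithin_nhds]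
    intro ε hε
    have hc' : ContinuousWithinAt (fun z => h' z (0, 1)) (S ×ˢ Ici (0 : ℝ)) z :=
      (hc z hz).clm_apply continuousWithinAt_const
    rw [ContinuousWithinAt, Metric.tendsto_nhdsWithin_nhds] at hc'
    obtain ⟨δ, hδ, hδ'⟩ := hc' (ε / 2) (half_pos hε)
    refine ⟨δ, hδ, fun x hx hxz => ?_⟩
    have e0 : normalQuot h h' z = h' z (0, 1) := by simp [normalQuot, hs]
    rw [e0]
    by_cases hxs : x.2 = 0
    · simp only [normalQuot, hxs, if_true]
      exact (hδ' hx hxz).trans (half_lt_self hε)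
    · have hx2 : 0 < x.2 := lt_of_le_of_ne hx.2 (Ne.symm hxs)
      set c := h' z (0, 1)
      have hder : ∀ τ ∈ Icc 0 x.2, HasDerivWithinAt (fun τ => h (x.1, τ) - c * τ)
          (h' (x.1, τ) (0, 1) - c) (Icc 0 x.2) τ := by
        intro τ hτ
        have h1 : HasDerivWithinAt (fun τ : ℝ => (x.1, τ)) ((0 : P), (1 : ℝ)) (Icc 0 x.2) τ :=
          (hasDerivWithinAt_const τ _ x.1).prodMk (hasDerivWithinAt_id τ _)
        have h2 := (hd (x.1, τ) ⟨hx.1, hτ.1⟩).comp_hasDerivWithinAt τ h1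
          (fun y hy => ⟨hx.1, hy.1⟩)
        have h3 := (hasDerivWithinAt_id τ (Icc 0 x.2)).const_mul c
        rw [mul_one] at h3
        exact h2.sub h3
      have hb : ∀ τ ∈ Icc 0 x.2, ‖h' (x.1, τ) (0, 1) - c‖ ≤ ε / 2 := by
        intro τ hτ
        refine (hδ' (x := (x.1, τ)) ⟨hx.1, hτ.1⟩ (lt_of_le_of_lt ?_ hxz)).le
        rw [Prod.dist_eq, Prod.dist_eq]
        refine max_le_max le_rfl ?_
        rw [hs, Real.dist_eq, Real.dist_eq, sub_zero, sub_zero, abs_of_nonneg hτ.1,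
          abs_of_nonneg hx2.le]
        exact hτ.2
      have hm := Convex.norm_image_sub_le_of_norm_hasDerivWithin_le hder hb (convex_Icc 0 x.2)
        (left_mem_Icc.2 hx2.le) (right_mem_Icc.2 hx2.le)
      simp only [h0 x.1 hx.1, mul_zero, sub_zero, Real.norm_eq_abs, abs_of_pos hx2] at hm
      rw [normalQuot, if_neg hxs, Real.dist_eq, div_sub' hxs, abs_div, abs_of_pos hx2,
        div_lt_iff₀ hx2, mul_comm x.2 c]
      refine lt_of_le_of_lt hm ?_
      exact mul_lt_mul_of_pos_right (half_lt_self hε) hx2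
  · have hcont : ContinuousWithinAt (fun z => h z / z.2) (S ×ˢ Ici (0 : ℝ)) z :=
      (hd z hz).continuousWithinAt.div continuousWithinAt_snd hs
    refine hcont.congr_of_eventuallyEq ?_ (by simp [normalQuot, hs])
    have : ∀ᶠ x : P × ℝ in 𝓝 z, x.2 ≠ 0 := continuous_snd.continuousAt.eventually_ne hs
    filter_upwards [mem_nhdsWithin_of_mem_nhds this] with x hx
    simp [normalQuot, show x.2 ≠ 0 from hx]

/-- If `h` is `C¹` on `S × [0, ∞)` and vanishes at `s = 0`, then `h(p, r) c / r` is `C¹` in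
`(p, a, b)`, where `r = √(a² + b²)` and `c` is a linear functional bounded by `r`. -/
lemma contDiffOn_one_mul_div_pairNorm {S : Set P} (hS : UniqueDiffOn ℝ S) {h : P × ℝ → ℝ}
    (hh : ContDiffOn ℝ 1 h (S ×ˢ Ici (0 : ℝ))) (h0 : ∀ p ∈ S, h (p, 0) = 0)
    {c : P × ℝ × ℝ →L[ℝ] ℝ} (hcr : ∀ q, |c q| ≤ pairNorm q) :
    ContDiffOn ℝ 1 (fun q => h (polarMap q) * (c q / pairNorm q))
      (S ×ˢ (univ : Set (ℝ × ℝ))) := by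
  have hD : UniqueDiffOn ℝ (S ×ˢ Ici (0 : ℝ)) := hS.prod (uniqueDiffOn_Ici 0)
  set h' := fderivWithin ℝ h (S ×ˢ Ici (0 : ℝ)) with hh'
  have hd : ∀ z ∈ S ×ˢ Ici (0 : ℝ), HasFDerivWithinAt h (h' z) (S ×ˢ Ici (0 : ℝ)) z := fun z hz =>
    (hh.differentiableOn one_ne_zero z hz).hasFDerivWithinAt
  have hc : ContinuousOn h' (S ×ˢ Ici (0 : ℝ)) := hh.continuousOn_fderivWithin hD le_rfl
  have hκ := continuousOn_normalQuot hd hc h0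
  set κ := normalQuot h h' with hκdef
  have hT := uniqueDiffOn_prod_univ hS
  have hκT : ∀ q ∈ S ×ˢ (univ : Set (ℝ × ℝ)), ContinuousWithinAt (fun q => κ (polarMap q))
      (S ×ˢ (univ : Set (ℝ × ℝ))) q := fun q hq =>
    (hκ _ (mapsTo_polarMap S hq)).comp continuous_polarMap.continuousAt.continuousWithinAt
      (mapsTo_polarMap S)
  have hcT : ∀ q ∈ S ×ˢ (univ : Set (ℝ × ℝ)), ContinuousWithinAt (fun q => h' (polarMap q))
      (S ×ˢ (univ : Set (ℝ × ℝ))) q := fun q hq =>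
    (hc _ (mapsTo_polarMap S hq)).comp continuous_polarMap.continuousAt.continuousWithinAt
      (mapsTo_polarMap S)
  have hbd : ∀ q : P × ℝ × ℝ, |c q / pairNorm q| ≤ 1 := fun q => abs_div_pairNorm_le (hcr q)
  have hk : ∀ q : P × ℝ × ℝ, h (polarMap q) * (c q / pairNorm q) = κ (polarMap q) * c q := by
    intro q
    by_cases hr : pairNorm q = 0
    · have : c q = 0 := abs_nonpos_iff.1 (hr ▸ hcr q)
      simp [this]
    · have : κ (polarMap q) = h (polarMap q) / pairNorm q := if_neg hr
      rw [this]; ring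
  -- The derivative of `κ(p, r) c`; all its terms but the last vanish where `r = 0`.
  let D' : P × ℝ × ℝ → (P × ℝ × ℝ →L[ℝ] ℝ) := fun q =>
    (c q / pairNorm q) • ((h' (polarMap q)).comp ((ContinuousLinearMap.inl ℝ P ℝ).comp
      (ContinuousLinearMap.fst ℝ P (ℝ × ℝ)))) +
    (c q / pairNorm q) • ((h' (polarMap q) (0, 1) - κ (polarMap q)) • pairNormDeriv q) +
    κ (polarMap q) • c
  rw [show (1 : WithTop ℕ∞) = 0 + 1 by rfl,
    contDiffOn_succ_iff_hasFDerivWithinAt_of_uniqueDiffOn hT]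
  refine ⟨by simp, D', ?_, fun q hq => ?_⟩
  · rw [contDiffOn_zero]
    intro q hq
    have hlast : ContinuousWithinAt (fun q => κ (polarMap q) • c) (S ×ˢ (univ : Set (ℝ × ℝ))) q :=
      (hκT q hq).smul continuousWithinAt_const
    by_cases hr : pairNorm q = 0
    · have hpm : polarMap q = (q.1, 0) := by simp [polarMap, hr]
      have hin : (h' (polarMap q)).comp (ContinuousLinearMap.inl ℝ P ℝ) = 0 := by
        have h1 : HasFDerivWithinAt (fun p : P => h (p, 0))
            ((h' (q.1, 0)).comp (ContinuousLinearMap.inl ℝ P ℝ)) S q.1 := by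
          have := (hd (q.1, 0) ⟨hq.1, le_refl (0 : ℝ)⟩).comp q.1
            ((ContinuousLinearMap.inl ℝ P ℝ).hasFDerivWithinAt (s := S) (x := q.1))
            (fun p hp => (⟨hp, le_refl (0 : ℝ)⟩ : (p, (0 : ℝ)) ∈ S ×ˢ Ici (0 : ℝ)))
          exact this
        have h2 : HasFDerivWithinAt (fun p : P => h (p, 0)) (0 : P →L[ℝ] ℝ) S q.1 :=
          (hasFDerivWithinAt_const (0 : ℝ) q.1 S).congr (fun p hp => h0 p hp) (h0 _ hq.1)
        rw [hpm]
        exact (hS q.1 hq.1).eq h1 h2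
      refine ContinuousWithinAt.add (ContinuousWithinAt.add ?_ ?_) hlast
      · have e1 : Tendsto (fun q => (h' (polarMap q)).comp ((ContinuousLinearMap.inl ℝ P ℝ).comp
            (ContinuousLinearMap.fst ℝ P (ℝ × ℝ)))) (𝓝[S ×ˢ (univ : Set (ℝ × ℝ))] q) (𝓝 0) := by
          have := (hcT q hq).clm_comp (continuousWithinAt_const
            (b := (ContinuousLinearMap.inl ℝ P ℝ).comp (ContinuousLinearMap.fst ℝ P (ℝ × ℝ))))
          rw [ContinuousWithinAt, ← ContinuousLinearMap.comp_assoc, hin,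
            ContinuousLinearMap.zero_comp] at this
          exact this
        have := tendsto_zero_smul_of_bounded hbd e1
        rw [ContinuousWithinAt]
        simp only [hr, div_zero, zero_smul]
        exact this
      · have e2 : Tendsto (fun q => h' (polarMap q) (0, 1) - κ (polarMap q))
            (𝓝[S ×ˢ (univ : Set (ℝ × ℝ))] q) (𝓝 0) := by
          have := ((hcT q hq).clm_apply (continuousWithinAt_const (b := ((0 : P), (1 : ℝ))))).sub
            (hκT q hq)
          rw [ContinuousWithinAt] at this
          have hz : h' (polarMap q) (0, 1) - κ (polarMap q) = 0 := by
            rw [hpm]; simp [hκdef, normalQuot]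
          have this' : Tendsto (fun q => h' (polarMap q) (0, 1) - κ (polarMap q))
              (𝓝[S ×ˢ (univ : Set (ℝ × ℝ))] q) (𝓝 (h' (polarMap q) (0, 1) - κ (polarMap q))) := this
          rwa [hz] at this'
        have e3 : Tendsto (fun q => (h' (polarMap q) (0, 1) - κ (polarMap q)) • pairNormDeriv q)
            (𝓝[S ×ˢ (univ : Set (ℝ × ℝ))] q) (𝓝 0) := by
          have hn := e2.norm.mul_const (‖(coordA : P × ℝ × ℝ →L[ℝ] ℝ)‖ +
            ‖(coordB : P × ℝ × ℝ →L[ℝ] ℝ)‖)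
          simp only [norm_zero, zero_mul] at hn
          refine squeeze_zero_norm (fun x => ?_) hn
          rw [norm_smul]
          exact mul_le_mul_of_nonneg_left (norm_pairNormDeriv_le x) (norm_nonneg _)
        have := tendsto_zero_smul_of_bounded hbd e3
        rw [ContinuousWithinAt]
        simp only [hr, div_zero, zero_smul]
        exact this
    · have hcq : ContinuousWithinAt (fun q => c q / pairNorm q) (S ×ˢ (univ : Set (ℝ × ℝ))) q :=
        (ContinuousAt.div c.continuous.continuousAt continuous_pairNorm.continuousAt
          hr).continuousWithinAt
      refine ContinuousWithinAt.add (ContinuousWithinAt.add ?_ ?_) hlast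
      · exact hcq.smul ((hcT q hq).clm_comp continuousWithinAt_const)
      · exact hcq.smul ((((hcT q hq).clm_apply continuousWithinAt_const).sub (hκT q hq)).smul
          (continuousAt_pairNormDeriv hr).continuousWithinAt)
  · by_cases hr : pairNorm q = 0
    · have hcq : c q = 0 := abs_nonpos_iff.1 (hr ▸ hcr q)
      have e : D' q = κ (polarMap q) • c := by simp [D', hr]
      rw [e]
      simp only [hk]
      refine HasFDerivWithinAt.of_isLittleO ?_
      have h1 : (fun x => κ (polarMap x) - κ (polarMap q)) =o[𝓝[S ×ˢ (univ : Set (ℝ × ℝ))] q]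
          (fun _ => (1 : ℝ)) := by
        rw [Asymptotics.isLittleO_one_iff]
        exact tendsto_sub_nhds_zero_iff.2 (hκT q hq)
      have h2 : (fun x => c (x - q)) =O[𝓝[S ×ˢ (univ : Set (ℝ × ℝ))] q] (fun x => x - q) :=
        c.isBigO_sub _ _
      have h3 := h1.mul_isBigO h2.norm_right
      simp only [one_mul] at h3
      refine (h3.of_norm_right).congr_left fun x => ?_
      simp [hcq]; ring
    · have h1 := (hd _ (mapsTo_polarMap S hq)).comp q
        (hasFDerivAt_polarMap hr).hasFDerivWithinAt (mapsTo_polarMap S)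
      have h2 := ((hasDerivAt_inv hr).comp_hasFDerivAt q (hasFDerivAt_pairNorm hr)).hasFDerivWithinAt
        (s := S ×ˢ (univ : Set (ℝ × ℝ)))
      have h3 := h1.mul ((c.hasFDerivWithinAt (x := q)
        (s := S ×ˢ (univ : Set (ℝ × ℝ)))).mul h2)
      simp only [div_eq_mul_inv]
      refine h3.congr_fderiv (ContinuousLinearMap.ext fun v => ?_)
      have hκq : κ (polarMap q) = h (polarMap q) / pairNorm q := if_neg hr
      have hv : ((v.1, pairNormDeriv q v) : P × ℝ) =
          (v.1, 0) + pairNormDeriv q v • ((0 : P), (1 : ℝ)) := by simp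
      simp only [D', ContinuousLinearMap.comp_apply, ContinuousLinearMap.prod_apply,
        add_apply, smul_apply, ContinuousLinearMap.coe_fst', ContinuousLinearMap.inl_apply,
        Function.comp, smul_eq_mul, Pi.mul_apply]
      rw [hv, map_add, map_smul, hκq, smul_eq_mul]
      field_simp
      ring

/-- A `C²` function of `(p, s)`, `s ≥ 0`, with vanishing normal derivative at `s = 0` becomes a `C²`
function of `(p, a, b)` after the substitution `s = √(a² + b²)`. The derivative has the components
`g_p(p, r)`, `g_s(p, r) a / r` and `g_s(p, r) b / r`, each of which is `C¹`. -/
lemma contDiffOn_two_comp_polarMap {S : Set P} (hS : Convex ℝ S) (hS' : (interior S).Nonempty)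
    {g : P × ℝ → ℝ} (hg : ContDiffOn ℝ 2 g (S ×ˢ Ici (0 : ℝ)))
    (h0 : ∀ p ∈ S, fderivWithin ℝ g (S ×ˢ Ici (0 : ℝ)) (p, 0) (0, 1) = 0) :
    ContDiffOn ℝ 2 (fun q => g (polarMap q)) (S ×ˢ (univ : Set (ℝ × ℝ))) := by
  have hSu : UniqueDiffOn ℝ S := uniqueDiffOn_convex hS hS'
  have hD : UniqueDiffOn ℝ (S ×ˢ Ici (0 : ℝ)) := hSu.prod (uniqueDiffOn_Ici 0)
  set D := S ×ˢ Ici (0 : ℝ) with hDdef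
  set g' := fderivWithin ℝ g D with hg'
  have hd : ∀ z ∈ D, HasFDerivWithinAt g (g' z) D z := fun z hz =>
    (hg.differentiableOn two_ne_zero z hz).hasFDerivWithinAt
  have hg1 : ContDiffOn ℝ 1 g' D := hg.fderivWithin hD (by norm_num)
  have hd2 : ∀ z ∈ D, HasFDerivWithinAt g' (fderivWithin ℝ g' D z) D z := fun z hz =>
    (hg1.differentiableOn one_ne_zero z hz).hasFDerivWithinAt
  have hT := uniqueDiffOn_prod_univ hSu
  rw [show (2 : WithTop ℕ∞) = 1 + 1 by rfl,
    contDiffOn_succ_iff_hasFDerivWithinAt_of_uniqueDiffOn hT]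
  refine ⟨by simp, _, ?_, fun q hq => hasFDerivWithinAt_comp_polarMap hd h0 hq⟩
  have e : ∀ x : P × ℝ × ℝ, (g' (polarMap x)).comp
      ((ContinuousLinearMap.fst ℝ P (ℝ × ℝ)).prod (pairNormDeriv x)) =
      ((g' (polarMap x)).comp (ContinuousLinearMap.inl ℝ P ℝ)).comp
        (ContinuousLinearMap.fst ℝ P (ℝ × ℝ)) +
      ((g' (polarMap x) (0, 1) * (coordA x / pairNorm x)) • coordA +
        (g' (polarMap x) (0, 1) * (coordB x / pairNorm x)) • coordB) := by
    intro x
    refine ContinuousLinearMap.ext fun v => ?_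
    have : ((v.1, pairNormDeriv x v) : P × ℝ) =
        (v.1, 0) + pairNormDeriv x v • ((0 : P), (1 : ℝ)) := by simp
    simp only [ContinuousLinearMap.comp_apply, ContinuousLinearMap.prod_apply,
      add_apply, smul_apply, ContinuousLinearMap.coe_fst', ContinuousLinearMap.inl_apply]
    rw [this, map_add, map_smul]
    simp only [pairNormDeriv, add_apply, smul_apply, smul_eq_mul, coordA_apply, coordB_apply]
    ring
  -- the mixed derivative `∂_s g_p` vanishes at `s = 0`, by symmetry of the second derivative
  have hmixed : ∀ p ∈ S, ∀ v : P, fderivWithin ℝ g' D (p, 0) (0, 1) (v, 0) = 0 := by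
    intro p hp v
    have hpD : (p, (0 : ℝ)) ∈ D := ⟨hp, le_refl (0 : ℝ)⟩
    have hcl : (p, (0 : ℝ)) ∈ closure (interior D) := by
      have hconv : Convex ℝ D := hS.prod (convex_Ici 0)
      have hne : (interior D).Nonempty := by
        rw [hDdef, interior_prod_eq]
        exact hS'.prod (by simp)
      rw [hconv.closure_interior_eq_closure_of_nonempty_interior hne]
      exact subset_closure hpD
    have hsymm := (hg _ hpD).isSymmSndFDerivWithinAt (by simp) hD hcl hpD
    rw [hsymm.eq]
    have h1 : HasFDerivWithinAt (fun p : P => g' (p, 0) (0, 1))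
        (((ContinuousLinearMap.apply ℝ ℝ ((0 : P), (1 : ℝ))).comp
          (fderivWithin ℝ g' D (p, 0))).comp (ContinuousLinearMap.inl ℝ P ℝ)) S p := by
      have := (ContinuousLinearMap.apply ℝ ℝ ((0 : P), (1 : ℝ))).hasFDerivAt.comp_hasFDerivWithinAt
        _ (hd2 _ hpD)
      exact this.comp p ((ContinuousLinearMap.inl ℝ P ℝ).hasFDerivWithinAt (s := S) (x := p))
        (fun p hp => (⟨hp, le_refl (0 : ℝ)⟩ : (p, (0 : ℝ)) ∈ D))
    have h2 : HasFDerivWithinAt (fun p : P => g' (p, 0) (0, 1)) (0 : P →L[ℝ] ℝ) S p :=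
      (hasFDerivWithinAt_const (0 : ℝ) p S).congr (fun p hp => h0 p hp) (h0 _ hp)
    have := congrArg (fun L : P →L[ℝ] ℝ => L v) ((hSu p hp).eq h1 h2)
    simpa using this
  have hgs : ContDiffOn ℝ 1 (fun z => g' z (0, 1)) D := hg1.clm_apply contDiffOn_const
  refine ContDiffOn.congr (ContDiffOn.add ?_ (ContDiffOn.add ?_ ?_)) (fun x _ => e x)
  · refine ContDiffOn.clm_comp ?_ contDiffOn_const
    refine contDiffOn_one_comp_polarMap hSu
      (h := fun z => (g' z).comp (ContinuousLinearMap.inl ℝ P ℝ))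
      (hg1.clm_comp contDiffOn_const) fun p hp => ?_
    have hpD : (p, (0 : ℝ)) ∈ D := ⟨hp, le_refl (0 : ℝ)⟩
    have h1 := (((ContinuousLinearMap.compL ℝ P (P × ℝ) ℝ).flip
      (ContinuousLinearMap.inl ℝ P ℝ)).hasFDerivAt (x := g' (p, 0))).comp_hasFDerivWithinAt
      _ (hd2 _ hpD)
    have h2 : fderivWithin ℝ (fun z => (g' z).comp (ContinuousLinearMap.inl ℝ P ℝ)) D (p, 0) = _ :=
      h1.fderivWithin (hD _ hpD)
    rw [h2]
    refine ContinuousLinearMap.ext fun v => ?_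
    simpa using hmixed p hp v
  · exact (contDiffOn_one_mul_div_pairNorm hSu hgs h0 abs_coordA_le).smul contDiffOn_const
  · exact (contDiffOn_one_mul_div_pairNorm hSu hgs h0 abs_coordB_le).smul contDiffOn_const

end RadialLiftTwo

/-! ### Even functions on the orthant as smooth functions of `(a, b)` -/

section OrthantLift

variable {ι : Type} [Fintype ι] [DecidableEq ι]

lemma convex_partial_orthant (s : Finset ι) :
    Convex ℝ {p : (ι → ℝ) × (ι → ℝ) | ∀ i, i ∉ s → 0 ≤ p.1 i} := by
  intro p hp q hq a b ha hb _ i hi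
  have h1 := hp i hi
  have h2 := hq i hi
  simp only [Prod.fst_add, Prod.smul_fst, Pi.add_apply, Pi.smul_apply, smul_eq_mul]
  positivity

lemma interior_partial_orthant_nonempty (s : Finset ι) :
    (interior {p : (ι → ℝ) × (ι → ℝ) | ∀ i, i ∉ s → 0 ≤ p.1 i}).Nonempty := by
  refine ⟨(fun _ => 1, 0), mem_interior.2 ⟨{p | ∀ i, 0 < p.1 i}, fun p hp i _ => (hp i).le, ?_,
    fun i => one_pos⟩⟩
  simp only [ofPred_forall]
  exact isOpen_iInter_of_finite fun i => isOpen_lt continuous_const (by fun_prop)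

/-- A `C²` function on the closed orthant whose normal derivatives vanish on the faces lifts, by
`x_i = √(a_i² + b_i²)`, to a `C²` function of `(a, b)`. The substitution is made one variable at
a time. -/
lemma contDiff_two_comp_sqrt {g : (ι → ℝ) → ℝ} (hg : ContDiffOn ℝ 2 g {x | ∀ i, 0 ≤ x i})
    (h0 : ∀ i, ∀ x : ι → ℝ, (∀ j, 0 ≤ x j) →
      derivWithin (fun σ => g (Function.update x i σ)) (Ici 0) 0 = 0) :
    ContDiff ℝ 2 (fun p : (ι → ℝ) × (ι → ℝ) =>
      g (fun i => Real.sqrt (p.1 i ^ 2 + p.2 i ^ 2))) := by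
  have key : ∀ s : Finset ι, ContDiffOn ℝ 2 (fun p : (ι → ℝ) × (ι → ℝ) =>
      g (fun i => if i ∈ s then Real.sqrt (p.1 i ^ 2 + p.2 i ^ 2) else p.1 i))
      {p | ∀ i, i ∉ s → 0 ≤ p.1 i} := by
    intro s
    induction s using Finset.induction_on with
    | empty =>
      simp only [Finset.notMem_empty, if_false, not_false_eq_true, forall_true_left]
      exact hg.comp contDiff_fst.contDiffOn fun p hp => hp
    | insert i s hi ih =>
      set S := {p : (ι → ℝ) × (ι → ℝ) | ∀ j, j ∉ insert i s → 0 ≤ p.1 j} with hS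
      set F := fun p : (ι → ℝ) × (ι → ℝ) =>
        g (fun j => if j ∈ s then Real.sqrt (p.1 j ^ 2 + p.2 j ^ 2) else p.1 j) with hF
      have hmap : ContDiff ℝ 2 (fun z : ((ι → ℝ) × (ι → ℝ)) × ℝ =>
          (Function.update z.1.1 i z.2, z.1.2)) := by
        refine ContDiff.prodMk (contDiff_pi.2 fun j => ?_) (by fun_prop)
        by_cases hj : j = i
        · subst hj; simpa using contDiff_snd
        · simp only [Function.update_of_ne hj]; fun_prop
      have hmaps : MapsTo (fun z : ((ι → ℝ) × (ι → ℝ)) × ℝ =>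
          (Function.update z.1.1 i z.2, z.1.2)) (S ×ˢ Ici (0 : ℝ))
          {p | ∀ j, j ∉ s → 0 ≤ p.1 j} := by
        intro z hz j hj
        by_cases hji : j = i
        · subst hji; simpa using hz.2
        · simpa [Function.update_of_ne hji] using hz.1 j (by simp [hj, hji])
      have hG : ContDiffOn ℝ 2 (fun z : ((ι → ℝ) × (ι → ℝ)) × ℝ =>
          F (Function.update z.1.1 i z.2, z.1.2)) (S ×ˢ Ici (0 : ℝ)) :=
        ih.comp hmap.contDiffOn hmaps
      have hSu := uniqueDiffOn_convex (convex_partial_orthant (insert i s))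
        (interior_partial_orthant_nonempty (insert i s))
      have hG0 : ∀ p ∈ S, fderivWithin ℝ (fun z : ((ι → ℝ) × (ι → ℝ)) × ℝ =>
          F (Function.update z.1.1 i z.2, z.1.2)) (S ×ˢ Ici (0 : ℝ)) (p, 0) (0, 1) = 0 := by
        intro p hp
        have hpD : (p, (0 : ℝ)) ∈ S ×ˢ Ici (0 : ℝ) := ⟨hp, le_refl (0 : ℝ)⟩
        have h1 := (hG.differentiableOn two_ne_zero _ hpD).hasFDerivWithinAt
        have h2 : HasDerivWithinAt (fun σ : ℝ => (p, σ)) (0, (1 : ℝ)) (Ici 0) 0 :=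
          (hasDerivWithinAt_const (0 : ℝ) _ p).prodMk (hasDerivWithinAt_id (0 : ℝ) _)
        have h3 := h1.comp_hasDerivWithinAt (0 : ℝ) h2 (t := S ×ˢ Ici (0 : ℝ))
          (fun σ hσ => ⟨hp, hσ⟩)
        rw [← h3.derivWithin (uniqueDiffOn_Ici (0 : ℝ) 0 (le_refl (0 : ℝ)))]
        set z : ι → ℝ := Function.update
          (fun j => if j ∈ s then Real.sqrt (p.1 j ^ 2 + p.2 j ^ 2) else p.1 j) i 0 with hz
        have hz0 : ∀ j, 0 ≤ z j := by
          intro j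
          by_cases hji : j = i
          · subst hji; simp [hz]
          · simp only [hz, Function.update_of_ne hji]
            split_ifs with hj
            · exact Real.sqrt_nonneg _
            · exact hp j (by simp [hj, hji])
        refine Eq.trans ?_ (h0 i z hz0)
        congr 1
        funext σ
        simp only [Function.comp, hF]
        congr 1
        funext j
        by_cases hji : j = i
        · subst hji; simp [hi]
        · simp [hz, Function.update_of_ne hji]
      have h5 := contDiffOn_two_comp_polarMap (convex_partial_orthant (insert i s))
        (interior_partial_orthant_nonempty (insert i s)) hG hG0
      have h6 : ContDiff ℝ 2 (fun p : (ι → ℝ) × (ι → ℝ) => (p, p.1 i, p.2 i)) := by fun_prop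
      refine (h5.comp h6.contDiffOn (t := S ×ˢ (univ : Set (ℝ × ℝ)))
        (fun p hp => ⟨hp, mem_univ _⟩)).congr fun p _ => ?_
      simp only [Function.comp, hF, polarMap, pairNorm]
      congr 1
      funext j
      by_cases hji : j = i
      · subst hji; simp [hi]
      · simp [hji]
  have := key Finset.univ
  simpa [contDiffOn_univ] using this

end OrthantLift

variable {n : ℕ}

/-- The vector with coordinates `√(a_i² + b_i²)`. -/
def sqrtVec (a b : EuclideanSpace ℝ (Fin n)) : EuclideanSpace ℝ (Fin n) :=
  WithLp.toLp 2 fun i => Real.sqrt (a i ^ 2 + b i ^ 2)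

lemma sqrtVec_apply (a b : EuclideanSpace ℝ (Fin n)) (i : Fin n) :
    sqrtVec a b i = Real.sqrt (a i ^ 2 + b i ^ 2) := rfl

lemma setCoord_apply (x : EuclideanSpace ℝ (Fin n)) (i j : Fin n) (s : ℝ) :
    setCoord x i s j = if j = i then s else x j := by
  simp [setCoord, Function.update_apply]

lemma contDiff_comp_sqrtVec {f : EuclideanSpace ℝ (Fin n) → ℝ} (hf : IsC2Even f) :
    ContDiff ℝ 2 (fun p : EuclideanSpace ℝ (Fin n) × EuclideanSpace ℝ (Fin n) =>
      f (sqrtVec p.1 p.2)) := by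
  have h1 : ContDiffOn ℝ 2 (fun x : Fin n → ℝ => f (WithLp.toLp 2 x)) {x | ∀ i, 0 ≤ x i} :=
    hf.1.comp (by fun_prop) fun x hx => hx
  have h2 := contDiff_two_comp_sqrt h1 fun i x hx => hf.2 i (WithLp.toLp 2 x) hx
  exact h2.comp (f := fun p : EuclideanSpace ℝ (Fin n) × EuclideanSpace ℝ (Fin n) =>
    (WithLp.ofLp p.1, WithLp.ofLp p.2)) (by fun_prop)

/-- The time variable is treated as one more coordinate of the orthant, lifted with second planar
coordinate `0`, so that `√(t²) = |t|`: a function with zero initial velocity extends evenly to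
negative times. -/
lemma contDiff_comp_sqrtVec_abs {v : EuclideanSpace ℝ (Fin n) → ℝ → ℝ}
    (hv : ContDiffOn ℝ 2 (fun p : EuclideanSpace ℝ (Fin n) × ℝ => v p.1 p.2)
      (closedOrthant n ×ˢ Ici (0 : ℝ)))
    (hx : ∀ t, 0 ≤ t → EvenInEach (fun x => v x t))
    (ht : ∀ x ∈ closedOrthant n, derivWithin (v x) (Ici 0) 0 = 0) :
    ContDiff ℝ 2 (fun p : (EuclideanSpace ℝ (Fin n) × EuclideanSpace ℝ (Fin n)) × ℝ =>
      v (sqrtVec p.1.1 p.1.2) |p.2|) := by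
  have h1 : ContDiffOn ℝ 2 (fun z : Option (Fin n) → ℝ =>
      v (WithLp.toLp 2 fun i => z (some i)) (z none)) {z | ∀ i, 0 ≤ z i} :=
    hv.comp (f := fun z : Option (Fin n) → ℝ => (WithLp.toLp 2 (fun i => z (some i)), z none))
      (by fun_prop) fun z hz => ⟨fun i => hz (some i), hz none⟩
  have h2 := contDiff_two_comp_sqrt h1 ?_
  · have h3 := h2.comp (f := fun p : (EuclideanSpace ℝ (Fin n) × EuclideanSpace ℝ (Fin n)) × ℝ =>
      ((fun i => Option.elim i p.2 p.1.1 : Option (Fin n) → ℝ),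
        (fun i => Option.elim i 0 p.1.2 : Option (Fin n) → ℝ))) ?_
    · convert h3 using 1
      funext p
      simp only [Function.comp, Option.elim, sqrtVec]
      congr 1
      simp [Real.sqrt_sq_eq_abs]
    · refine ContDiff.prodMk (contDiff_pi.2 fun i => ?_) (contDiff_pi.2 fun i => ?_)
      · cases i <;> simp only [Option.elim] <;> fun_prop
      · cases i <;> simp only [Option.elim] <;> fun_prop
  · intro i z hz
    cases i with
    | none =>
      simpa using ht (WithLp.toLp 2 fun i => z (some i)) fun i => hz (some i)
    | some i =>
      have := hx (z none) (hz none) i (WithLp.toLp 2 fun i => z (some i)) fun i => hz (some i)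
      refine Eq.trans ?_ this
      congr 1
      funext σ
      simp only [setCoord, ne_eq, reduceCtorEq, not_false_eq_true, Function.update_of_ne]
      congr 2
      funext j
      simp [Function.update_apply]

/-! ### Integrals depending on a parameter -/

section ParametricIntegral

variable {E₀ : Type} [NormedAddCommGroup E₀] [NormedSpace ℝ E₀] [FiniteDimensional ℝ E₀]
  {Z : Type} [NormedAddCommGroup Z] [NormedSpace ℝ Z] [FiniteDimensional ℝ Z]
  [MeasurableSpace Z] [BorelSpace Z]
  {μ : Measure Z} [IsFiniteMeasure μ] {K : Set Z}

lemma restrict_eq_self_of_compl_null (hμ : μ Kᶜ = 0) : μ.restrict K = μ :=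
  Measure.restrict_eq_self_of_ae_mem (mem_ae_iff.2 hμ)

lemma integrable_of_continuous_of_compact {G : Type} [NormedAddCommGroup G] (hK : IsCompact K)
    (hμ : μ Kᶜ = 0) {g : Z → G} (hg : Continuous g) : Integrable g μ := by
  have : ProperSpace Z := FiniteDimensional.proper ℝ Z
  rw [← restrict_eq_self_of_compl_null hμ]
  exact hg.continuousOn.integrableOn_compact hK

lemma continuous_integral_of_compact {G : Type} [NormedAddCommGroup G] [NormedSpace ℝ G]
    (hK : IsCompact K) (hμ : μ Kᶜ = 0) {H : E₀ × Z → G} (hH : Continuous H) :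
    Continuous fun p => ∫ z, H (p, z) ∂μ := by
  have : ProperSpace Z := FiniteDimensional.proper ℝ Z
  have : ProperSpace E₀ := FiniteDimensional.proper ℝ E₀
  have := continuous_parametric_integral_of_continuous (μ := μ) (f := fun p z => H (p, z))
    (by exact hH) hK
  rwa [restrict_eq_self_of_compl_null hμ] at this

/-- Differentiation under the integral sign; compactness of `K` bounds the derivative. -/
lemma hasFDerivAt_integral_of_compact {G : Type} [NormedAddCommGroup G] [NormedSpace ℝ G]
    (hK : IsCompact K) (hμ : μ Kᶜ = 0) {H : E₀ × Z → G} (hH : ContDiff ℝ 1 H) (p : E₀) :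
    HasFDerivAt (fun p => ∫ z, H (p, z) ∂μ)
      (∫ z, (fderiv ℝ H (p, z)).comp (ContinuousLinearMap.inl ℝ E₀ Z) ∂μ) p := by
  have : ProperSpace Z := FiniteDimensional.proper ℝ Z
  have : ProperSpace E₀ := FiniteDimensional.proper ℝ E₀
  set H' : E₀ × Z → (E₀ →L[ℝ] G) :=
    fun q => (fderiv ℝ H q).comp (ContinuousLinearMap.inl ℝ E₀ Z) with hH'
  have hc : Continuous H' := (hH.continuous_fderiv one_ne_zero).clm_comp continuous_const
  obtain ⟨C, hC⟩ := ((isCompact_closedBall p 1).prod hK).exists_bound_of_continuousOn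
    hc.continuousOn
  refine hasFDerivAt_integral_of_dominated_of_fderiv_le (F := fun p z => H (p, z))
    (F' := fun p z => H' (p, z)) (bound := fun _ => C)
    (Metric.closedBall_mem_nhds p one_pos) ?_ ?_ ?_ ?_ (integrable_const C) ?_
  · exact Eventually.of_forall fun x =>
      (integrable_of_continuous_of_compact hK hμ
        (hH.continuous.comp (Continuous.prodMk_right x))).aestronglyMeasurable
  · exact integrable_of_continuous_of_compact hK hμ (hH.continuous.comp (Continuous.prodMk_right p))
  · exact (integrable_of_continuous_of_compact hK hμ
      (hc.comp (Continuous.prodMk_right p))).aestronglyMeasurable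
  · have hmem : ∀ᵐ z ∂μ, z ∈ K := mem_ae_iff.2 hμ
    filter_upwards [hmem] with z hz x hx using hC (x, z) ⟨hx, hz⟩
  · refine Eventually.of_forall fun z x _ => ?_
    have h1 := (hH.differentiable one_ne_zero (x, z)).hasFDerivAt
    exact h1.comp x (hasFDerivAt_prodMk_left x z)

/-- Integration over a compactly supported finite measure preserves `C^m` dependence. -/
lemma contDiff_integral_of_compact (hK : IsCompact K) (hμ : μ Kᶜ = 0) (m : ℕ) :
    ∀ {G : Type} [NormedAddCommGroup G] [NormedSpace ℝ G] {H : E₀ × Z → G}, ContDiff ℝ m H →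
      ContDiff ℝ m fun p => ∫ z, H (p, z) ∂μ := by
  induction m with
  | zero =>
    intro G _ _ H hH
    rw [Nat.cast_zero, contDiff_zero] at *
    exact continuous_integral_of_compact hK hμ hH
  | succ m ih =>
    intro G _ _ H hH
    have h1 : ContDiff ℝ 1 H := hH.of_le (by norm_cast; omega)
    rw [Nat.cast_succ, contDiff_succ_iff_hasFDerivAt]
    refine ⟨_, ?_, fun p => hasFDerivAt_integral_of_compact hK hμ h1 p⟩
    refine ih (H := fun q : E₀ × Z => (fderiv ℝ H q).comp (ContinuousLinearMap.inl ℝ E₀ Z)) ?_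
    exact (hH.fderiv_right (by norm_cast)).clm_comp contDiff_const

lemma hasDerivAt_slice {h : ℝ × Z → ℝ} (hh : ContDiff ℝ 1 h) (s : ℝ) (z : Z) :
    HasDerivAt (fun s => h (s, z)) (fderiv ℝ h (s, z) (1, 0)) s := by
  have h1 := (hh.differentiable one_ne_zero (s, z)).hasFDerivAt
  have h2 : HasDerivAt (fun s : ℝ => (s, z)) ((1 : ℝ), (0 : Z)) s :=
    (hasDerivAt_id s).prodMk (hasDerivAt_const s z)
  exact h1.comp_hasDerivAt s h2

lemma hasDerivAt_integral_of_compact (hK : IsCompact K) (hμ : μ Kᶜ = 0) {h : ℝ × Z → ℝ}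
    (hh : ContDiff ℝ 1 h) (s : ℝ) :
    HasDerivAt (fun s => ∫ z, h (s, z) ∂μ) (∫ z, fderiv ℝ h (s, z) (1, 0) ∂μ) s := by
  have h1 := (hasFDerivAt_integral_of_compact hK hμ hh s).hasDerivAt
  rw [ContinuousLinearMap.integral_apply] at h1
  · simpa using h1
  · exact integrable_of_continuous_of_compact hK hμ
      (((hh.continuous_fderiv one_ne_zero).clm_comp continuous_const).comp
        (Continuous.prodMk_right s))

lemma contDiff_fderiv_slice {h : ℝ × Z → ℝ} (hh : ContDiff ℝ 2 h) :
    ContDiff ℝ 1 fun q : ℝ × Z => fderiv ℝ h q (1, 0) :=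
  (hh.fderiv_right (m := 1) (by norm_num)).clm_apply contDiff_const

lemma besselOp_slice {h : ℝ × Z → ℝ} (hh : ContDiff ℝ 2 h) (κ s : ℝ) (z : Z) :
    besselOp κ (fun s => h (s, z)) s =
      fderiv ℝ (fun q : ℝ × Z => fderiv ℝ h q (1, 0)) (s, z) (1, 0) +
        κ / s * fderiv ℝ h (s, z) (1, 0) := by
  have h1 : deriv (fun s => h (s, z)) = fun s => fderiv ℝ h (s, z) (1, 0) :=
    funext fun s => (hasDerivAt_slice (hh.of_le (by norm_num)) s z).deriv
  rw [besselOp, h1, (hasDerivAt_slice (contDiff_fderiv_slice hh) s z).deriv]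

lemma continuous_besselOp_slice {h : ℝ × Z → ℝ} (hh : ContDiff ℝ 2 h) (κ s : ℝ) :
    Continuous fun z => besselOp κ (fun s => h (s, z)) s := by
  simp only [besselOp_slice hh]
  have h1 := (contDiff_fderiv_slice hh).continuous_fderiv one_ne_zero
  have h2 := (contDiff_fderiv_slice hh).continuous
  exact ((h1.clm_apply continuous_const).comp (Continuous.prodMk_right s)).add
    ((h2.comp (Continuous.prodMk_right s)).const_mul _)

/-- Bessel operators commute with integration in a parameter. -/
lemma besselOp_integral (hK : IsCompact K) (hμ : μ Kᶜ = 0) {h : ℝ × Z → ℝ}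
    (hh : ContDiff ℝ 2 h) (κ s : ℝ) :
    besselOp κ (fun s => ∫ z, h (s, z) ∂μ) s = ∫ z, besselOp κ (fun s => h (s, z)) s ∂μ := by
  have h1 : deriv (fun s => ∫ z, h (s, z) ∂μ) = fun s => ∫ z, fderiv ℝ h (s, z) (1, 0) ∂μ :=
    funext fun s => (hasDerivAt_integral_of_compact hK hμ (hh.of_le (by norm_num)) s).deriv
  have c1 := (contDiff_fderiv_slice hh).continuous_fderiv one_ne_zero
  have c2 := (contDiff_fderiv_slice hh).continuous
  rw [besselOp, h1, (hasDerivAt_integral_of_compact hK hμ (contDiff_fderiv_slice hh) s).deriv,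
    ← integral_const_mul, ← integral_add]
  · simp only [besselOp_slice hh]
  · exact integrable_of_continuous_of_compact hK hμ
      ((c1.clm_apply continuous_const).comp (Continuous.prodMk_right s))
  · exact (integrable_of_continuous_of_compact hK hμ
      (c2.comp (Continuous.prodMk_right s))).const_mul _

lemma contDiff_setCoord {n : ℕ} {m : WithTop ℕ∞} (i : Fin n) :
    ContDiff ℝ m fun p : EuclideanSpace ℝ (Fin n) × ℝ => setCoord p.1 i p.2 := by
  unfold setCoord
  refine (PiLp.contDiff_toLp).comp (contDiff_pi.2 fun j => ?_)
  by_cases hj : j = i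
  · subst hj; simpa using contDiff_snd
  · simp only [Function.update_of_ne hj]; fun_prop

lemma laplaceBessel_integral {n : ℕ} (hK : IsCompact K) (hμ : μ Kᶜ = 0)
    {h : EuclideanSpace ℝ (Fin n) × Z → ℝ} (hh : ContDiff ℝ 2 h) (γ : Fin n → ℝ)
    (x : EuclideanSpace ℝ (Fin n)) :
    laplaceBessel γ (fun x => ∫ z, h (x, z) ∂μ) x =
      ∫ z, laplaceBessel γ (fun x => h (x, z)) x ∂μ := by
  have hi : ∀ i, ContDiff ℝ 2 fun q : ℝ × Z => h (setCoord x i q.1, q.2) := fun i =>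
    hh.comp (ContDiff.prodMk ((contDiff_setCoord i).comp
      (contDiff_const.prodMk contDiff_fst)) contDiff_snd)
  unfold laplaceBessel
  rw [integral_finsetSum]
  · exact Finset.sum_congr rfl fun i _ => besselOp_integral hK hμ (hi i) (γ i) (x i)
  · exact fun i _ => integrable_of_continuous_of_compact hK hμ
      (continuous_besselOp_slice (hi i) (γ i) (x i))

end ParametricIntegral

section Update

variable {n : ℕ}

/-- Two functions have the same integral against a product measure as soon as their partial
integrals in one variable agree. -/
lemma integral_pi_congr_update {ν : Fin n → Measure ℝ} [∀ i, SigmaFinite (ν i)]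
    {φ₁ φ₂ : (Fin n → ℝ) → ℝ} (h₁ : Integrable φ₁ (Measure.pi ν))
    (h₂ : Integrable φ₂ (Measure.pi ν)) (i : Fin n)
    (h : ∀ α : Fin n → ℝ, ∫ s, φ₁ (Function.update α i s) ∂(ν i) =
      ∫ s, φ₂ (Function.update α i s) ∂(ν i)) :
    ∫ α, φ₁ α ∂(Measure.pi ν) = ∫ α, φ₂ α ∂(Measure.pi ν) := by
  cases n with
  | zero => exact i.elim0
  | succ m =>
    have hmp := (measurePreserving_piFinSuccAbove ν i).symm
    have key : ∀ {φ : (Fin (m + 1) → ℝ) → ℝ}, Integrable φ (Measure.pi ν) →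
        ∫ α, φ α ∂(Measure.pi ν) =
          ∫ y, ∫ s, φ (i.insertNth s y) ∂(ν i) ∂(Measure.pi fun j => ν (i.succAbove j)) := by
      intro φ hφ
      rw [← hmp.integral_comp' φ]
      rw [integral_prod_symm]
      · rfl
      · exact (hmp.integrable_comp_emb (MeasurableEquiv.measurableEmbedding _)).2 hφ
    rw [key h₁, key h₂]
    refine integral_congr_ae (Eventually.of_forall fun y => ?_)
    have := h (i.insertNth 0 y)
    simpa [Fin.update_insertNth] using this

end Update

/-! ### Densities, Beta integrals and the sine measure -/

section Density

variable {X : Type} [MeasurableSpace X] {μ : Measure X} {w : X → ℝ}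

/-- The measure with density `w` with respect to `μ`, for a real-valued `w ≥ 0`. -/
def densityMeasure (μ : Measure X) (w : X → ℝ) : Measure X :=
  μ.withDensity fun x => ENNReal.ofReal (w x)

lemma integral_densityMeasure (hw : Measurable w) (h0 : ∀ᵐ x ∂μ, 0 ≤ w x) (g : X → ℝ) :
    ∫ x, g x ∂(densityMeasure μ w) = ∫ x, w x * g x ∂μ := by
  rw [densityMeasure, integral_withDensity_eq_integral_toReal_smul hw.ennreal_ofReal
    (Eventually.of_forall fun _ => ENNReal.ofReal_lt_top)]
  refine integral_congr_ae ?_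
  filter_upwards [h0] with x hx
  rw [ENNReal.toReal_ofReal hx, smul_eq_mul]

lemma integrable_densityMeasure (hw : Measurable w) (h0 : ∀ᵐ x ∂μ, 0 ≤ w x) {g : X → ℝ} :
    Integrable g (densityMeasure μ w) ↔ Integrable (fun x => w x * g x) μ := by
  rw [densityMeasure, integrable_withDensity_iff_integrable_smul' hw.ennreal_ofReal
    (Eventually.of_forall fun _ => ENNReal.ofReal_lt_top)]
  refine integrable_congr ?_
  filter_upwards [h0] with x hx
  rw [ENNReal.toReal_ofReal hx, smul_eq_mul]

lemma isProbabilityMeasure_densityMeasure (hi : Integrable w μ) (h0 : ∀ᵐ x ∂μ, 0 ≤ w x)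
    (h1 : ∫ x, w x ∂μ = 1) : IsProbabilityMeasure (densityMeasure μ w) := by
  refine ⟨?_⟩
  rw [densityMeasure, withDensity_apply _ MeasurableSet.univ, Measure.restrict_univ,
    ← ofReal_integral_eq_lintegral_ofReal hi h0, h1, ENNReal.ofReal_one]

lemma densityMeasure_absolutelyContinuous : densityMeasure μ w ≪ μ :=
  withDensity_absolutelyContinuous _ _

end Density

section Beta

/-- Read off from the normalization of the Beta distribution. -/
lemma integral_beta {p q : ℝ} (hp : 0 < p) (hq : 0 < q) :
    IntegrableOn (fun x : ℝ => x ^ (p - 1) * (1 - x) ^ (q - 1)) (Ioo 0 1) ∧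
      ∫ x in Ioo (0 : ℝ) 1, x ^ (p - 1) * (1 - x) ^ (q - 1) = ProbabilityTheory.beta p q := by
  have hb := ProbabilityTheory.beta_pos hp hq
  have h1 := ProbabilityTheory.lintegral_betaPDF_eq_one hp hq
  rw [ProbabilityTheory.lintegral_betaPDF] at h1
  set w : ℝ → ℝ := fun x => 1 / ProbabilityTheory.beta p q * x ^ (p - 1) * (1 - x) ^ (q - 1) with hw
  have hm : Measurable w := by fun_prop
  have h0 : 0 ≤ᵐ[volume.restrict (Ioo (0 : ℝ) 1)] w := by
    refine ae_restrict_of_forall_mem measurableSet_Ioo fun x hx => ?_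
    have h1 : 0 ≤ 1 - x := by linarith [hx.2]
    have h2 : 0 ≤ x := hx.1.le
    simp only [hw, Pi.zero_apply]
    positivity
  have hi : IntegrableOn w (Ioo 0 1) := by
    refine ⟨hm.aestronglyMeasurable, ?_⟩
    rw [hasFiniteIntegral_iff_ofReal h0, h1]
    exact ENNReal.one_lt_top
  have hI : ∫ x in Ioo (0 : ℝ) 1, w x = 1 := by
    rw [integral_eq_lintegral_of_nonneg_ae h0 hm.aestronglyMeasurable, h1, ENNReal.toReal_one]
  have e : (fun x : ℝ => x ^ (p - 1) * (1 - x) ^ (q - 1)) =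
      fun x => ProbabilityTheory.beta p q * w x := by
    funext x
    simp only [hw]
    field_simp
  rw [e]
  refine ⟨hi.const_mul _, ?_⟩
  rw [integral_const_mul, hI, mul_one]

/-- The Beta integral after the substitution of `x²` for `x`. -/
lemma integral_beta_sq {p q : ℝ} (hp : 0 < p) (hq : 0 < q) :
    IntegrableOn (fun x : ℝ => x ^ (2 * p - 1) * (1 - x ^ 2) ^ (q - 1)) (Ioo 0 1) ∧
      ∫ x in Ioo (0 : ℝ) 1, x ^ (2 * p - 1) * (1 - x ^ 2) ^ (q - 1) =
        ProbabilityTheory.beta p q / 2 := by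
  have himg : (fun x : ℝ => x ^ 2) '' Ioo 0 1 = Ioo 0 1 := by
    ext y
    constructor
    · rintro ⟨x, hx, rfl⟩
      exact ⟨pow_pos hx.1 2, pow_lt_one₀ hx.1.le hx.2 two_ne_zero⟩
    · intro hy
      refine ⟨Real.sqrt y, ⟨Real.sqrt_pos.2 hy.1, ?_⟩, Real.sq_sqrt hy.1.le⟩
      rw [Real.sqrt_lt' one_pos]
      simpa using hy.2
  have hd : ∀ x ∈ Ioo (0 : ℝ) 1, HasDerivWithinAt (fun x : ℝ => x ^ 2) (2 * x) (Ioo 0 1) x := by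
    intro x _
    simpa using (hasDerivAt_pow 2 x).hasDerivWithinAt
  have hinj : InjOn (fun x : ℝ => x ^ 2) (Ioo 0 1) := fun x hx y hy h =>
    (pow_left_inj₀ hx.1.le hy.1.le two_ne_zero).1 h
  obtain ⟨hi, hI⟩ := integral_beta hp hq
  have h1 := (integrableOn_image_iff_integrableOn_abs_deriv_smul measurableSet_Ioo hd hinj
    (fun x : ℝ => x ^ (p - 1) * (1 - x) ^ (q - 1))).1 (by rwa [himg])
  have h2 := integral_image_eq_integral_abs_deriv_smul measurableSet_Ioo hd hinj
    (fun x : ℝ => x ^ (p - 1) * (1 - x) ^ (q - 1))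
  rw [himg, hI] at h2
  have e : EqOn (fun x : ℝ => |2 * x| • ((x ^ 2) ^ (p - 1) * (1 - x ^ 2) ^ (q - 1)))
      (fun x => 2 * (x ^ (2 * p - 1) * (1 - x ^ 2) ^ (q - 1))) (Ioo 0 1) := by
    intro x hx
    have hx0 := hx.1
    have : (x ^ 2) ^ (p - 1) * x = x ^ (2 * p - 1) := by
      rw [← Real.rpow_natCast, ← Real.rpow_mul hx0.le]
      nth_rewrite 2 [← Real.rpow_one x]
      rw [← Real.rpow_add hx0]
      congr 1
      push_cast
      ring
    simp only [smul_eq_mul]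
    rw [abs_of_pos (by positivity), ← this]
    ring
  rw [integrableOn_congr_fun e measurableSet_Ioo] at h1
  rw [setIntegral_congr_fun measurableSet_Ioo e, integral_const_mul] at h2
  refine ⟨?_, by linarith⟩
  have := h1.const_mul (1 / 2)
  refine this.congr (Eventually.of_forall fun x => ?_)
  simp only
  ring

lemma integral_sin_rpow_half {a : ℝ} (ha : 0 < a) :
    IntegrableOn (fun α : ℝ => Real.sin α ^ (a - 1)) (Ioo 0 (Real.pi / 2)) ∧
      ∫ α in Ioo (0 : ℝ) (Real.pi / 2), Real.sin α ^ (a - 1) =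
        ProbabilityTheory.beta (a / 2) (1 / 2) / 2 := by
  have hcos : ∀ α ∈ Ioo (0 : ℝ) (Real.pi / 2), 0 < Real.cos α := fun α hα =>
    Real.cos_pos_of_mem_Ioo ⟨by linarith [hα.1, Real.pi_pos], hα.2⟩
  have himg : Real.sin '' Ioo 0 (Real.pi / 2) = Ioo 0 1 := by
    ext y
    constructor
    · rintro ⟨x, hx, rfl⟩
      refine ⟨Real.sin_pos_of_pos_of_lt_pi hx.1 (by linarith [hx.2, Real.pi_pos]), ?_⟩
      rw [← Real.sin_pi_div_two]
      exact Real.sin_lt_sin_of_lt_of_le_pi_div_two (by linarith [hx.1, Real.pi_pos]) le_rfl hx.2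
    · intro hy
      exact ⟨Real.arcsin y, ⟨Real.arcsin_pos.2 hy.1, Real.arcsin_lt_pi_div_two.2 hy.2⟩,
        Real.sin_arcsin (by linarith [hy.1]) hy.2.le⟩
  have hd : ∀ x ∈ Ioo (0 : ℝ) (Real.pi / 2),
      HasDerivWithinAt Real.sin (Real.cos x) (Ioo 0 (Real.pi / 2)) x :=
    fun x _ => (Real.hasDerivAt_sin x).hasDerivWithinAt
  have hsub : Ioo 0 (Real.pi / 2) ⊆ Icc (-(Real.pi / 2)) (Real.pi / 2) := fun x hx =>
    ⟨by linarith [hx.1, Real.pi_pos], hx.2.le⟩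
  have hinj : InjOn Real.sin (Ioo 0 (Real.pi / 2)) := Real.injOn_sin.mono hsub
  obtain ⟨hi, hI⟩ := integral_beta_sq (half_pos ha) (one_half_pos (α := ℝ))
  have h1 := (integrableOn_image_iff_integrableOn_abs_deriv_smul measurableSet_Ioo hd hinj
    (fun x : ℝ => x ^ (2 * (a / 2) - 1) * (1 - x ^ 2) ^ ((1 / 2 : ℝ) - 1))).1 (by rwa [himg])
  have h2 := integral_image_eq_integral_abs_deriv_smul measurableSet_Ioo hd hinj
    (fun x : ℝ => x ^ (2 * (a / 2) - 1) * (1 - x ^ 2) ^ ((1 / 2 : ℝ) - 1))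
  rw [himg, hI] at h2
  have e : EqOn (fun x : ℝ => |Real.cos x| • (Real.sin x ^ (2 * (a / 2) - 1) *
      (1 - Real.sin x ^ 2) ^ ((1 / 2 : ℝ) - 1)))
      (fun x => Real.sin x ^ (a - 1)) (Ioo 0 (Real.pi / 2)) := by
    intro x hx
    have hc := hcos x hx
    have h3 : (1 - Real.sin x ^ 2) ^ ((1 / 2 : ℝ) - 1) = (Real.cos x)⁻¹ := by
      rw [← Real.cos_sq', ← Real.rpow_natCast, ← Real.rpow_mul hc.le, ← Real.rpow_neg_one]
      congr 1
      norm_num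
    simp only [smul_eq_mul]
    rw [abs_of_pos hc, h3, show 2 * (a / 2) - 1 = a - 1 by ring]
    field_simp
  rw [integrableOn_congr_fun e measurableSet_Ioo] at h1
  rw [setIntegral_congr_fun measurableSet_Ioo e] at h2
  exact ⟨h1, h2.symm⟩

lemma integral_sin_rpow {a : ℝ} (ha : 0 < a) :
    IntervalIntegrable (fun α : ℝ => Real.sin α ^ (a - 1)) volume 0 Real.pi ∧
      ∫ α in (0 : ℝ)..Real.pi, Real.sin α ^ (a - 1) = ProbabilityTheory.beta (a / 2) (1 / 2) := by
  obtain ⟨hi, hI⟩ := integral_sin_rpow_half ha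
  have hpi : (0 : ℝ) ≤ Real.pi / 2 := by positivity
  have h1 : IntervalIntegrable (fun α : ℝ => Real.sin α ^ (a - 1)) volume 0 (Real.pi / 2) := by
    rw [intervalIntegrable_iff_integrableOn_Ioo_of_le hpi]; exact hi
  have h1' : ∫ α in (0 : ℝ)..(Real.pi / 2), Real.sin α ^ (a - 1) =
      ProbabilityTheory.beta (a / 2) (1 / 2) / 2 := by
    rw [intervalIntegral.integral_of_le hpi, integral_Ioc_eq_integral_Ioo, hI]
  have h2 := h1.comp_sub_left Real.pi
  simp only [Real.sin_pi_sub, sub_zero] at h2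
  rw [show Real.pi - Real.pi / 2 = Real.pi / 2 by ring] at h2
  have h2' := intervalIntegral.integral_comp_sub_left (a := 0) (b := Real.pi / 2)
    (fun α : ℝ => Real.sin α ^ (a - 1)) Real.pi
  simp only [Real.sin_pi_sub, sub_zero] at h2'
  rw [show Real.pi - Real.pi / 2 = Real.pi / 2 by ring, h1'] at h2'
  refine ⟨h1.trans h2.symm, ?_⟩
  rw [← intervalIntegral.integral_add_adjacent_intervals h1 h2.symm, h1', ← h2']
  ring

end Beta

section SineMeasure

/-- The normalizing constant of the one-dimensional generalized translation. -/
def sineConst (a : ℝ) : ℝ :=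
  Real.Gamma ((a + 1) / 2) / (Real.Gamma (a / 2) * Real.Gamma (1 / 2))

/-- The probability measure `C sin^{a-1} α dα` on `(0, π)` that defines the generalized
translation. -/
def sineMeasure (a : ℝ) : Measure ℝ :=
  densityMeasure (volume.restrict (Ioc 0 Real.pi)) fun α => sineConst a * Real.sin α ^ (a - 1)

variable {a : ℝ}

lemma sineConst_pos (ha : 0 < a) : 0 < sineConst a := by
  have h1 := Real.Gamma_pos_of_pos (show 0 < (a + 1) / 2 by linarith)
  have h2 := Real.Gamma_pos_of_pos (show 0 < a / 2 by linarith)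
  have h3 := Real.Gamma_pos_of_pos (show (0 : ℝ) < 1 / 2 by norm_num)
  unfold sineConst
  positivity

lemma measurable_sineDensity : Measurable fun α : ℝ => sineConst a * Real.sin α ^ (a - 1) := by
  fun_prop

lemma sineDensity_nonneg (ha : 0 < a) :
    ∀ᵐ α ∂(volume.restrict (Ioc 0 Real.pi)), 0 ≤ sineConst a * Real.sin α ^ (a - 1) := by
  refine ae_restrict_of_forall_mem measurableSet_Ioc fun α hα => ?_
  exact mul_nonneg (sineConst_pos ha).le
    (Real.rpow_nonneg (Real.sin_nonneg_of_nonneg_of_le_pi hα.1.le hα.2) _)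

lemma isProbabilityMeasure_sineMeasure (ha : 0 < a) : IsProbabilityMeasure (sineMeasure a) := by
  obtain ⟨hi, hI⟩ := integral_sin_rpow ha
  rw [intervalIntegrable_iff_integrableOn_Ioc_of_le Real.pi_pos.le] at hi
  rw [intervalIntegral.integral_of_le Real.pi_pos.le] at hI
  refine isProbabilityMeasure_densityMeasure (hi.const_mul _) (sineDensity_nonneg ha) ?_
  rw [integral_const_mul, hI, sineConst, ProbabilityTheory.beta,
    show a / 2 + 1 / 2 = (a + 1) / 2 by ring]
  have h1 := (Real.Gamma_pos_of_pos (show 0 < (a + 1) / 2 by linarith)).ne'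
  have h2 := (Real.Gamma_pos_of_pos (show 0 < a / 2 by linarith)).ne'
  have h3 := (Real.Gamma_pos_of_pos (show (0 : ℝ) < 1 / 2 by norm_num)).ne'
  field_simp

lemma integral_sineMeasure (ha : 0 < a) (g : ℝ → ℝ) :
    ∫ α, g α ∂(sineMeasure a) =
      sineConst a * ∫ α in (0 : ℝ)..Real.pi, g α * Real.sin α ^ (a - 1) := by
  rw [sineMeasure, integral_densityMeasure measurable_sineDensity (sineDensity_nonneg ha),
    intervalIntegral.integral_of_le Real.pi_pos.le, ← integral_const_mul]
  refine integral_congr_ae (Eventually.of_forall fun α => ?_)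
  simp only
  ring

lemma sineMeasure_compl (a : ℝ) : sineMeasure a (Icc 0 Real.pi)ᶜ = 0 := by
  refine densityMeasure_absolutelyContinuous ?_
  rw [Measure.restrict_apply measurableSet_Icc.compl]
  convert! measure_empty (μ := (volume : Measure ℝ))
  ext x
  simp only [mem_inter_iff, mem_compl_iff, mem_Icc, mem_Ioc, mem_empty_iff_false, iff_false]
  rintro ⟨h1, h2⟩
  exact h1 ⟨h2.1.le, h2.2⟩

lemma ae_sineMeasure_mem (a : ℝ) : ∀ᵐ α ∂(sineMeasure a), α ∈ Ioo 0 Real.pi := by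
  refine densityMeasure_absolutelyContinuous.ae_le ?_
  rw [← restrict_Ioo_eq_restrict_Ioc]
  exact ae_restrict_mem measurableSet_Ioo

end SineMeasure

/-! ### Partial derivatives of even functions -/

section CoordinateDerivatives

variable {n : ℕ}

/-- Global evenness in each variable. -/
def GloballyEven (w : EuclideanSpace ℝ (Fin n) → ℝ) : Prop :=
  ∀ i x s, w (setCoord x i (-s)) = w (setCoord x i s)

/-- The partial derivative `∂w/∂x_i`. -/
def partialDeriv (i : Fin n) (w : EuclideanSpace ℝ (Fin n) → ℝ)
    (x : EuclideanSpace ℝ (Fin n)) : ℝ := fderiv ℝ w x (EuclideanSpace.single i 1)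

@[simp] lemma setCoord_same (x : EuclideanSpace ℝ (Fin n)) (i : Fin n) (s : ℝ) :
    setCoord x i s i = s := by simp [setCoord_apply]

@[simp] lemma setCoord_setCoord (x : EuclideanSpace ℝ (Fin n)) (i : Fin n) (s t : ℝ) :
    setCoord (setCoord x i s) i t = setCoord x i t := by
  ext j; by_cases hj : j = i <;> simp [setCoord_apply, hj]

@[simp] lemma setCoord_self (x : EuclideanSpace ℝ (Fin n)) (i : Fin n) :
    setCoord x i (x i) = x := by
  ext j; by_cases hj : j = i <;> simp [setCoord_apply, hj]

lemma setCoord_eq_add (x : EuclideanSpace ℝ (Fin n)) (i : Fin n) (s : ℝ) :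
    setCoord x i s = x + (s - x i) • EuclideanSpace.single i (1 : ℝ) := by
  ext j
  by_cases hj : j = i
  · subst hj; simp
  · simp [setCoord_apply, hj]

lemma hasDerivAt_setCoord (x : EuclideanSpace ℝ (Fin n)) (i : Fin n) (s : ℝ) :
    HasDerivAt (fun s => setCoord x i s) (EuclideanSpace.single i 1) s := by
  simp only [setCoord_eq_add]
  have h := (((hasDerivAt_id s).sub_const (x i)).smul_const
    (EuclideanSpace.single i (1 : ℝ))).const_add x
  simpa using h

lemma hasDerivAt_comp_setCoord {w : EuclideanSpace ℝ (Fin n) → ℝ} (hw : ContDiff ℝ 1 w)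
    (x : EuclideanSpace ℝ (Fin n)) (i : Fin n) (s : ℝ) :
    HasDerivAt (fun s => w (setCoord x i s)) (partialDeriv i w (setCoord x i s)) s :=
  (hw.differentiable one_ne_zero _).hasFDerivAt.comp_hasDerivAt s (hasDerivAt_setCoord x i s)

lemma contDiff_partialDeriv {w : EuclideanSpace ℝ (Fin n) → ℝ} (hw : ContDiff ℝ 2 w)
    (i : Fin n) : ContDiff ℝ 1 (partialDeriv i w) :=
  (hw.fderiv_right (m := 1) (by norm_num)).clm_apply contDiff_const

lemma continuous_partialDeriv {w : EuclideanSpace ℝ (Fin n) → ℝ} (hw : ContDiff ℝ 1 w)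
    (i : Fin n) : Continuous (partialDeriv i w) :=
  (hw.continuous_fderiv one_ne_zero).clm_apply continuous_const

lemma besselOp_setCoord {w : EuclideanSpace ℝ (Fin n) → ℝ} (hw : ContDiff ℝ 2 w) (κ : ℝ)
    (x : EuclideanSpace ℝ (Fin n)) (i : Fin n) (s : ℝ) :
    besselOp κ (fun s => w (setCoord x i s)) s =
      partialDeriv i (partialDeriv i w) (setCoord x i s) +
        κ / s * partialDeriv i w (setCoord x i s) := by
  have h1 : deriv (fun s => w (setCoord x i s)) = fun s => partialDeriv i w (setCoord x i s) :=
    funext fun s => (hasDerivAt_comp_setCoord (hw.of_le (by norm_num)) x i s).deriv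
  rw [besselOp, h1, (hasDerivAt_comp_setCoord (contDiff_partialDeriv hw i) x i s).deriv]

lemma laplaceBessel_eq {w : EuclideanSpace ℝ (Fin n) → ℝ} (hw : ContDiff ℝ 2 w) (γ : Fin n → ℝ)
    (x : EuclideanSpace ℝ (Fin n)) :
    laplaceBessel γ w x = ∑ i, (partialDeriv i (partialDeriv i w) x +
      γ i / x i * partialDeriv i w x) := by
  refine Finset.sum_congr rfl fun i _ => ?_
  rw [besselOp_setCoord hw, setCoord_self]

/-- An even differentiable function of `x_i` has derivative zero at `x_i = 0`. -/
lemma GloballyEven.partialDeriv_eq_zero {w : EuclideanSpace ℝ (Fin n) → ℝ} (he : GloballyEven w)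
    (hw : ContDiff ℝ 1 w) (i : Fin n) (x : EuclideanSpace ℝ (Fin n)) :
    partialDeriv i w (setCoord x i 0) = 0 := by
  have h1 := hasDerivAt_comp_setCoord hw x i 0
  have h2 : HasDerivAt (fun s => w (setCoord x i s)) (-partialDeriv i w (setCoord x i 0)) 0 := by
    have h1' : HasDerivAt (fun s => w (setCoord x i s)) (partialDeriv i w (setCoord x i 0))
        (-0) := by simpa using h1
    have h3 := h1'.scomp (0 : ℝ) (hasDerivAt_neg (0 : ℝ))
    have e : (fun s => w (setCoord x i s)) ∘ (fun s : ℝ => -s) = fun s => w (setCoord x i s) :=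
      funext fun s => he i x s
    change HasDerivAt ((fun s => w (setCoord x i s)) ∘ (fun s : ℝ => -s)) _ _ at h3
    rw [e] at h3
    simpa using h3
  have := h1.unique h2
  linarith

lemma norm_setCoord_le {x : EuclideanSpace ℝ (Fin n)} {i : Fin n} {s : ℝ} (h : |s| ≤ |x i|) :
    ‖setCoord x i s‖ ≤ ‖x‖ := by
  rw [EuclideanSpace.norm_eq, EuclideanSpace.norm_eq]
  refine Real.sqrt_le_sqrt (Finset.sum_le_sum fun j _ => ?_)
  by_cases hj : j = i
  · subst hj; simpa using sq_le_sq.2 h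
  · simp [setCoord_apply, hj]

/-- On bounded sets the normal derivative of an even `C²` function is `O(x_i)`. -/
lemma GloballyEven.abs_partialDeriv_le {w : EuclideanSpace ℝ (Fin n) → ℝ} (he : GloballyEven w)
    (hw : ContDiff ℝ 2 w) (R : ℝ) :
    ∃ C, 0 ≤ C ∧ ∀ i, ∀ x : EuclideanSpace ℝ (Fin n), ‖x‖ ≤ R →
      |partialDeriv i w x| ≤ C * |x i| ∧ |partialDeriv i (partialDeriv i w) x| ≤ C := by
  have hc : ∀ i, ∃ C, ∀ x ∈ Metric.closedBall (0 : EuclideanSpace ℝ (Fin n)) R,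
      ‖partialDeriv i (partialDeriv i w) x‖ ≤ C := fun i =>
    (isCompact_closedBall _ _).exists_bound_of_continuousOn
      (continuous_partialDeriv (contDiff_partialDeriv hw i) i).continuousOn
  choose C hC using hc
  refine ⟨∑ i, |C i|, Finset.sum_nonneg fun i _ => abs_nonneg _, fun i x hx => ?_⟩
  have hCi : C i ≤ ∑ i, |C i| := (le_abs_self _).trans
    (Finset.single_le_sum (f := fun i => |C i|) (fun i _ => abs_nonneg _) (Finset.mem_univ i))
  refine ⟨?_, (hC i x (by simpa using hx)).trans hCi⟩
  have hder : ∀ τ ∈ uIcc 0 (x i), HasDerivWithinAt (fun s => partialDeriv i w (setCoord x i s))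
      (partialDeriv i (partialDeriv i w) (setCoord x i τ)) (uIcc 0 (x i)) τ := fun τ _ =>
    (hasDerivAt_comp_setCoord (contDiff_partialDeriv hw i) x i τ).hasDerivWithinAt
  have hb : ∀ τ ∈ uIcc 0 (x i), ‖partialDeriv i (partialDeriv i w) (setCoord x i τ)‖ ≤ C i := by
    intro τ hτ
    refine hC i _ ?_
    have : |τ| ≤ |x i| := by
      have := abs_sub_left_of_mem_uIcc hτ
      simpa using this
    simpa using (norm_setCoord_le this).trans hx
  have hm := Convex.norm_image_sub_le_of_norm_hasDerivWithin_le hder hb (convex_uIcc 0 (x i))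
    left_mem_uIcc right_mem_uIcc
  rw [setCoord_self, he.partialDeriv_eq_zero (hw.of_le (by norm_num)), sub_zero, sub_zero,
    Real.norm_eq_abs, Real.norm_eq_abs] at hm
  exact hm.trans (mul_le_mul_of_nonneg_right hCi (abs_nonneg _))

/-- The Bessel operators applied to an even `C²` function are bounded on bounded sets. -/
lemma GloballyEven.abs_besselOp_le {w : EuclideanSpace ℝ (Fin n) → ℝ} (he : GloballyEven w)
    (hw : ContDiff ℝ 2 w) (κ R : ℝ) :
    ∃ C, ∀ i, ∀ x : EuclideanSpace ℝ (Fin n), ‖x‖ ≤ R →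
      |besselOp κ (fun s => w (setCoord x i s)) (x i)| ≤ C := by
  obtain ⟨C, hC0, hC⟩ := he.abs_partialDeriv_le hw R
  refine ⟨C + |κ| * C, fun i x hx => ?_⟩
  obtain ⟨h1, h2⟩ := hC i x hx
  rw [besselOp_setCoord hw, setCoord_self]
  refine (abs_add_le _ _).trans (add_le_add h2 ?_)
  rw [abs_mul, abs_div, div_mul_eq_mul_div, mul_div_assoc]
  refine mul_le_mul_of_nonneg_left ?_ (abs_nonneg _)
  exact div_le_of_le_mul₀ (abs_nonneg _) hC0 h1

lemma measurable_besselOp_setCoord {w : EuclideanSpace ℝ (Fin n) → ℝ} (hw : ContDiff ℝ 2 w)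
    (κ : ℝ) (i : Fin n) :
    Measurable fun x : EuclideanSpace ℝ (Fin n) =>
      besselOp κ (fun s => w (setCoord x i s)) (x i) := by
  simp only [besselOp_setCoord hw, setCoord_self]
  have h1 := (continuous_partialDeriv (contDiff_partialDeriv hw i) i).measurable
  have h2 := (contDiff_partialDeriv hw i).continuous.measurable
  have h3 : Measurable fun x : EuclideanSpace ℝ (Fin n) => x i := by fun_prop
  exact h1.add ((measurable_const.div h3).mul h2)

end CoordinateDerivatives

/-! ### The one-dimensional generalized translation -/

section OneDimensionalTranslation

/-- The distance `√(x² + s² - 2 x s cos α)`, written as a Euclidean norm in the plane. -/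
def triDist (x s α : ℝ) : ℝ :=
  Real.sqrt ((x - s * Real.cos α) ^ 2 + (s * Real.sin α) ^ 2)

lemma triDist_eq (x s α : ℝ) :
    triDist x s α = Real.sqrt (x ^ 2 + s ^ 2 - 2 * x * s * Real.cos α) := by
  rw [triDist]
  congr 1
  linear_combination (s ^ 2) * Real.sin_sq_add_cos_sq α

lemma triDist_nonneg (x s α : ℝ) : 0 ≤ triDist x s α := Real.sqrt_nonneg _

lemma triDist_sq (x s α : ℝ) :
    triDist x s α ^ 2 = x ^ 2 + s ^ 2 - 2 * x * s * Real.cos α := by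
  rw [triDist, Real.sq_sqrt (by positivity)]
  linear_combination (s ^ 2) * Real.sin_sq_add_cos_sq α

lemma triDist_neg_right (x s α : ℝ) : triDist x (-s) α = triDist x s (Real.pi - α) := by
  rw [triDist_eq, triDist_eq, Real.cos_pi_sub]; congr 1; ring

lemma triDist_comm (x s α : ℝ) : triDist x s α = triDist s x α := by
  rw [triDist_eq, triDist_eq]; congr 1; ring

lemma triDist_zero (x α : ℝ) : triDist x 0 α = |x| := by
  rw [triDist_eq, ← Real.sqrt_sq_eq_abs]; congr 1; ring

lemma continuous_triDist : Continuous fun q : ℝ × ℝ × ℝ => triDist q.1 q.2.1 q.2.2 := by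
  unfold triDist; fun_prop

lemma triDist_pos {s α : ℝ} (x : ℝ) (hs : 0 < s) (hα : α ∈ Ioo 0 Real.pi) :
    0 < triDist x s α := by
  have := Real.sin_pos_of_mem_Ioo hα
  exact Real.sqrt_pos.2 (by positivity)

lemma triDist_le {x s α : ℝ} (hx : 0 ≤ x) (hs : 0 ≤ s) : triDist x s α ≤ x + s := by
  rw [triDist_eq]
  refine Real.sqrt_le_iff.2 ⟨by positivity, ?_⟩
  nlinarith [Real.neg_one_le_cos α, mul_nonneg hx hs]

lemma hasDerivAt_triDist {s α : ℝ} (x : ℝ) (hs : 0 < s) (hα : α ∈ Ioo 0 Real.pi) :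
    HasDerivAt (fun s => triDist x s α) ((s - x * Real.cos α) / triDist x s α) s := by
  have h1 : HasDerivAt (fun s : ℝ => x ^ 2 + s ^ 2 - 2 * x * s * Real.cos α)
      (2 * s - 2 * x * Real.cos α) s := by
    have := ((hasDerivAt_pow 2 s).const_add (x ^ 2)).sub
      (((hasDerivAt_id s).const_mul (2 * x)).mul_const (Real.cos α))
    refine this.congr_deriv ?_
    simp
  have h0 : x ^ 2 + s ^ 2 - 2 * x * s * Real.cos α ≠ 0 := by
    rw [← triDist_sq]; exact (pow_pos (triDist_pos x hs hα) 2).ne'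
  have h2 := h1.sqrt h0
  have e : (fun s => triDist x s α) =
      fun s => Real.sqrt (x ^ 2 + s ^ 2 - 2 * x * s * Real.cos α) :=
    funext fun s => triDist_eq x s α
  rw [e, triDist_eq]
  refine h2.congr_deriv ?_
  rw [show 2 * s - 2 * x * Real.cos α = 2 * (s - x * Real.cos α) by ring,
    mul_div_mul_left _ _ two_ne_zero]

lemma hasDerivAt_triDist_angle {s α : ℝ} (x : ℝ) (hs : 0 < s) (hα : α ∈ Ioo 0 Real.pi) :
    HasDerivAt (fun α => triDist x s α) (x * s * Real.sin α / triDist x s α) α := by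
  have h1 : HasDerivAt (fun α : ℝ => x ^ 2 + s ^ 2 - 2 * x * s * Real.cos α)
      (2 * (x * s * Real.sin α)) α := by
    have := ((Real.hasDerivAt_cos α).const_mul (2 * x * s)).const_sub (x ^ 2 + s ^ 2)
    refine this.congr_deriv ?_
    ring
  have h0 : x ^ 2 + s ^ 2 - 2 * x * s * Real.cos α ≠ 0 := by
    rw [← triDist_sq]; exact (pow_pos (triDist_pos x hs hα) 2).ne'
  have h2 := h1.sqrt h0
  have e : (fun α => triDist x s α) =
      fun α => Real.sqrt (x ^ 2 + s ^ 2 - 2 * x * s * Real.cos α) :=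
    funext fun α => triDist_eq x s α
  rw [e, triDist_eq]
  refine h2.congr_deriv ?_
  rw [mul_div_mul_left _ _ two_ne_zero]

variable {g : ℝ → ℝ}

lemma besselOp_comp_triDist (hg : ContDiff ℝ 2 g) (a : ℝ) {x s α : ℝ} (hs : 0 < s)
    (hα : α ∈ Ioo 0 Real.pi) :
    besselOp a (fun s => g (triDist x s α)) s =
      deriv (deriv g) (triDist x s α) * ((s - x * Real.cos α) / triDist x s α) ^ 2 +
      deriv g (triDist x s α) * (1 / triDist x s α -
        (s - x * Real.cos α) ^ 2 / triDist x s α ^ 3) +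
      a / s * (deriv g (triDist x s α) * ((s - x * Real.cos α) / triDist x s α)) := by
  have hg' : ContDiff ℝ 1 (deriv g) := ((contDiff_succ_iff_deriv (n := 1)).1 hg).2.2
  have hd : ∀ r, HasDerivAt g (deriv g r) r := fun r =>
    (hg.differentiable two_ne_zero r).hasDerivAt
  have hd' : ∀ r, HasDerivAt (deriv g) (deriv (deriv g) r) r := fun r =>
    (hg'.differentiable one_ne_zero r).hasDerivAt
  have h1 : ∀ σ, 0 < σ → HasDerivAt (fun s => g (triDist x s α))
      (deriv g (triDist x σ α) * ((σ - x * Real.cos α) / triDist x σ α)) σ := fun σ hσ =>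
    (hd _).comp σ (hasDerivAt_triDist x hσ hα)
  have h2 : deriv (fun s => g (triDist x s α)) =ᶠ[𝓝 s]
      fun σ => deriv g (triDist x σ α) * ((σ - x * Real.cos α) / triDist x σ α) := by
    filter_upwards [lt_mem_nhds hs] with σ hσ using (h1 σ hσ).deriv
  have hr := (triDist_pos x hs hα).ne'
  have h3 : HasDerivAt (fun σ => deriv g (triDist x σ α) *
      ((σ - x * Real.cos α) / triDist x σ α)) _ s :=
    ((hd' _).comp s (hasDerivAt_triDist x hs hα)).mul
      (((hasDerivAt_id s).sub_const (x * Real.cos α)).div (hasDerivAt_triDist x hs hα) hr)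
  rw [besselOp, h2.deriv_eq, h3.deriv, h2.eq_of_nhds]
  simp only [id, Function.comp]
  field_simp

/-- In polar coordinates `(s, α)` about `x`, the Bessel operator in `s` and the one of the radial
function differ by an exact `α`-derivative, once multiplied by the density of the translation. -/
lemma hasDerivAt_angular_flux (hg : ContDiff ℝ 2 g) (a : ℝ) {x s α : ℝ} (hs : 0 < s)
    (hα : α ∈ Ioo 0 Real.pi) :
    HasDerivAt (fun α => Real.sin α ^ a * (x * s) *
        (deriv g (triDist x s α) / triDist x s α))
      (s ^ 2 * ((besselOp a g (triDist x s α) - besselOp a (fun s => g (triDist x s α)) s) *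
        Real.sin α ^ (a - 1))) α := by
  have hg' : ContDiff ℝ 1 (deriv g) := ((contDiff_succ_iff_deriv (n := 1)).1 hg).2.2
  have hd' : ∀ r, HasDerivAt (deriv g) (deriv (deriv g) r) r := fun r =>
    (hg'.differentiable one_ne_zero r).hasDerivAt
  have hS := Real.sin_pos_of_mem_Ioo hα
  have hr := triDist_pos x hs hα
  have h1 := ((Real.hasDerivAt_sin α).rpow_const (p := a) (Or.inl hS.ne')).mul_const (x * s)
  have h2 := ((hd' _).comp α (hasDerivAt_triDist_angle x hs hα)).div
    (hasDerivAt_triDist_angle x hs hα) hr.ne'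
  refine (h1.mul h2).congr_deriv ?_
  rw [besselOp_comp_triDist hg a hs hα]
  have hpow : Real.sin α ^ a = Real.sin α * Real.sin α ^ (a - 1) := by
    rw [Real.rpow_sub_one hS.ne']; field_simp
  have hc : Real.cos α ^ 2 = 1 - Real.sin α ^ 2 := Real.cos_sq' α
  have hr2 := triDist_sq x s α
  simp only [Function.comp, besselOp, Pi.div_apply]
  rw [hpow]
  generalize deriv (deriv g) (triDist x s α) = g2
  generalize deriv g (triDist x s α) = g1
  generalize hrr : triDist x s α = r at *
  generalize Real.sin α ^ (a - 1) = p
  generalize Real.sin α = S at *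
  generalize Real.cos α = c at *
  have hrne := hr.ne'
  field_simp
  linear_combination (-(p * s * (g2 * r - g1))) * hr2 + (p * s * (g2 * r - g1) * x ^ 2) * hc

end OneDimensionalTranslation

section OneDimensionalTranslation

variable {g : ℝ → ℝ}

/-- The sine measure is invariant under `α ↦ π - α`; this makes the translation even in its step. -/
lemma integral_sineMeasure_reflect {a : ℝ} (ha : 0 < a) (h : ℝ → ℝ) :
    ∫ α, h (Real.pi - α) ∂(sineMeasure a) = ∫ α, h α ∂(sineMeasure a) := by
  rw [integral_sineMeasure ha, integral_sineMeasure ha]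
  have := intervalIntegral.integral_comp_sub_left (a := 0) (b := Real.pi)
    (fun α : ℝ => h α * Real.sin α ^ (a - 1)) Real.pi
  simp only [Real.sin_pi_sub, sub_zero, sub_self] at this
  rw [this]

/-- The flux extends continuously by `0` to `α = 0` and `α = π`, even if the triangle degenerates to
`triDist = 0` there, since `g'(r) / r` is bounded. -/
lemma continuousOn_angular_flux (hg : ContDiff ℝ 2 g) {a C : ℝ} (ha : 0 < a) {x s : ℝ}
    (hx : 0 < x) (hs : 0 < s) (hC : ∀ r, 0 < r → r ≤ x + s → |deriv g r| ≤ C * r) :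
    ContinuousOn (fun α => Real.sin α ^ a * (x * s) *
        (deriv g (triDist x s α) / triDist x s α)) (Icc 0 Real.pi) := by
  have hg' : Continuous (deriv g) := ((contDiff_succ_iff_deriv (n := 1)).1 hg).2.2.continuous
  have hct : Continuous fun α => triDist x s α :=
    continuous_triDist.comp (by fun_prop : Continuous fun α : ℝ => (x, s, α))
  have hsa : Continuous fun α => Real.sin α ^ a :=
    Real.continuous_sin.rpow_const fun _ => Or.inr ha.le
  have hquot : ∀ α, |deriv g (triDist x s α) / triDist x s α| ≤ |C| := by
    intro α
    by_cases h0 : triDist x s α = 0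
    · simp [h0]
    · have hp : 0 < triDist x s α := lt_of_le_of_ne (triDist_nonneg _ _ _) (Ne.symm h0)
      rw [abs_div, abs_of_pos hp, div_le_iff₀ hp]
      exact (hC _ hp (triDist_le hx.le hs.le)).trans
        (mul_le_mul_of_nonneg_right (le_abs_self C) hp.le)
  intro α hα
  refine ContinuousAt.continuousWithinAt ?_
  by_cases hS : Real.sin α = 0
  · have h1 := tendsto_zero_smul_of_bounded (l := 𝓝 α) hquot
      (X := fun β => Real.sin β ^ a * (x * s)) (by
        have := (hsa.mul_const (x * s)).tendsto α
        simpa [hS, Real.zero_rpow ha.ne'] using this)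
    rw [ContinuousAt]
    simp only [hS, Real.zero_rpow ha.ne', zero_mul]
    refine h1.congr fun β => ?_
    rw [smul_eq_mul, mul_comm]
  · have hr : triDist x s α ≠ 0 := by
      have : 0 < (s * Real.sin α) ^ 2 := by positivity
      exact (Real.sqrt_pos.2 (by positivity)).ne'
    exact (hsa.continuousAt.mul continuousAt_const).mul
      ((hg'.comp hct).continuousAt.div hct.continuousAt hr)

lemma integrable_besselOp_triDist (hg : ContDiff ℝ 2 g) {a C : ℝ} (ha : 0 < a) {x s : ℝ}
    (hx : 0 < x) (hs : 0 < s) (hC : ∀ r, 0 < r → r ≤ x + s → |deriv g r| ≤ C * r) :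
    Integrable (fun α => besselOp a g (triDist x s α)) (sineMeasure a) := by
  have := isProbabilityMeasure_sineMeasure ha
  have hg1 : ContDiff ℝ 1 (deriv g) := ((contDiff_succ_iff_deriv (n := 1)).1 hg).2.2
  have hg2 : Continuous (deriv (deriv g)) := hg1.continuous_deriv_one
  obtain ⟨C', hC'⟩ := (isCompact_Icc (a := (0 : ℝ)) (b := x + s)).exists_bound_of_continuousOn
    hg2.continuousOn
  have hct : Continuous fun α => triDist x s α :=
    continuous_triDist.comp (by fun_prop : Continuous fun α : ℝ => (x, s, α))
  refine Integrable.of_bound (C := C' + |a| * C) ?_ ?_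
  · unfold besselOp
    have h1 : Measurable fun α => deriv (deriv g) (triDist x s α) := (hg2.comp hct).measurable
    have h2 : Measurable fun α => deriv g (triDist x s α) := (hg1.continuous.comp hct).measurable
    exact (h1.add ((measurable_const.div hct.measurable).mul h2)).aestronglyMeasurable
  · filter_upwards [ae_sineMeasure_mem a] with α hα
    have hr := triDist_pos x hs hα
    have hr' := triDist_le (α := α) hx.le hs.le
    refine (norm_add_le _ _).trans (add_le_add (hC' _ ⟨hr.le, hr'⟩) ?_)
    rw [Real.norm_eq_abs, abs_mul, abs_div, div_mul_eq_mul_div, mul_div_assoc]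
    refine mul_le_mul_of_nonneg_left ?_ (abs_nonneg _)
    rw [abs_of_pos hr, div_le_iff₀ hr]
    exact hC _ hr hr'

/-- The generalized translation intertwines the Bessel operator in the step `s` with the Bessel
operator of the translated function. -/
lemma integral_besselOp_triDist (hg : ContDiff ℝ 2 g) {a C : ℝ} (ha : 0 < a) {x s : ℝ}
    (hx : 0 < x) (hs : 0 < s) (hC : ∀ r, 0 < r → r ≤ x + s → |deriv g r| ≤ C * r)
    (hint : Integrable (fun α => besselOp a (fun s => g (triDist x s α)) s) (sineMeasure a)) :
    ∫ α, besselOp a (fun s => g (triDist x s α)) s ∂(sineMeasure a) =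
      ∫ α, besselOp a g (triDist x s α) ∂(sineMeasure a) := by
  have hint2 := integrable_besselOp_triDist hg ha hx hs hC
  have hd := hint2.sub hint
  symm
  rw [← sub_eq_zero, ← integral_sub hint2 hint, integral_sineMeasure ha]
  have hD : IntervalIntegrable (fun α => s ^ 2 * ((besselOp a g (triDist x s α) -
      besselOp a (fun s => g (triDist x s α)) s) * Real.sin α ^ (a - 1))) volume 0 Real.pi := by
    rw [intervalIntegrable_iff_integrableOn_Ioc_of_le Real.pi_pos.le]
    rw [sineMeasure, integrable_densityMeasure measurable_sineDensity (sineDensity_nonneg ha)] at hd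
    have := hd.const_mul (s ^ 2 / sineConst a)
    refine this.congr (Eventually.of_forall fun α => ?_)
    have hc := (sineConst_pos ha).ne'
    simp only [Pi.sub_apply]
    field_simp
  -- the flux carries the factor `sin α ^ a`, so both boundary values are zero
  have hF := intervalIntegral.integral_eq_sub_of_hasDerivAt_of_le Real.pi_pos.le
    (continuousOn_angular_flux hg ha hx hs hC)
    (fun α hα => hasDerivAt_angular_flux hg a (x := x) hs hα) hD
  rw [intervalIntegral.integral_const_mul] at hF
  simp only [Real.sin_pi, Real.sin_zero, Real.zero_rpow ha.ne', zero_mul, sub_self] at hF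
  rcases mul_eq_zero.1 hF with h | h
  · exact absurd h (by positivity)
  · rw [h, mul_zero]

end OneDimensionalTranslation

/-! ### The multidimensional generalized translation -/

section MultidimensionalTranslation

variable {n : ℕ}

/-- The point at which the translated function is evaluated: its coordinates are
`√(x_i² + y_i² - 2 x_i y_i cos α_i)`. -/
def transPoint (x y : EuclideanSpace ℝ (Fin n)) (α : Fin n → ℝ) : EuclideanSpace ℝ (Fin n) :=
  WithLp.toLp 2 fun i => triDist (x i) (y i) (α i)

/-- The product over the variables of the probability measures of the one-dimensional generalized
translations. -/
def angleMeasure (γ : Fin n → ℝ) : Measure (Fin n → ℝ) := Measure.pi fun i => sineMeasure (γ i)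

/-- The generalized translation as one integral over all angles. -/
def transMean (γ : Fin n → ℝ) (f : EuclideanSpace ℝ (Fin n) → ℝ)
    (x y : EuclideanSpace ℝ (Fin n)) : ℝ := ∫ α, f (transPoint x y α) ∂(angleMeasure γ)

/-- The box `[0, π]^n` of angles. -/
def angleBox (n : ℕ) : Set (Fin n → ℝ) := Set.pi univ fun _ => Icc 0 Real.pi

lemma isCompact_angleBox : IsCompact (angleBox n) := isCompact_univ_pi fun _ => isCompact_Icc

variable {γ : Fin n → ℝ}

lemma isProbabilityMeasure_angleMeasure (hγ : ∀ i, 0 < γ i) :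
    IsProbabilityMeasure (angleMeasure γ) := by
  have := fun i => isProbabilityMeasure_sineMeasure (hγ i)
  unfold angleMeasure
  infer_instance

lemma ae_angleMeasure_mem (hγ : ∀ i, 0 < γ i) :
    ∀ᵐ α ∂(angleMeasure γ), ∀ i, α i ∈ Ioo 0 Real.pi := by
  have := fun i => isProbabilityMeasure_sineMeasure (hγ i)
  rw [ae_all_iff]
  intro i
  exact (Measure.quasiMeasurePreserving_eval (μ := fun i => sineMeasure (γ i)) i).ae
    (ae_sineMeasure_mem (γ i))

lemma angleMeasure_compl (hγ : ∀ i, 0 < γ i) : angleMeasure γ (angleBox n)ᶜ = 0 := by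
  refine mem_ae_iff.1 ?_
  filter_upwards [ae_angleMeasure_mem hγ] with α hα i _
  exact Ioo_subset_Icc_self (hα i)

@[simp] lemma transPoint_apply (x y : EuclideanSpace ℝ (Fin n)) (α : Fin n → ℝ) (i : Fin n) :
    transPoint x y α i = triDist (x i) (y i) (α i) := rfl

lemma transPoint_mem (x y : EuclideanSpace ℝ (Fin n)) (α : Fin n → ℝ) :
    transPoint x y α ∈ closedOrthant n := fun _ => triDist_nonneg _ _ _

lemma transPoint_update (x y : EuclideanSpace ℝ (Fin n)) (α : Fin n → ℝ) (i : Fin n) (θ : ℝ) :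
    transPoint x y (Function.update α i θ) =
      setCoord (transPoint x y α) i (triDist (x i) (y i) θ) := by
  ext j; by_cases hj : j = i
  · subst hj; simp
  · simp [setCoord_apply, hj]

lemma transPoint_setCoord_right (x y : EuclideanSpace ℝ (Fin n)) (α : Fin n → ℝ) (i : Fin n)
    (s : ℝ) : transPoint x (setCoord y i s) α =
      setCoord (transPoint x y α) i (triDist (x i) s (α i)) := by
  ext j; by_cases hj : j = i
  · subst hj; simp
  · simp [setCoord_apply, hj]

lemma transPoint_comm (x y : EuclideanSpace ℝ (Fin n)) (α : Fin n → ℝ) :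
    transPoint x y α = transPoint y x α := by
  ext j; simp [triDist_comm (x j)]

/-- The coordinates of the translated point are planar distances, so a lift along `sqrtVec` is smooth
in `x`, `y` and the angles. -/
lemma transPoint_eq_sqrtVec (x y : EuclideanSpace ℝ (Fin n)) (α : Fin n → ℝ) :
    transPoint x y α = sqrtVec (WithLp.toLp 2 fun i => x i - y i * Real.cos (α i))
      (WithLp.toLp 2 fun i => y i * Real.sin (α i)) := rfl

lemma continuous_transPoint :
    Continuous fun q : (EuclideanSpace ℝ (Fin n) × EuclideanSpace ℝ (Fin n)) × (Fin n → ℝ) =>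
      transPoint q.1.1 q.1.2 q.2 := by
  unfold transPoint triDist
  fun_prop

lemma transPoint_zero {x : EuclideanSpace ℝ (Fin n)} (hx : x ∈ closedOrthant n) (α : Fin n → ℝ) :
    transPoint x 0 α = x := by
  ext j; simp [triDist_zero, abs_of_nonneg (hx j)]

lemma transMean_zero (hγ : ∀ i, 0 < γ i) {f : EuclideanSpace ℝ (Fin n) → ℝ}
    {x : EuclideanSpace ℝ (Fin n)} (hx : x ∈ closedOrthant n) : transMean γ f x 0 = f x := by
  have := isProbabilityMeasure_angleMeasure hγ
  simp [transMean, transPoint_zero hx]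

lemma transMean_comm (γ : Fin n → ℝ) (f : EuclideanSpace ℝ (Fin n) → ℝ)
    (x y : EuclideanSpace ℝ (Fin n)) : transMean γ f x y = transMean γ f y x := by
  simp only [transMean, transPoint_comm x y]

/-- `f` at the translated point is `C²` jointly in `x`, `y` and the angles, without sign
restrictions. -/
lemma contDiff_comp_transPoint {f : EuclideanSpace ℝ (Fin n) → ℝ} (hf : IsC2Even f) :
    ContDiff ℝ 2 fun q : (EuclideanSpace ℝ (Fin n) × EuclideanSpace ℝ (Fin n)) × (Fin n → ℝ) =>
      f (transPoint q.1.1 q.1.2 q.2) := by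
  simp only [transPoint_eq_sqrtVec]
  refine (contDiff_comp_sqrtVec hf).comp (f := fun q : (EuclideanSpace ℝ (Fin n) ×
    EuclideanSpace ℝ (Fin n)) × (Fin n → ℝ) =>
      ((WithLp.toLp 2 fun i => q.1.1 i - q.1.2 i * Real.cos (q.2 i) : EuclideanSpace ℝ (Fin n)),
      (WithLp.toLp 2 fun i => q.1.2 i * Real.sin (q.2 i) : EuclideanSpace ℝ (Fin n)))) ?_
  fun_prop

lemma contDiff_transMean (hγ : ∀ i, 0 < γ i) {f : EuclideanSpace ℝ (Fin n) → ℝ}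
    (hf : IsC2Even f) :
    ContDiff ℝ 2 fun p : EuclideanSpace ℝ (Fin n) × EuclideanSpace ℝ (Fin n) =>
      transMean γ f p.1 p.2 := by
  have := isProbabilityMeasure_angleMeasure hγ
  exact contDiff_integral_of_compact isCompact_angleBox (angleMeasure_compl hγ) 2
    (contDiff_comp_transPoint hf)

/-- An angle can be averaged separately from the others. -/
lemma integral_integral_update (hγ : ∀ i, 0 < γ i) {φ : (Fin n → ℝ) → ℝ} (hφ : Continuous φ)
    (i : Fin n) :
    ∫ s, ∫ α, φ (Function.update α i s) ∂(angleMeasure γ) ∂(sineMeasure (γ i)) =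
      ∫ α, φ α ∂(angleMeasure γ) := by
  have := isProbabilityMeasure_angleMeasure hγ
  have hν := fun i => isProbabilityMeasure_sineMeasure (hγ i)
  have hc : Continuous fun p : (Fin n → ℝ) × ℝ => φ (Function.update p.1 i p.2) :=
    hφ.comp (continuous_fst.update i continuous_snd)
  have hint : Integrable (fun p : ℝ × (Fin n → ℝ) => φ (Function.update p.2 i p.1))
      ((sineMeasure (γ i)).prod (angleMeasure γ)) := by
    refine integrable_of_continuous_of_compact
      ((isCompact_Icc (a := (0 : ℝ)) (b := Real.pi)).prod (isCompact_angleBox (n := n))) ?_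
      (hc.comp continuous_swap)
    refine mem_ae_iff.1 ?_
    have h1 := (Measure.quasiMeasurePreserving_fst (μ := sineMeasure (γ i))
      (ν := angleMeasure γ)).ae (ae_sineMeasure_mem (γ i))
    have h2 := (Measure.quasiMeasurePreserving_snd (μ := sineMeasure (γ i))
      (ν := angleMeasure γ)).ae (ae_angleMeasure_mem hγ)
    filter_upwards [h1, h2] with p hp1 hp2
    exact ⟨Ioo_subset_Icc_self hp1, fun i _ => Ioo_subset_Icc_self (hp2 i)⟩
  rw [integral_integral_swap hint]
  refine integral_pi_congr_update (i := i) ?_ ?_ fun α => ?_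
  · exact hint.integral_prod_right
  · exact integrable_of_continuous_of_compact isCompact_angleBox (angleMeasure_compl hγ) hφ
  · simp

/-- The one-dimensional translations in distinct variables compose to an average over all the angles;
each factor of the composition adds one variable to the list of translated ones. -/
lemma translate_foldr (hγ : ∀ i, 0 < γ i) {f : EuclideanSpace ℝ (Fin n) → ℝ}
    (hf : ContinuousOn f (closedOrthant n)) (y : EuclideanSpace ℝ (Fin n)) (l : List (Fin n))
    (hl : l.Nodup) : ∀ x ∈ closedOrthant n,
      l.foldr (fun i h => translate₁ (γ i) i (y i) h) f x =
        ∫ α, f (WithLp.toLp 2 fun j => if j ∈ l then triDist (x j) (y j) (α j) else x j)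
          ∂(angleMeasure γ) := by
  have := isProbabilityMeasure_angleMeasure hγ
  induction l with
  | nil =>
    intro x _
    simp
  | cons i l ih =>
    intro x hx
    obtain ⟨hil, hl'⟩ := List.nodup_cons.1 hl
    have hx' : ∀ θ, setCoord x i (triDist (x i) (y i) θ) ∈ closedOrthant n := by
      intro θ j
      rw [setCoord_apply]
      split_ifs
      · exact triDist_nonneg _ _ _
      · exact hx j
    have hφ : Continuous fun α : Fin n → ℝ => f (WithLp.toLp 2 fun j =>
        if j ∈ i :: l then triDist (x j) (y j) (α j) else x j) := by
      refine hf.comp_continuous ?_ fun α j => ?_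
      · refine (PiLp.continuous_toLp 2 _).comp (continuous_pi fun j => ?_)
        split_ifs
        · exact continuous_triDist.comp
            (by fun_prop : Continuous fun α : Fin n → ℝ => (x j, y j, α j))
        · exact continuous_const
      · change 0 ≤ (if j ∈ i :: l then triDist (x j) (y j) (α j) else x j)
        split_ifs
        · exact triDist_nonneg _ _ _
        · exact hx j
    rw [List.foldr_cons, translate₁, ← sineConst, ← integral_integral_update hγ hφ i,
      integral_sineMeasure (hγ i)]
    congr 1
    refine intervalIntegral.integral_congr fun θ _ => ?_
    simp only
    rw [← triDist_eq, ih hl' _ (hx' θ)]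
    congr 1
    refine integral_congr_ae (Eventually.of_forall fun α => ?_)
    simp only
    congr 2
    funext j
    by_cases hj : j = i
    · subst hj; simp [hil]
    · simp [setCoord_apply, hj]

lemma translate_eq_transMean (hγ : ∀ i, 0 < γ i) {f : EuclideanSpace ℝ (Fin n) → ℝ}
    (hf : ContinuousOn f (closedOrthant n)) {x : EuclideanSpace ℝ (Fin n)}
    (hx : x ∈ closedOrthant n) (y : EuclideanSpace ℝ (Fin n)) :
    translate γ y f x = transMean γ f x y := by
  rw [translate, translate_foldr hγ hf y _ (List.nodup_finRange n) x hx]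
  simp [transMean, transPoint]

lemma transMean_even_right (hγ : ∀ i, 0 < γ i) {f : EuclideanSpace ℝ (Fin n) → ℝ}
    (hf : ContinuousOn f (closedOrthant n)) (x : EuclideanSpace ℝ (Fin n)) :
    GloballyEven (transMean γ f x) := by
  have := isProbabilityMeasure_angleMeasure hγ
  have hν := fun i => isProbabilityMeasure_sineMeasure (hγ i)
  intro i y s
  have hint : ∀ y : EuclideanSpace ℝ (Fin n), Integrable (fun α => f (transPoint x y α))
      (angleMeasure γ) := fun y =>
    integrable_of_continuous_of_compact isCompact_angleBox (angleMeasure_compl hγ)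
      (hf.comp_continuous (continuous_transPoint.comp (Continuous.prodMk_right (x, y)))
        fun α => transPoint_mem x y α)
  refine integral_pi_congr_update (hint _) (hint _) i fun α => ?_
  simp only [transPoint_update, transPoint_setCoord_right, setCoord_same, triDist_neg_right,
    setCoord_setCoord]
  exact integral_sineMeasure_reflect (hγ i)
    (fun θ => f (setCoord (transPoint x y α) i (triDist (x i) s θ)))

/-- The generalized translation intertwines the Bessel operators: applied in the step `y_i` they can
be moved onto the function. -/
lemma besselOp_transMean_right (hγ : ∀ i, 0 < γ i) {f : EuclideanSpace ℝ (Fin n) → ℝ}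
    (hf : IsC2Even f) (hf' : ContDiff ℝ 2 f) (he : GloballyEven f)
    {x y : EuclideanSpace ℝ (Fin n)} (hx : x ∈ orthant n) (hy : y ∈ orthant n) (i : Fin n) :
    besselOp (γ i) (fun s => transMean γ f x (setCoord y i s)) (y i) =
      ∫ α, besselOp (γ i) (fun s => f (setCoord (transPoint x y α) i s)) (transPoint x y α i)
        ∂(angleMeasure γ) := by
  have := isProbabilityMeasure_angleMeasure hγ
  have hν := fun i => isProbabilityMeasure_sineMeasure (hγ i)
  have hC2 : ContDiff ℝ 2 fun q : ℝ × (Fin n → ℝ) => f (transPoint x (setCoord y i q.1) q.2) :=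
    (contDiff_comp_transPoint hf).comp (f := fun q : ℝ × (Fin n → ℝ) =>
      ((x, setCoord y i q.1), q.2)) ((contDiff_const.prodMk ((contDiff_setCoord i).comp
        (contDiff_const.prodMk contDiff_fst))).prodMk contDiff_snd)
  have hcont := continuous_besselOp_slice hC2 (γ i) (y i)
  have hcT : Continuous fun α => transPoint x y α :=
    continuous_transPoint.comp (Continuous.prodMk_right (x, y))
  obtain ⟨R, hR⟩ := (isCompact_angleBox (n := n)).exists_bound_of_continuousOn hcT.continuousOn
  obtain ⟨C, hC⟩ := he.abs_besselOp_le hf' (γ i) R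
  unfold transMean
  rw [besselOp_integral isCompact_angleBox (angleMeasure_compl hγ) hC2]
  refine integral_pi_congr_update (i := i)
    (integrable_of_continuous_of_compact isCompact_angleBox (angleMeasure_compl hγ) hcont) ?_ ?_
  · refine Integrable.of_bound (C := C)
      ((measurable_besselOp_setCoord hf' (γ i) i).comp hcT.measurable).aestronglyMeasurable ?_
    filter_upwards [ae_angleMeasure_mem hγ] with α hα
    exact hC i _ (hR α fun j _ => Ioo_subset_Icc_self (hα j))
  · intro α
    have hg : ContDiff ℝ 2 fun s => f (setCoord (transPoint x y α) i s) :=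
      hf'.comp ((contDiff_setCoord i).comp (contDiff_const.prodMk contDiff_id))
    simp only [transPoint_update, transPoint_setCoord_right, setCoord_same, setCoord_setCoord]
    set z := transPoint x y α with hz
    obtain ⟨C₁, -, hC₁⟩ := he.abs_partialDeriv_le hf' (‖setCoord z i (x i + y i)‖)
    refine integral_besselOp_triDist (g := fun s => f (setCoord z i s)) (C := C₁) hg (hγ i)
      (hx i) (hy i) (fun r hr hr' => ?_) ?_
    · rw [(hasDerivAt_comp_setCoord (hf'.of_le (by norm_num)) z i r).deriv]
      have := (hC₁ i (setCoord z i r) ?_).1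
      · simpa [abs_of_pos hr] using this
      · have h1 := norm_setCoord_le (x := setCoord z i (x i + y i)) (i := i) (s := r)
          (by rw [setCoord_same, abs_of_pos hr]; exact hr'.trans (le_abs_self _))
        rwa [setCoord_setCoord] at h1
    · refine integrable_of_continuous_of_compact (isCompact_Icc (a := (0 : ℝ)) (b := Real.pi))
        (sineMeasure_compl (γ i)) ?_
      have hc2 := hcont.comp (continuous_const.update i continuous_id : Continuous fun θ : ℝ =>
        Function.update α i θ)
      refine hc2.congr fun θ => ?_
      simp only [Function.comp, transPoint_update, transPoint_setCoord_right, setCoord_same,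
        setCoord_setCoord, ← hz]

/-- The translation is symmetric in `x` and `y`, hence `B_{γ_i}` may be moved from `x_i` to `y_i`. -/
lemma besselOp_transMean_left (hγ : ∀ i, 0 < γ i) {f : EuclideanSpace ℝ (Fin n) → ℝ}
    (hf : IsC2Even f) (hf' : ContDiff ℝ 2 f) (he : GloballyEven f)
    {x y : EuclideanSpace ℝ (Fin n)} (hx : x ∈ orthant n) (hy : y ∈ orthant n) (i : Fin n) :
    besselOp (γ i) (fun s => transMean γ f (setCoord x i s) y) (x i) =
      besselOp (γ i) (fun s => transMean γ f x (setCoord y i s)) (y i) := by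
  rw [besselOp_transMean_right hγ hf hf' he hx hy]
  have := besselOp_transMean_right hγ hf hf' he hy hx i
  simp only [transMean_comm γ f y, transPoint_comm y x] at this
  exact this

end MultidimensionalTranslation

/-! ### Weighted polar coordinates in the orthant -/

section Polar

variable {n : ℕ}

/-- The homogeneous dimension `n + |γ|`. -/
def homDim {n : ℕ} (γ : Fin n → ℝ) : ℝ := (n : ℝ) + ∑ i, γ i

lemma measurableSet_orthant : MeasurableSet (orthant n) := by
  unfold orthant
  rw [ofPred_forall]
  exact MeasurableSet.iInter fun i => measurableSet_lt measurable_const (by fun_prop)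

lemma measurableSet_spherePart : MeasurableSet (spherePart n) :=
  measurable_subtype_coe measurableSet_orthant

lemma continuous_weight {γ : Fin n → ℝ} (hγ : ∀ i, 0 < γ i) : Continuous (weight γ) := by
  unfold weight
  refine continuous_finsetProd _ fun i _ => ?_
  exact Continuous.rpow_const (by fun_prop) fun _ => Or.inr (hγ i).le

lemma weight_nonneg {γ : Fin n → ℝ} {x : EuclideanSpace ℝ (Fin n)} (hx : x ∈ closedOrthant n) :
    0 ≤ weight γ x := Finset.prod_nonneg fun i _ => Real.rpow_nonneg (hx i) _

lemma orthant_subset : orthant n ⊆ closedOrthant n := fun _ hx i => (hx i).le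

lemma smul_mem_orthant_iff {x : EuclideanSpace ℝ (Fin n)} {ρ : ℝ} (hρ : 0 < ρ) :
    ρ • x ∈ orthant n ↔ x ∈ orthant n := by
  simp [orthant, hρ]

/-- The weight is homogeneous of degree `|γ|`. -/
lemma weight_smul {γ : Fin n → ℝ} {x : EuclideanSpace ℝ (Fin n)} (hx : x ∈ closedOrthant n)
    {ρ : ℝ} (hρ : 0 < ρ) : weight γ (ρ • x) = ρ ^ (∑ i, γ i) * weight γ x := by
  unfold weight
  rw [Real.rpow_sum_of_pos hρ, ← Finset.prod_mul_distrib]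
  refine Finset.prod_congr rfl fun i _ => ?_
  rw [PiLp.smul_apply, smul_eq_mul, Real.mul_rpow hρ.le (hx i)]

lemma pow_mul_rpow_homDim (hn : 1 ≤ n) (γ : Fin n → ℝ) {ρ : ℝ} (hρ : 0 < ρ) :
    ρ ^ (n - 1) * ρ ^ (∑ i, γ i) = ρ ^ (homDim γ - 1) := by
  rw [← Real.rpow_natCast, ← Real.rpow_add hρ, homDim, Nat.cast_sub hn]
  congr 1
  push_cast
  ring

instance isFiniteMeasure_surfaceMeasure : IsFiniteMeasure (surfaceMeasure n) := by
  unfold surfaceMeasure; infer_instance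

lemma integrable_polar_iff (hn : 1 ≤ n) {g : EuclideanSpace ℝ (Fin n) → ℝ} :
    Integrable g ↔ Integrable (fun p : Metric.sphere (0 : EuclideanSpace ℝ (Fin n)) 1 ×
      Ioi (0 : ℝ) => g ((p.2 : ℝ) • (p.1 : EuclideanSpace ℝ (Fin n))))
      ((surfaceMeasure n).prod (Measure.volumeIoiPow (n - 1))) := by
  have : Nonempty (Fin n) := ⟨⟨0, hn⟩⟩
  have h1 := (volume : Measure (EuclideanSpace ℝ (Fin n))).measurePreserving_homeomorphUnitSphereProd
  rw [finrank_euclideanSpace_fin] at h1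
  have h2 := h1.integrable_comp_emb
    (g := fun p : Metric.sphere (0 : EuclideanSpace ℝ (Fin n)) 1 × Ioi (0 : ℝ) =>
      g ((p.2 : ℝ) • (p.1 : EuclideanSpace ℝ (Fin n)))) (Homeomorph.measurableEmbedding _)
  have h3 : Integrable g ↔ Integrable (g ∘ Subtype.val)
      ((volume : Measure (EuclideanSpace ℝ (Fin n))).comap
        (Subtype.val : ({0}ᶜ : Set (EuclideanSpace ℝ (Fin n))) → _)) := by
    rw [← integrableOn_iff_comap_subtypeVal (by measurability), IntegrableOn,
      restrict_compl_singleton]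
  rw [surfaceMeasure, ← h2, h3]
  have e : g ∘ Subtype.val = (fun p : Metric.sphere (0 : EuclideanSpace ℝ (Fin n)) 1 ×
      Ioi (0 : ℝ) => g ((p.2 : ℝ) • (p.1 : EuclideanSpace ℝ (Fin n)))) ∘
      (homeomorphUnitSphereProd (EuclideanSpace ℝ (Fin n))) := by
    funext x
    have hx : ‖(x : EuclideanSpace ℝ (Fin n))‖ ≠ 0 := norm_ne_zero_iff.2 x.2
    simp [smul_smul, hx]
  rw [e]

lemma integral_polar (hn : 1 ≤ n) (g : EuclideanSpace ℝ (Fin n) → ℝ) :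
    ∫ y, g y = ∫ p : Metric.sphere (0 : EuclideanSpace ℝ (Fin n)) 1 ×
      Ioi (0 : ℝ), g ((p.2 : ℝ) • (p.1 : EuclideanSpace ℝ (Fin n)))
      ∂((surfaceMeasure n).prod (Measure.volumeIoiPow (n - 1))) := by
  have : Nonempty (Fin n) := ⟨⟨0, hn⟩⟩
  have h1 := (volume : Measure (EuclideanSpace ℝ (Fin n))).measurePreserving_homeomorphUnitSphereProd
  rw [finrank_euclideanSpace_fin] at h1
  have h2 := h1.integral_comp (Homeomorph.measurableEmbedding _)
    (fun p : Metric.sphere (0 : EuclideanSpace ℝ (Fin n)) 1 × Ioi (0 : ℝ) =>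
      g ((p.2 : ℝ) • (p.1 : EuclideanSpace ℝ (Fin n))))
  have h3 : ∫ y, g y = ∫ x : ({0}ᶜ : Set (EuclideanSpace ℝ (Fin n))), g x
      ∂((volume : Measure (EuclideanSpace ℝ (Fin n))).comap Subtype.val) := by
    rw [integral_subtype_comap (measurableSet_singleton _).compl g, restrict_compl_singleton]
  rw [surfaceMeasure, ← h2, h3]
  refine integral_congr_ae (Eventually.of_forall fun x => ?_)
  have hx : ‖(x : EuclideanSpace ℝ (Fin n))‖ ≠ 0 := norm_ne_zero_iff.2 x.2
  simp [smul_smul, hx]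

lemma integral_volumeIoiPow (m : ℕ) (g : ℝ → ℝ) :
    ∫ x : Ioi (0 : ℝ), g x ∂(Measure.volumeIoiPow m) = ∫ ρ in Ioi (0 : ℝ), ρ ^ m * g ρ := by
  simp only [Measure.volumeIoiPow, ENNReal.ofReal]
  rw [integral_withDensity_eq_integral_smul,
    integral_subtype_comap measurableSet_Ioi fun a ↦ Real.toNNReal (a ^ m) • g a,
    setIntegral_congr_fun measurableSet_Ioi fun x hx ↦ ?_]
  · rw [NNReal.smul_def, Real.coe_toNNReal _ (pow_nonneg hx.out.le _), smul_eq_mul]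
  · exact (measurable_subtype_coe.pow_const _).real_toNNReal

lemma integrable_volumeIoiPow_iff (m : ℕ) {g : ℝ → ℝ} :
    Integrable (fun x : Ioi (0 : ℝ) => g x) (Measure.volumeIoiPow m) ↔
      IntegrableOn (fun ρ => ρ ^ m * g ρ) (Ioi 0) := by
  rw [integrableOn_iff_comap_subtypeVal measurableSet_Ioi, Measure.volumeIoiPow,
    integrable_withDensity_iff_integrable_smul' (by fun_prop)
      (Eventually.of_forall fun _ => ENNReal.ofReal_lt_top)]
  refine integrable_congr (Eventually.of_forall ?_)
  rintro ⟨x, hx : 0 < x⟩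
  simp (disch := positivity) [ENNReal.toReal_ofReal]

/-- Integration in polar coordinates over the orthant against the weight `y^γ`. -/
lemma setIntegral_orthant_polar (hn : 1 ≤ n) (γ : Fin n → ℝ)
    {H : EuclideanSpace ℝ (Fin n) → ℝ} {κ : ℝ → ℝ}
    (hi : IntegrableOn (fun y => weight γ y * (H y * κ ‖y‖)) (orthant n)) :
    ∫ y in orthant n, weight γ y * (H y * κ ‖y‖) =
      ∫ ρ in Ioi (0 : ℝ), ρ ^ (homDim γ - 1) * κ ρ *
        ∫ θ in spherePart n, weight γ (θ : EuclideanSpace ℝ (Fin n)) *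
          H (ρ • (θ : EuclideanSpace ℝ (Fin n))) ∂(surfaceMeasure n) := by
  rw [← integral_indicator measurableSet_orthant, integral_polar hn]
  rw [← integrable_indicator_iff measurableSet_orthant, integrable_polar_iff hn] at hi
  rw [integral_prod_symm _ hi]
  rw [integral_volumeIoiPow (n - 1) (fun ρ => ∫ θ : Metric.sphere (0 : EuclideanSpace ℝ (Fin n)) 1,
    (orthant n).indicator (fun y => weight γ y * (H y * κ ‖y‖))
      (ρ • (θ : EuclideanSpace ℝ (Fin n))) ∂(surfaceMeasure n))]
  refine setIntegral_congr_fun measurableSet_Ioi fun ρ hρ => ?_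
  have hρ' : 0 < ρ := hρ
  rw [← pow_mul_rpow_homDim hn γ hρ', mul_assoc, mul_assoc]
  congr 1
  rw [← integral_const_mul, ← integral_const_mul, ← integral_indicator measurableSet_spherePart]
  refine integral_congr_ae (Eventually.of_forall fun θ => ?_)
  simp only
  by_cases hθ : θ ∈ spherePart n
  · rw [indicator_of_mem hθ, indicator_of_mem ((smul_mem_orthant_iff hρ').2 hθ),
      weight_smul (orthant_subset hθ) hρ', norm_smul, norm_eq_of_mem_sphere, mul_one,
      Real.norm_eq_abs, abs_of_pos hρ']
    ring
  · rw [indicator_of_notMem hθ, indicator_of_notMem (fun h => hθ ((smul_mem_orthant_iff hρ').1 h))]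

lemma integrable_weight_sphere {γ : Fin n → ℝ} (hγ : ∀ i, 0 < γ i) :
    IntegrableOn (fun θ : Metric.sphere (0 : EuclideanSpace ℝ (Fin n)) 1 =>
      weight γ (θ : EuclideanSpace ℝ (Fin n))) (spherePart n) (surfaceMeasure n) := by
  have h1 : IntegrableOn (fun θ : Metric.sphere (0 : EuclideanSpace ℝ (Fin n)) 1 =>
      weight γ (θ : EuclideanSpace ℝ (Fin n))) univ (surfaceMeasure n) :=
    ((continuous_weight hγ).comp continuous_subtype_val).continuousOn.integrableOn_compact
      isCompact_univ
  exact h1.mono_set (subset_univ _)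

/-- A bounded function times a radial one is integrable against `y^γ` as soon as the radial factor is
integrable against `ρ ^ (n + |γ| - 1)`. -/
lemma integrableOn_orthant_of_radial (hn : 1 ≤ n) {γ : Fin n → ℝ} (hγ : ∀ i, 0 < γ i)
    {H : EuclideanSpace ℝ (Fin n) → ℝ} (hH : Measurable H) {C : ℝ} (hC : ∀ y, |H y| ≤ C)
    {κ : ℝ → ℝ} (hκ : IntegrableOn (fun ρ => ρ ^ (homDim γ - 1) * κ ρ) (Ioi 0)) :
    IntegrableOn (fun y => weight γ y * (H y * κ ‖y‖)) (orthant n) := by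
  rw [← integrable_indicator_iff measurableSet_orthant, integrable_polar_iff hn]
  have h1 : Integrable (fun x : Ioi (0 : ℝ) => (x : ℝ) ^ (∑ i, γ i) * κ x)
      (Measure.volumeIoiPow (n - 1)) := by
    rw [integrable_volumeIoiPow_iff (n - 1) (g := fun ρ => ρ ^ (∑ i, γ i) * κ ρ)]
    refine hκ.congr_fun (fun ρ hρ => ?_) measurableSet_Ioi
    simp only
    rw [← pow_mul_rpow_homDim hn γ hρ, mul_assoc]
  have h2 := (integrable_indicator_iff measurableSet_spherePart).2 (integrable_weight_sphere hγ)
  have h3 := h2.mul_prod h1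
  have h4 := h3.bdd_mul (f := fun p : Metric.sphere (0 : EuclideanSpace ℝ (Fin n)) 1 ×
      Ioi (0 : ℝ) => H ((p.2 : ℝ) • (p.1 : EuclideanSpace ℝ (Fin n)))) (c := C)
    (hH.comp (by fun_prop)).aestronglyMeasurable (Eventually.of_forall fun p => hC _)
  refine h4.congr (Eventually.of_forall ?_)
  rintro ⟨θ, ⟨ρ, hρ⟩⟩
  have hρ' : 0 < ρ := hρ
  simp only
  by_cases hθ : θ ∈ spherePart n
  · rw [indicator_of_mem hθ, indicator_of_mem ((smul_mem_orthant_iff hρ').2 hθ),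
      weight_smul (orthant_subset hθ) hρ', norm_smul, norm_eq_of_mem_sphere, mul_one,
      Real.norm_eq_abs, abs_of_pos hρ']
    ring
  · rw [indicator_of_notMem hθ, indicator_of_notMem (fun h => hθ ((smul_mem_orthant_iff hρ').1 h))]
    ring

end Polar

section Area

variable {n : ℕ}

/-- The half-line Gaussian moment `∫ x^a exp(-x²)`. -/
lemma integral_rpow_mul_exp_neg_sq {a : ℝ} (ha : -1 < a) :
    ∫ x in Ioi (0 : ℝ), x ^ a * Real.exp (-x ^ 2) = Real.Gamma ((a + 1) / 2) / 2 := by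
  have := integral_rpow_mul_exp_neg_rpow (p := 2) (q := a) two_pos ha
  simp only [Real.rpow_two] at this
  rw [this]; ring

lemma integrableOn_rpow_mul_exp_neg_sq {a : ℝ} (ha : -1 < a) :
    IntegrableOn (fun x : ℝ => x ^ a * Real.exp (-x ^ 2)) (Ioi 0) := by
  have := integrableOn_rpow_mul_exp_neg_mul_sq one_pos ha
  simpa using this

lemma orthant_eq_preimage :
    orthant n = WithLp.ofLp ⁻¹' (Set.pi univ fun _ : Fin n => Ioi (0 : ℝ)) := by
  ext x; simp [orthant]

/-- Integrals over the orthant as integrals against a product measure. -/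
lemma setIntegral_orthant_eq_pi (g : EuclideanSpace ℝ (Fin n) → ℝ) :
    ∫ y in orthant n, g y =
      ∫ x, g (WithLp.toLp 2 x) ∂(Measure.pi fun _ : Fin n => volume.restrict (Ioi (0 : ℝ))) := by
  have h := (PiLp.volume_preserving_ofLp (Fin n)).setIntegral_preimage_emb
    (MeasurableEquiv.toLp 2 (Fin n → ℝ)).symm.measurableEmbedding
    (fun x => g (WithLp.toLp 2 x)) (Set.pi univ fun _ : Fin n => Ioi (0 : ℝ))
  rw [← Measure.restrict_pi_pi, ← volume_pi, ← h, orthant_eq_preimage]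

lemma integrableOn_orthant_iff_pi {g : EuclideanSpace ℝ (Fin n) → ℝ} :
    IntegrableOn g (orthant n) ↔ Integrable (fun x => g (WithLp.toLp 2 x))
      (Measure.pi fun _ : Fin n => volume.restrict (Ioi (0 : ℝ))) := by
  have h := (PiLp.volume_preserving_ofLp (Fin n)).integrableOn_comp_preimage
    (MeasurableEquiv.toLp 2 (Fin n → ℝ)).symm.measurableEmbedding
    (f := fun x => g (WithLp.toLp 2 x)) (s := Set.pi univ fun _ : Fin n => Ioi (0 : ℝ))
  rw [← Measure.restrict_pi_pi, ← volume_pi, orthant_eq_preimage, ← IntegrableOn, ← h]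
  rfl

lemma homDim_pos (hn : 1 ≤ n) {γ : Fin n → ℝ} (hγ : ∀ i, 0 < γ i) : 1 < homDim γ := by
  have : Nonempty (Fin n) := ⟨⟨0, hn⟩⟩
  have h1 : 0 < ∑ i, γ i := Finset.sum_pos (fun i _ => hγ i) Finset.univ_nonempty
  have h2 : (1 : ℝ) ≤ n := by exact_mod_cast hn
  unfold homDim
  linarith

lemma weightedArea_pos (hn : 1 ≤ n) {γ : Fin n → ℝ} (hγ : ∀ i, 0 < γ i) :
    0 < weightedArea γ := by
  have h1 := homDim_pos hn hγ
  have h2 := Real.Gamma_pos_of_pos (show 0 < ((n : ℝ) + ∑ i, γ i) / 2 by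
    unfold homDim at h1; linarith)
  have h3 : 0 < ∏ i, Real.Gamma ((γ i + 1) / 2) := Finset.prod_pos fun i _ =>
    Real.Gamma_pos_of_pos (by linarith [hγ i])
  unfold weightedArea
  positivity

/-- The weighted area of the spherical part, by computing a Gaussian integral in Cartesian and in
polar coordinates. -/
lemma integral_weight_sphere (hn : 1 ≤ n) {γ : Fin n → ℝ} (hγ : ∀ i, 0 < γ i) :
    ∫ θ in spherePart n, weight γ (θ : EuclideanSpace ℝ (Fin n)) ∂(surfaceMeasure n) =
      weightedArea γ := by
  have hN := homDim_pos hn hγ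
  have hi := integrableOn_orthant_of_radial hn hγ (H := fun _ => 1) measurable_const (C := 1)
    (fun _ => by simp) (κ := fun ρ => Real.exp (-ρ ^ 2))
    (integrableOn_rpow_mul_exp_neg_sq (by linarith))
  have h1 := setIntegral_orthant_polar hn γ (H := fun _ => 1) (κ := fun ρ => Real.exp (-ρ ^ 2)) hi
  rw [integral_mul_const, integral_rpow_mul_exp_neg_sq (by linarith)] at h1
  simp only [mul_one, one_mul] at h1
  rw [setIntegral_orthant_eq_pi] at h1
  have e : (fun x : Fin n → ℝ => weight γ (WithLp.toLp 2 x) *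
      Real.exp (-‖(WithLp.toLp 2 x : EuclideanSpace ℝ (Fin n))‖ ^ 2)) =
      fun x => ∏ i, (x i ^ γ i * Real.exp (-x i ^ 2)) := by
    funext x
    rw [Finset.prod_mul_distrib, ← Real.exp_sum, EuclideanSpace.norm_sq_eq]
    simp [weight]
  rw [e, integral_fintype_prod_eq_prod (fun i (s : ℝ) => s ^ γ i * Real.exp (-s ^ 2))] at h1
  have e2 : ∀ i, ∫ s in Ioi (0 : ℝ), s ^ γ i * Real.exp (-s ^ 2) =
      Real.Gamma ((γ i + 1) / 2) / 2 := fun i =>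
    integral_rpow_mul_exp_neg_sq (by linarith [hγ i])
  simp only [e2] at h1
  rw [Finset.prod_div_distrib, Finset.prod_const, Finset.card_univ, Fintype.card_fin,
    sub_add_cancel] at h1
  have hG := (Real.Gamma_pos_of_pos (show 0 < homDim γ / 2 by linarith)).ne'
  rw [weightedArea, ← homDim, Real.rpow_sub_one two_ne_zero, Real.rpow_natCast]
  field_simp at h1 ⊢
  linarith

end Area

/-! ### Green's identity for the Laplace–Bessel operator against radial functions -/

section WeakIdentity

variable {n : ℕ}

lemma integrable_of_bounded_support {X : Type} [NormedAddCommGroup X] [NormedSpace ℝ X]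
    [FiniteDimensional ℝ X] [MeasureSpace X] [BorelSpace X]
    [IsFiniteMeasureOnCompacts (volume : Measure X)] {φ : X → ℝ} (hm : Measurable φ) {R C : ℝ}
    (hC : ∀ y, ‖y‖ ≤ R → |φ y| ≤ C) (h0 : ∀ y, R < ‖y‖ → φ y = 0) : Integrable φ := by
  have : ProperSpace X := FiniteDimensional.proper ℝ X
  have hs : Function.support φ ⊆ Metric.closedBall 0 R := by
    intro y hy
    by_contra h
    exact hy (h0 y (by simpa using h))
  rw [← integrableOn_iff_integrable_of_support_subset hs]
  refine Measure.integrableOn_of_bounded (M := C)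
    (isCompact_closedBall (0 : X) R).measure_lt_top.ne hm.aestronglyMeasurable ?_
  exact ae_restrict_of_forall_mem Metric.isClosed_closedBall.measurableSet
    fun y hy => hC y (by simpa using hy)

lemma abs_coord_le_norm (y : EuclideanSpace ℝ (Fin n)) (i : Fin n) : |y i| ≤ ‖y‖ :=
  PiLp.norm_apply_le y i

lemma continuous_setCoord (x : EuclideanSpace ℝ (Fin n)) (i : Fin n) :
    Continuous fun s => setCoord x i s :=
  (contDiff_setCoord (m := 0) i).continuous.comp (Continuous.prodMk_right x)

lemma integrable_weight_mul_radial {γ : Fin n → ℝ} (hγ : ∀ i, 0 < γ i)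
    {G : EuclideanSpace ℝ (Fin n) → ℝ} (hG : Measurable G) {κ : ℝ → ℝ} (hκ : Continuous κ)
    {R C : ℝ} (hC : ∀ y, ‖y‖ ≤ R → |G y| ≤ C) (h0 : ∀ ρ, R < ρ → κ ρ = 0) :
    Integrable (fun y => weight γ y * (G y * κ ‖y‖)) ∧
      ∀ x i, Integrable fun s : ℝ => weight γ (setCoord x i s) *
        (G (setCoord x i s) * κ ‖setCoord x i s‖) := by
  have hm : Measurable fun y => weight γ y * (G y * κ ‖y‖) :=
    (continuous_weight hγ).measurable.mul (hG.mul (hκ.measurable.comp measurable_norm))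
  obtain ⟨C₁, hC₁⟩ := (isCompact_closedBall (0 : EuclideanSpace ℝ (Fin n)) R
    ).exists_bound_of_continuousOn ((continuous_weight hγ).mul
      (hκ.comp continuous_norm)).continuousOn
  have hb : ∀ y : EuclideanSpace ℝ (Fin n), ‖y‖ ≤ R →
      |weight γ y * (G y * κ ‖y‖)| ≤ C₁ * C := by
    intro y hy
    have h1 := hC₁ y (by simpa using hy)
    have h2 := hC y hy
    rw [show weight γ y * (G y * κ ‖y‖) = (weight γ y * κ ‖y‖) * G y by ring, abs_mul]
    exact mul_le_mul h1 h2 (abs_nonneg _) ((norm_nonneg _).trans h1)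
  have hz : ∀ y : EuclideanSpace ℝ (Fin n), R < ‖y‖ → weight γ y * (G y * κ ‖y‖) = 0 :=
    fun y hy => by rw [h0 _ hy]; ring
  refine ⟨integrable_of_bounded_support hm hb hz, fun x i => ?_⟩
  refine integrable_of_bounded_support (R := R) (C := C₁ * C)
    (hm.comp (continuous_setCoord x i).measurable) (fun s _ => ?_) fun s hs => ?_
  · by_cases h : ‖setCoord x i s‖ ≤ R
    · exact hb _ h
    · simp only [hz _ (not_le.1 h), abs_zero]
      by_cases hR : 0 ≤ R
      · have h1 := hb 0 (by simpa using hR)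
        exact (abs_nonneg _).trans h1
      · have : ‖s‖ ≤ R := by assumption
        exact absurd ((norm_nonneg s).trans this) hR
  · refine hz _ (lt_of_lt_of_le hs ?_)
    have := abs_coord_le_norm (setCoord x i s) i
    simpa using this

lemma weight_setCoord (γ : Fin n → ℝ) (x : EuclideanSpace ℝ (Fin n)) (i : Fin n) (s : ℝ) :
    weight γ (setCoord x i s) = s ^ γ i * ∏ j ∈ Finset.univ.erase i, x j ^ γ j := by
  rw [weight, ← Finset.mul_prod_erase _ _ (Finset.mem_univ i), setCoord_same]
  congr 1
  refine Finset.prod_congr rfl fun j hj => ?_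
  rw [setCoord_apply, if_neg (Finset.ne_of_mem_erase hj)]

lemma hasDerivAt_norm_setCoord (x : EuclideanSpace ℝ (Fin n)) (i : Fin n) {s : ℝ} (hs : 0 < s) :
    HasDerivAt (fun s => ‖setCoord x i s‖) (s / ‖setCoord x i s‖) s := by
  have h0 : setCoord x i s ≠ 0 := by
    intro h
    have := congrArg (fun z : EuclideanSpace ℝ (Fin n) => z i) h
    simp only [setCoord_same, PiLp.zero_apply] at this
    exact hs.ne' this
  have h1 := (hasDerivAt_setCoord x i s).norm_sq
  have h2 := h1.sqrt (pow_ne_zero 2 (norm_ne_zero_iff.2 h0))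
  have e : (fun s => ‖setCoord x i s‖) = fun s => Real.sqrt (‖setCoord x i s‖ ^ 2) :=
    funext fun s => (Real.sqrt_sq (norm_nonneg _)).symm
  rw [e]
  refine h2.congr_deriv ?_
  rw [Real.sqrt_sq (norm_nonneg _), EuclideanSpace.inner_single_right]
  simp only [setCoord_same, one_mul, conj_trivial]
  rw [mul_div_mul_left _ _ two_ne_zero]

lemma fderiv_self_eq_sum (w : EuclideanSpace ℝ (Fin n) → ℝ) (z y : EuclideanSpace ℝ (Fin n)) :
    fderiv ℝ w z y = ∑ i, y i * partialDeriv i w z := by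
  have : y = ∑ i, y i • EuclideanSpace.single i (1 : ℝ) := by
    ext j
    simp [Finset.sum_apply, Pi.single_apply]
  conv_lhs => rw [this]
  rw [map_sum]
  simp [partialDeriv]

/-- Integration by parts in one coordinate against a radial test function; the boundary term on the
face `y_i = 0` vanishes because of the weight. -/
lemma integral_coordinate_eq_zero {γ : Fin n → ℝ} (hγ : ∀ i, 0 < γ i)
    {w : EuclideanSpace ℝ (Fin n) → ℝ} (hw : ContDiff ℝ 2 w) (he : GloballyEven w)
    {ψ : ℝ → ℝ} (hψ : ContDiff ℝ 1 ψ) {R : ℝ} (hR : ∀ ρ, R ≤ ρ → ψ ρ = 0) (i : Fin n) :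
    IntegrableOn (fun y => weight γ y *
        (besselOp (γ i) (fun s => w (setCoord y i s)) (y i) * ψ ‖y‖)) (orthant n) ∧
      IntegrableOn (fun y => weight γ y *
        (y i * partialDeriv i w y / ‖y‖ * deriv ψ ‖y‖)) (orthant n) ∧
      (∫ y in orthant n, weight γ y *
        (besselOp (γ i) (fun s => w (setCoord y i s)) (y i) * ψ ‖y‖)) +
      ∫ y in orthant n, weight γ y * (y i * partialDeriv i w y / ‖y‖ * deriv ψ ‖y‖) = 0 := by
  obtain ⟨C₁, hC₁⟩ := he.abs_besselOp_le hw (γ i) R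
  have hDc := continuous_partialDeriv (hw.of_le (by norm_num)) i
  obtain ⟨C₂, hC₂⟩ := (isCompact_closedBall (0 : EuclideanSpace ℝ (Fin n)) R
    ).exists_bound_of_continuousOn hDc.continuousOn
  have hψ' : Continuous (deriv ψ) := hψ.continuous_deriv_one
  have hR' : ∀ ρ, R < ρ → deriv ψ ρ = 0 := by
    intro ρ hρ
    have : ψ =ᶠ[𝓝 ρ] fun _ => 0 := by
      filter_upwards [lt_mem_nhds hρ] with r hr using hR r hr.le
    rw [this.deriv_eq, deriv_const]
  have I₁ := integrable_weight_mul_radial hγ (measurable_besselOp_setCoord hw (γ i) i)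
    hψ.continuous (hC₁ i) (fun ρ hρ => hR ρ hρ.le)
  have I₂ := integrable_weight_mul_radial hγ (G := fun y => y i * partialDeriv i w y / ‖y‖)
    (by have := hDc.measurable; fun_prop) hψ' (R := R) (C := C₂) (fun y hy => by
      have h1 := hC₂ y (by simpa using hy)
      have h2 := abs_coord_le_norm y i
      -- at the origin the quotient has the value zero
      by_cases h : ‖y‖ = 0
      · rw [h, div_zero, abs_zero]; exact (norm_nonneg _).trans h1
      · have hp : 0 < ‖y‖ := lt_of_le_of_ne (norm_nonneg y) (Ne.symm h)
        rw [abs_div, abs_of_pos hp, div_le_iff₀ hp, abs_mul, mul_comm]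
        exact mul_le_mul h1 h2 (abs_nonneg _) ((norm_nonneg _).trans h1)) hR'
  refine ⟨I₁.1.integrableOn, I₂.1.integrableOn, ?_⟩
  rw [← integral_add I₁.1.integrableOn I₂.1.integrableOn, setIntegral_orthant_eq_pi]
  have hφ := integrableOn_orthant_iff_pi.1 (I₁.1.add I₂.1).integrableOn
  refine (integral_pi_congr_update hφ (φ₂ := fun _ => 0) (integrable_zero _ _ _) i
    fun x => ?_).trans (integral_zero _ _)
  rw [integral_zero]
  set z : EuclideanSpace ℝ (Fin n) := WithLp.toLp 2 x with hz
  have ez : ∀ s, (WithLp.toLp 2 (Function.update x i s) : EuclideanSpace ℝ (Fin n)) =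
      setCoord z i s := fun s => rfl
  simp only [ez, Pi.add_apply, setCoord_setCoord, setCoord_same]
  have hcont : Continuous fun s => weight γ (setCoord z i s) *
      (partialDeriv i w (setCoord z i s) * ψ ‖setCoord z i s‖) := by
    have h1 := continuous_setCoord z i
    exact ((continuous_weight hγ).comp h1).mul ((hDc.comp h1).mul
      (hψ.continuous.comp (continuous_norm.comp h1)))
  have hder : ∀ s ∈ Ioi (0 : ℝ), HasDerivAt (fun s => weight γ (setCoord z i s) *
      (partialDeriv i w (setCoord z i s) * ψ ‖setCoord z i s‖))
      (weight γ (setCoord z i s) * (besselOp (γ i) (fun σ => w (setCoord z i σ)) s *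
          ψ ‖setCoord z i s‖) +
        weight γ (setCoord z i s) * (s * partialDeriv i w (setCoord z i s) / ‖setCoord z i s‖ *
          deriv ψ ‖setCoord z i s‖)) s := by
    intro s hs
    have hs' : (0 : ℝ) < s := hs
    have h1 : HasDerivAt (fun s => weight γ (setCoord z i s))
        (γ i / s * weight γ (setCoord z i s)) s := by
      simp only [weight_setCoord]
      refine ((Real.hasDerivAt_rpow_const (Or.inl hs'.ne')).mul_const _).congr_deriv ?_
      rw [Real.rpow_sub_one hs'.ne']
      ring
    have h2 := hasDerivAt_comp_setCoord (contDiff_partialDeriv hw i) z i s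
    have h3 : HasDerivAt (fun s => ψ ‖setCoord z i s‖)
        (deriv ψ ‖setCoord z i s‖ * (s / ‖setCoord z i s‖)) s :=
      ((hψ.differentiable one_ne_zero _).hasDerivAt).comp s (hasDerivAt_norm_setCoord z i hs')
    refine (h1.mul (h2.mul h3)).congr_deriv ?_
    rw [besselOp_setCoord hw, Pi.mul_apply]
    ring
  have htend : Tendsto (fun s => weight γ (setCoord z i s) *
      (partialDeriv i w (setCoord z i s) * ψ ‖setCoord z i s‖)) atTop (𝓝 0) := by
    refine tendsto_const_nhds.congr' ?_
    filter_upwards [eventually_ge_atTop R] with s hs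
    rw [hR _ (hs.trans ?_)]
    · ring
    · have := abs_coord_le_norm (setCoord z i s) i
      rw [setCoord_same] at this
      exact (le_abs_self s).trans this
  have J₁ := I₁.2 z i
  have J₂ := I₂.2 z i
  simp only [setCoord_setCoord, setCoord_same] at J₁ J₂
  have hint := (J₁.add J₂).integrableOn (s := Ioi (0 : ℝ))
  have hfin := integral_Ioi_of_hasDerivAt_of_tendsto hcont.continuousWithinAt hder hint htend
  refine hfin.trans ?_
  rw [weight_setCoord, Real.zero_rpow (hγ i).ne']
  ring

/-- The weak form of the polar decomposition of the Laplace–Bessel operator: as `ψ(|y|)` has the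
gradient `ψ'(|y|) y / |y|`, only the radial derivative of `w` appears. -/
lemma integral_laplaceBessel_radial {γ : Fin n → ℝ} (hγ : ∀ i, 0 < γ i)
    {w : EuclideanSpace ℝ (Fin n) → ℝ} (hw : ContDiff ℝ 2 w) (he : GloballyEven w)
    {ψ : ℝ → ℝ} (hψ : ContDiff ℝ 1 ψ) {R : ℝ} (hR : ∀ ρ, R ≤ ρ → ψ ρ = 0) :
    IntegrableOn (fun y => weight γ y * (laplaceBessel γ w y * ψ ‖y‖)) (orthant n) ∧
      IntegrableOn (fun y => weight γ y * (fderiv ℝ w y y / ‖y‖ * deriv ψ ‖y‖)) (orthant n) ∧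
      (∫ y in orthant n, weight γ y * (laplaceBessel γ w y * ψ ‖y‖)) +
        ∫ y in orthant n, weight γ y * (fderiv ℝ w y y / ‖y‖ * deriv ψ ‖y‖) = 0 := by
  have h := fun i => integral_coordinate_eq_zero hγ hw he hψ hR i
  have e₁ : (fun y => weight γ y * (laplaceBessel γ w y * ψ ‖y‖)) = fun y => ∑ i, weight γ y *
      (besselOp (γ i) (fun s => w (setCoord y i s)) (y i) * ψ ‖y‖) := by
    funext y
    rw [laplaceBessel, Finset.sum_mul, Finset.mul_sum]
  have e₂ : (fun y => weight γ y * (fderiv ℝ w y y / ‖y‖ * deriv ψ ‖y‖)) = fun y => ∑ i,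
      weight γ y * (y i * partialDeriv i w y / ‖y‖ * deriv ψ ‖y‖) := by
    funext y
    rw [fderiv_self_eq_sum, Finset.sum_div, Finset.sum_mul, Finset.mul_sum]
  rw [e₁, e₂]
  refine ⟨integrable_finsetSum _ fun i _ => (h i).1,
    integrable_finsetSum _ fun i _ => (h i).2.1, ?_⟩
  rw [integral_finsetSum _ fun i _ => (h i).1, integral_finsetSum _ fun i _ => (h i).2.1,
    ← Finset.sum_add_distrib]
  exact Finset.sum_eq_zero fun i _ => (h i).2.2

end WeakIdentity

/-! ### The weighted sphere and its Darboux equation -/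

section Sphere

variable {n : ℕ}

/-- The normalized weighted surface measure on the spherical part, pushed forward to the ambient
space. -/
def sphMeasure (γ : Fin n → ℝ) : Measure (EuclideanSpace ℝ (Fin n)) :=
  Measure.map (fun θ : Metric.sphere (0 : EuclideanSpace ℝ (Fin n)) 1 =>
      (θ : EuclideanSpace ℝ (Fin n)))
    (densityMeasure ((surfaceMeasure n).restrict (spherePart n))
      fun θ => weight γ (θ : EuclideanSpace ℝ (Fin n)) / weightedArea γ)

variable {γ : Fin n → ℝ}

lemma measurableEmbedding_sphere : MeasurableEmbedding
    (fun θ : Metric.sphere (0 : EuclideanSpace ℝ (Fin n)) 1 => (θ : EuclideanSpace ℝ (Fin n))) :=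
  MeasurableEmbedding.subtype_coe Metric.isClosed_sphere.measurableSet

lemma measurable_sphereDensity (hγ : ∀ i, 0 < γ i) :
    Measurable fun θ : Metric.sphere (0 : EuclideanSpace ℝ (Fin n)) 1 =>
      weight γ (θ : EuclideanSpace ℝ (Fin n)) / weightedArea γ :=
  (((continuous_weight hγ).comp continuous_subtype_val).div_const _).measurable

lemma sphereDensity_nonneg (hn : 1 ≤ n) (hγ : ∀ i, 0 < γ i) :
    ∀ᵐ θ ∂((surfaceMeasure n).restrict (spherePart n)), 0 ≤ weight γ θ.1 / weightedArea γ := by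
  filter_upwards [ae_restrict_mem measurableSet_spherePart] with θ hθ
  exact div_nonneg (weight_nonneg (orthant_subset hθ)) (weightedArea_pos hn hγ).le

lemma isProbabilityMeasure_sphMeasure (hn : 1 ≤ n) (hγ : ∀ i, 0 < γ i) :
    IsProbabilityMeasure (sphMeasure γ) := by
  have := isProbabilityMeasure_densityMeasure ((integrable_weight_sphere hγ).div_const
    (weightedArea γ)) (sphereDensity_nonneg hn hγ) (by
      rw [integral_div, integral_weight_sphere hn hγ, div_self (weightedArea_pos hn hγ).ne'])
  exact Measure.isProbabilityMeasure_map measurableEmbedding_sphere.measurable.aemeasurable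

lemma integral_sphMeasure (hn : 1 ≤ n) (hγ : ∀ i, 0 < γ i)
    (g : EuclideanSpace ℝ (Fin n) → ℝ) :
    ∫ y, g y ∂(sphMeasure γ) = 1 / weightedArea γ * ∫ θ in spherePart n,
      weight γ (θ : EuclideanSpace ℝ (Fin n)) * g θ ∂(surfaceMeasure n) := by
  rw [sphMeasure, measurableEmbedding_sphere.integral_map,
    integral_densityMeasure (measurable_sphereDensity hγ) (sphereDensity_nonneg hn hγ),
    ← integral_const_mul]
  congr 1
  funext θ
  ring

lemma ae_sphMeasure (γ : Fin n → ℝ) :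
    ∀ᵐ y ∂(sphMeasure γ), y ∈ orthant n ∧ ‖y‖ = 1 := by
  rw [sphMeasure, measurableEmbedding_sphere.ae_map_iff]
  refine densityMeasure_absolutelyContinuous.ae_le ?_
  filter_upwards [ae_restrict_mem measurableSet_spherePart] with θ hθ
  exact ⟨hθ, by simp⟩

lemma closedBall_compl_null {μ : Measure (EuclideanSpace ℝ (Fin n))} (h : ∀ᵐ y ∂μ, ‖y‖ ≤ 1) :
    μ (Metric.closedBall (0 : EuclideanSpace ℝ (Fin n)) 1)ᶜ = 0 := by
  rw [← mem_ae_iff]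
  filter_upwards [h] with y hy
  simpa using hy

/-- The dilation means `t ↦ ∫ w(t y) dμ(y)` of even `C²` functions `w` satisfy the
Euler–Poisson–Darboux equation with parameter `k`. -/
def HasDarbouxIdentity (γ : Fin n → ℝ) (k : ℝ) (μ : Measure (EuclideanSpace ℝ (Fin n))) : Prop :=
  ∀ w : EuclideanSpace ℝ (Fin n) → ℝ, ContDiff ℝ 2 w → GloballyEven w → ∀ t : ℝ, 0 < t →
    besselOp k (fun t => ∫ y, w (t • y) ∂μ) t = ∫ y, laplaceBessel γ w (t • y) ∂μ

lemma contDiff_comp_smul {m : WithTop ℕ∞} {w : EuclideanSpace ℝ (Fin n) → ℝ}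
    (hw : ContDiff ℝ m w) :
    ContDiff ℝ m fun q : ℝ × EuclideanSpace ℝ (Fin n) => w (q.1 • q.2) :=
  hw.comp (contDiff_fst.smul contDiff_snd)

lemma fderiv_comp_smul {w : EuclideanSpace ℝ (Fin n) → ℝ} (hw : ContDiff ℝ 1 w) (s : ℝ)
    (y : EuclideanSpace ℝ (Fin n)) :
    fderiv ℝ (fun q : ℝ × EuclideanSpace ℝ (Fin n) => w (q.1 • q.2)) (s, y) (1, 0) =
      fderiv ℝ w (s • y) y := by
  have h1 := hasDerivAt_slice (contDiff_comp_smul hw) s y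
  have h2 : HasDerivAt (fun s : ℝ => w (s • y)) (fderiv ℝ w (s • y) y) s := by
    have h3 : HasDerivAt (fun s : ℝ => s • y) ((1 : ℝ) • y) s := (hasDerivAt_id s).smul_const y
    rw [one_smul] at h3
    exact ((hw.differentiable one_ne_zero (s • y)).hasFDerivAt).comp_hasDerivAt s h3
  exact h1.unique h2

lemma GloballyEven.abs_laplaceBessel_le {w : EuclideanSpace ℝ (Fin n) → ℝ} (he : GloballyEven w)
    (hw : ContDiff ℝ 2 w) (γ : Fin n → ℝ) (R : ℝ) :
    ∃ C, ∀ x : EuclideanSpace ℝ (Fin n), ‖x‖ ≤ R → |laplaceBessel γ w x| ≤ C := by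
  choose C hC using fun i => he.abs_besselOp_le hw (γ i) R
  exact ⟨∑ i, C i, fun x hx => (Finset.abs_sum_le_sum_abs _ _).trans
    (Finset.sum_le_sum fun i _ => hC i i x hx)⟩

lemma measurable_laplaceBessel {w : EuclideanSpace ℝ (Fin n) → ℝ} (hw : ContDiff ℝ 2 w)
    (γ : Fin n → ℝ) : Measurable (laplaceBessel γ w) :=
  Finset.measurable_sum _ fun i _ => measurable_besselOp_setCoord hw (γ i) i

lemma continuousAt_laplaceBessel {w : EuclideanSpace ℝ (Fin n) → ℝ} (hw : ContDiff ℝ 2 w)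
    (γ : Fin n → ℝ) {x : EuclideanSpace ℝ (Fin n)} (hx : x ∈ orthant n) :
    ContinuousAt (laplaceBessel γ w) x := by
  have e : laplaceBessel γ w = fun x => ∑ i, (partialDeriv i (partialDeriv i w) x +
      γ i / x i * partialDeriv i w x) := funext fun x => laplaceBessel_eq hw γ x
  rw [e]
  refine tendsto_finsetSum _ fun i _ => ?_
  have h1 := (continuous_partialDeriv (contDiff_partialDeriv hw i) i).continuousAt (x := x)
  have h2 := (continuous_partialDeriv (hw.of_le (by norm_num)) i).continuousAt (x := x)
  have h3 : ContinuousAt (fun x : EuclideanSpace ℝ (Fin n) => x i) x := by fun_prop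
  exact h1.add ((continuousAt_const.div h3 (hx i).ne').mul h2)

/-- `Δ_γ w` may be discontinuous on the faces, where the quotients `w_{x_i} / x_i` take the value `0`,
but it is bounded there and the faces do not meet the support of `μ`. -/
lemma continuousOn_integral_laplaceBessel {w : EuclideanSpace ℝ (Fin n) → ℝ} (hw : ContDiff ℝ 2 w)
    (he : GloballyEven w) (γ : Fin n → ℝ) {μ : Measure (EuclideanSpace ℝ (Fin n))}
    [IsFiniteMeasure μ] (hμ : ∀ᵐ y ∂μ, y ∈ orthant n ∧ ‖y‖ ≤ 1) :
    ContinuousOn (fun t : ℝ => ∫ y, laplaceBessel γ w (t • y) ∂μ) (Ioi 0) := by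
  intro t ht
  have ht' : (0 : ℝ) < t := ht
  obtain ⟨C, hC⟩ := he.abs_laplaceBessel_le hw γ (t + 1)
  refine ContinuousAt.continuousWithinAt ?_
  refine continuousAt_of_dominated (bound := fun _ => C) ?_ ?_ (integrable_const C) ?_
  · exact Eventually.of_forall fun s =>
      ((measurable_laplaceBessel hw γ).comp (measurable_const_smul s)).aestronglyMeasurable
  · filter_upwards [Ioo_mem_nhds ht' (lt_add_one t)] with s hs
    filter_upwards [hμ] with y hy
    refine hC _ ?_
    rw [norm_smul, Real.norm_eq_abs, abs_of_pos hs.1]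
    nlinarith [hs.1, hs.2, hy.2, norm_nonneg y]
  · filter_upwards [hμ] with y hy
    have h1 := continuousAt_laplaceBessel hw γ ((smul_mem_orthant_iff ht').2 hy.1)
    exact ContinuousAt.comp (f := fun s : ℝ => s • y) (g := laplaceBessel γ w) h1 (by fun_prop)

lemma integrable_mul_of_tsupport {ψ h : ℝ → ℝ} (hψ : Continuous ψ) (hc : HasCompactSupport ψ)
    (hs : tsupport ψ ⊆ Ioi 0) (hh : ContinuousOn h (Ioi 0)) : Integrable fun x => ψ x * h x := by
  have hsub : tsupport (fun x => ψ x * h x) ⊆ tsupport ψ :=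
    closure_mono (Function.support_mul_subset_left ψ h)
  exact ((hψ.continuousOn.mul hh).continuous_of_tsupport_subset isOpen_Ioi (hsub.trans hs)
    ).integrable_of_hasCompactSupport (hc.mono' (subset_trans subset_closure hsub))

/-- The spherical means satisfy the Darboux equation: the weak identity of Green type on the
orthant, read in polar coordinates, says so after testing against radial functions. -/
lemma hasDarbouxIdentity_sphMeasure (hn : 1 ≤ n) (hγ : ∀ i, 0 < γ i) :
    HasDarbouxIdentity γ (homDim γ - 1) (sphMeasure γ) := by
  intro w hw he
  have hprob := isProbabilityMeasure_sphMeasure hn hγ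
  have hae := ae_sphMeasure γ
  have hae' : ∀ᵐ y ∂(sphMeasure γ), y ∈ orthant n ∧ ‖y‖ ≤ 1 :=
    hae.mono fun y hy => ⟨hy.1, hy.2.le⟩
  have hK := isCompact_closedBall (0 : EuclideanSpace ℝ (Fin n)) 1
  have hμ := closedBall_compl_null (hae'.mono fun y hy => hy.2)
  have hA := weightedArea_pos hn hγ
  set N := homDim γ with hN
  have hN1 : 1 < N := homDim_pos hn hγ
  set m : ℝ → ℝ := fun t => ∫ y, w (t • y) ∂(sphMeasure γ) with hm
  set D : ℝ → ℝ := fun t => ∫ y, fderiv ℝ w (t • y) y ∂(sphMeasure γ) with hD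
  set a : ℝ → ℝ := fun t => ∫ y, laplaceBessel γ w (t • y) ∂(sphMeasure γ) with ha
  have hmC : ContDiff ℝ 2 m := contDiff_integral_of_compact hK hμ 2 (contDiff_comp_smul hw)
  have hmD : deriv m = D := by
    funext s
    rw [(hasDerivAt_integral_of_compact hK hμ
      (contDiff_comp_smul (hw.of_le (by norm_num : (1 : WithTop ℕ∞) ≤ 2))) s).deriv]
    exact integral_congr_ae (Eventually.of_forall fun y =>
      fderiv_comp_smul (hw.of_le (by norm_num)) s y)
  have hDC : ContDiff ℝ 1 D := by
    rw [← hmD]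
    exact (contDiff_succ_iff_deriv.1 (show ContDiff ℝ (1 + 1) m from hmC)).2.2
  have hD' : Continuous (deriv D) := hDC.continuous_deriv_one
  have haC : ContinuousOn a (Ioi 0) := continuousOn_integral_laplaceBessel hw he γ hae'
  have hpow : ContinuousOn (fun ρ : ℝ => ρ ^ (N - 1)) (Ioi 0) := fun ρ hρ =>
    (Real.continuousAt_rpow_const ρ _ (Or.inl (ne_of_gt hρ))).continuousWithinAt
  have hbC : ContinuousOn (fun ρ => deriv D ρ + (N - 1) / ρ * D ρ) (Ioi 0) :=
    hD'.continuousOn.add ((continuousOn_const.div continuousOn_id fun ρ hρ => ne_of_gt hρ).mul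
      hDC.continuous.continuousOn)
  set F : ℝ → ℝ := fun ρ => ρ ^ (N - 1) * (a ρ - (deriv D ρ + (N - 1) / ρ * D ρ)) with hF
  have hFC : ContinuousOn F (Ioi 0) := hpow.mul (haC.sub hbC)
  -- `F` is the defect of the equation times `ρ ^ (N - 1)`; it vanishes because it is continuous and
  -- orthogonal to all test functions supported in the open half-line.
  have hzero : ∀ ψ : ℝ → ℝ, ContDiff ℝ (⊤ : ℕ∞) ψ → HasCompactSupport ψ → tsupport ψ ⊆ Ioi 0 →
      ∫ ρ, ψ ρ • F ρ = 0 := by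
    intro ψ hψ hc hs
    have hψ1 : ContDiff ℝ 1 ψ := hψ.of_le (by exact_mod_cast le_top)
    have hψc := hψ1.continuous
    have hψ'c : Continuous (deriv ψ) := hψ1.continuous_deriv_one
    have hoff : ∀ ρ, ρ ∉ Ioi (0 : ℝ) → ψ ρ = 0 := fun ρ hρ =>
      image_eq_zero_of_notMem_tsupport fun h => hρ (hs h)
    obtain ⟨R, hR⟩ := hc.isCompact.isBounded.subset_closedBall (0 : ℝ)
    have hR' : ∀ ρ, |R| + 1 ≤ ρ → ψ ρ = 0 := fun ρ hρ =>
      image_eq_zero_of_notMem_tsupport fun h => by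
        have h1 := hR h
        rw [Metric.mem_closedBall, dist_zero_right, Real.norm_eq_abs] at h1
        linarith [le_abs_self ρ, le_abs_self R]
    obtain ⟨I₁, I₂, hsum⟩ := integral_laplaceBessel_radial hγ hw he hψ1 hR'
    have e₁ : ∀ ρ, ∫ θ in spherePart n, weight γ (θ : EuclideanSpace ℝ (Fin n)) *
        laplaceBessel γ w (ρ • (θ : EuclideanSpace ℝ (Fin n))) ∂(surfaceMeasure n) =
        weightedArea γ * a ρ := by
      intro ρ
      rw [ha]
      dsimp only
      rw [integral_sphMeasure hn hγ]
      field_simp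
    have e₂ : ∀ ρ, 0 < ρ → ∫ θ in spherePart n, weight γ (θ : EuclideanSpace ℝ (Fin n)) *
        (fderiv ℝ w (ρ • (θ : EuclideanSpace ℝ (Fin n))) (ρ • (θ : EuclideanSpace ℝ (Fin n))) /
          ‖ρ • (θ : EuclideanSpace ℝ (Fin n))‖) ∂(surfaceMeasure n) =
        weightedArea γ * D ρ := by
      intro ρ hρ
      have : ∀ θ : Metric.sphere (0 : EuclideanSpace ℝ (Fin n)) 1,
          fderiv ℝ w (ρ • (θ : EuclideanSpace ℝ (Fin n))) (ρ • (θ : EuclideanSpace ℝ (Fin n))) /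
          ‖ρ • (θ : EuclideanSpace ℝ (Fin n))‖ =
          fderiv ℝ w (ρ • (θ : EuclideanSpace ℝ (Fin n))) (θ : EuclideanSpace ℝ (Fin n)) := by
        intro θ
        have hθ : ‖(θ : EuclideanSpace ℝ (Fin n))‖ = 1 := by simp
        rw [norm_smul, hθ, mul_one, Real.norm_eq_abs, abs_of_pos hρ, map_smul, smul_eq_mul,
          mul_div_cancel_left₀ _ hρ.ne']
      simp only [this]
      rw [hD]
      dsimp only
      rw [integral_sphMeasure hn hγ]
      field_simp
    -- both terms of Green's identity in polar coordinates
    have h₁ : ∫ y in orthant n, weight γ y * (laplaceBessel γ w y * ψ ‖y‖) =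
        weightedArea γ * ∫ ρ in Ioi (0 : ℝ), ψ ρ * (ρ ^ (N - 1) * a ρ) := by
      rw [setIntegral_orthant_polar hn γ I₁, ← integral_const_mul]
      refine setIntegral_congr_fun measurableSet_Ioi fun ρ _ => ?_
      rw [e₁]
      ring
    have h₂ : ∫ y in orthant n, weight γ y * (fderiv ℝ w y y / ‖y‖ * deriv ψ ‖y‖) =
        weightedArea γ * ∫ ρ in Ioi (0 : ℝ), deriv ψ ρ * (ρ ^ (N - 1) * D ρ) := by
      rw [setIntegral_orthant_polar hn γ (H := fun y => fderiv ℝ w y y / ‖y‖) I₂,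
        ← integral_const_mul]
      refine setIntegral_congr_fun measurableSet_Ioi fun ρ hρ => ?_
      rw [e₂ ρ hρ]
      ring
    rw [h₁, h₂, ← mul_add] at hsum
    have hsum' := (mul_eq_zero.1 hsum).resolve_left hA.ne'
    have hcs' : HasCompactSupport (deriv ψ) := hc.deriv
    have hs' : tsupport (deriv ψ) ⊆ Ioi 0 := tsupport_deriv_subset.trans hs
    have J₁ : Integrable fun ρ => ψ ρ * (ρ ^ (N - 1) * a ρ) :=
      integrable_mul_of_tsupport hψc hc hs (hpow.mul haC)
    have J₂ : Integrable fun ρ => deriv ψ ρ * (ρ ^ (N - 1) * D ρ) :=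
      integrable_mul_of_tsupport hψ'c hcs' hs' (hpow.mul hDC.continuous.continuousOn)
    have J₃ : Integrable fun ρ => ψ ρ * (ρ ^ (N - 1) * (deriv D ρ + (N - 1) / ρ * D ρ)) :=
      integrable_mul_of_tsupport hψc hc hs (hpow.mul hbC)
    -- integration by parts in the radius, with `ψ` zero near both ends
    have hIBP : (∫ ρ in Ioi (0 : ℝ), (deriv ψ ρ * (ρ ^ (N - 1) * D ρ) +
        ψ ρ * (ρ ^ (N - 1) * (deriv D ρ + (N - 1) / ρ * D ρ)))) = 0 := by
      have hcw : ContinuousWithinAt (fun ρ => ψ ρ * (ρ ^ (N - 1) * D ρ)) (Ici 0) 0 :=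
        (hψc.mul ((Real.continuous_rpow_const (by linarith)).mul hDC.continuous)
          ).continuousWithinAt
      have hder : ∀ ρ ∈ Ioi (0 : ℝ), HasDerivAt (fun ρ => ψ ρ * (ρ ^ (N - 1) * D ρ))
          (deriv ψ ρ * (ρ ^ (N - 1) * D ρ) +
            ψ ρ * (ρ ^ (N - 1) * (deriv D ρ + (N - 1) / ρ * D ρ))) ρ := by
        intro ρ hρ
        have hρ' : (0 : ℝ) < ρ := hρ
        have h1 := (hψ1.differentiable one_ne_zero ρ).hasDerivAt
        have h2 := (hDC.differentiable one_ne_zero ρ).hasDerivAt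
        have h3 := Real.hasDerivAt_rpow_const (x := ρ) (p := N - 1) (Or.inl hρ'.ne')
        refine (h1.mul (h3.mul h2)).congr_deriv ?_
        rw [Real.rpow_sub_one hρ'.ne', Pi.mul_apply]
        ring
      have htend : Tendsto (fun ρ => ψ ρ * (ρ ^ (N - 1) * D ρ)) atTop (𝓝 0) := by
        refine tendsto_const_nhds.congr' ?_
        filter_upwards [eventually_ge_atTop (|R| + 1)] with ρ hρ
        rw [hR' ρ hρ, zero_mul]
      rw [integral_Ioi_of_hasDerivAt_of_tendsto hcw hder (J₂.add J₃).integrableOn htend,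
        hoff 0 (by simp)]
      ring
    rw [integral_add J₂.integrableOn J₃.integrableOn] at hIBP
    have e₃ : ∫ ρ, ψ ρ • F ρ = ∫ ρ in Ioi (0 : ℝ), ψ ρ • F ρ := by
      rw [setIntegral_eq_integral_of_forall_compl_eq_zero]
      intro ρ hρ
      rw [hoff ρ hρ, zero_smul]
    have e₄ : ∀ ρ, ψ ρ • F ρ = ψ ρ * (ρ ^ (N - 1) * a ρ) -
        ψ ρ * (ρ ^ (N - 1) * (deriv D ρ + (N - 1) / ρ * D ρ)) := by
      intro ρ
      rw [hF, smul_eq_mul]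
      ring
    rw [e₃]
    simp only [e₄]
    rw [integral_sub J₁.integrableOn J₃.integrableOn]
    linarith
  have hFae := isOpen_Ioi.ae_eq_zero_of_integral_contDiff_smul_eq_zero
    (hFC.locallyIntegrableOn measurableSet_Ioi) hzero
  have hF0 : EqOn F (fun _ => 0) (Ioi 0) := Measure.eqOn_open_of_ae_eq
    ((ae_restrict_iff' measurableSet_Ioi).2 hFae) isOpen_Ioi hFC continuousOn_const
  intro t ht
  have h := (mul_eq_zero.1 (hF0 ht)).resolve_left (Real.rpow_pos_of_pos ht _).ne'
  rw [besselOp, hmD]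
  linarith

end Sphere

/-! ### The weighted ball and its Darboux equation -/

section Ball

variable {n : ℕ}

/-- The probability measure on `(0, 1)` with density proportional to
`ρ ^ (2 p - 1) * (1 - ρ ^ 2) ^ (q - 1)`. -/
def radialMeasure (p q : ℝ) : Measure ℝ :=
  densityMeasure (volume.restrict (Ioo 0 1)) fun ρ =>
    2 / ProbabilityTheory.beta p q * (ρ ^ (2 * p - 1) * (1 - ρ ^ 2) ^ (q - 1))

lemma measurable_radialDensity (p q : ℝ) : Measurable fun ρ : ℝ =>
    2 / ProbabilityTheory.beta p q * (ρ ^ (2 * p - 1) * (1 - ρ ^ 2) ^ (q - 1)) := by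
  fun_prop

lemma radialDensity_nonneg {p q : ℝ} (hp : 0 < p) (hq : 0 < q) :
    ∀ᵐ ρ ∂(volume.restrict (Ioo (0 : ℝ) 1)),
      0 ≤ 2 / ProbabilityTheory.beta p q * (ρ ^ (2 * p - 1) * (1 - ρ ^ 2) ^ (q - 1)) := by
  filter_upwards [ae_restrict_mem measurableSet_Ioo] with ρ hρ
  have h1 := ProbabilityTheory.beta_pos hp hq
  have h2 : 0 ≤ 1 - ρ ^ 2 := by nlinarith [hρ.1, hρ.2]
  exact mul_nonneg (div_pos two_pos h1).le
    (mul_nonneg (Real.rpow_nonneg hρ.1.le _) (Real.rpow_nonneg h2 _))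

lemma isProbabilityMeasure_radialMeasure {p q : ℝ} (hp : 0 < p) (hq : 0 < q) :
    IsProbabilityMeasure (radialMeasure p q) := by
  obtain ⟨h1, h2⟩ := integral_beta_sq hp hq
  refine isProbabilityMeasure_densityMeasure (h1.const_mul _) (radialDensity_nonneg hp hq) ?_
  rw [integral_const_mul, h2]
  have := (ProbabilityTheory.beta_pos hp hq).ne'
  field_simp

lemma ae_radialMeasure (p q : ℝ) : ∀ᵐ ρ ∂(radialMeasure p q), ρ ∈ Ioo (0 : ℝ) 1 :=
  densityMeasure_absolutelyContinuous.ae_le (ae_restrict_mem measurableSet_Ioo)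

/-- The normalized measure with density proportional to `(1 - |y|²) ^ (q - 1) y^γ` on the unit
ball part, in polar form. -/
def ballMeasure (γ : Fin n → ℝ) (q : ℝ) : Measure (EuclideanSpace ℝ (Fin n)) :=
  Measure.map (fun z : ℝ × EuclideanSpace ℝ (Fin n) => z.1 • z.2)
    ((radialMeasure (homDim γ / 2) q).prod (sphMeasure γ))

variable {γ : Fin n → ℝ} {q : ℝ}

lemma measurable_smul_pair :
    Measurable fun z : ℝ × EuclideanSpace ℝ (Fin n) => z.1 • z.2 := by fun_prop

lemma isProbabilityMeasure_ballMeasure (hn : 1 ≤ n) (hγ : ∀ i, 0 < γ i) (hq : 0 < q) :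
    IsProbabilityMeasure (ballMeasure γ q) := by
  have h1 := isProbabilityMeasure_sphMeasure hn hγ
  have h2 := isProbabilityMeasure_radialMeasure
    (show 0 < homDim γ / 2 by linarith [homDim_pos hn hγ]) hq
  exact Measure.isProbabilityMeasure_map measurable_smul_pair.aemeasurable

lemma ae_prod_radial_sph (hn : 1 ≤ n) (hγ : ∀ i, 0 < γ i) (hq : 0 < q) :
    ∀ᵐ z ∂((radialMeasure (homDim γ / 2) q).prod (sphMeasure γ)),
      z.1 ∈ Ioo (0 : ℝ) 1 ∧ z.2 ∈ orthant n ∧ ‖z.2‖ = 1 := by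
  have h1 := isProbabilityMeasure_sphMeasure hn hγ
  have h2 := isProbabilityMeasure_radialMeasure
    (show 0 < homDim γ / 2 by linarith [homDim_pos hn hγ]) hq
  have h3 := Measure.quasiMeasurePreserving_fst
    (μ := radialMeasure (homDim γ / 2) q) (ν := sphMeasure γ) |>.ae (ae_radialMeasure _ q)
  have h4 := Measure.quasiMeasurePreserving_snd
    (μ := radialMeasure (homDim γ / 2) q) (ν := sphMeasure γ) |>.ae (ae_sphMeasure γ)
  filter_upwards [h3, h4] with z hz1 hz2 using ⟨hz1, hz2⟩

lemma ae_ballMeasure (hn : 1 ≤ n) (hγ : ∀ i, 0 < γ i) (hq : 0 < q) :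
    ∀ᵐ y ∂(ballMeasure γ q), y ∈ orthant n ∧ ‖y‖ ≤ 1 := by
  have hm : MeasurableSet {y : EuclideanSpace ℝ (Fin n) | y ∈ orthant n ∧ ‖y‖ ≤ 1} :=
    measurableSet_orthant.inter (measurableSet_le measurable_norm measurable_const)
  rw [ballMeasure, ae_map_iff measurable_smul_pair.aemeasurable hm]
  filter_upwards [ae_prod_radial_sph hn hγ hq] with z hz
  refine ⟨(smul_mem_orthant_iff hz.1.1).2 hz.2.1, ?_⟩
  rw [norm_smul, hz.2.2, mul_one, Real.norm_eq_abs, abs_of_pos hz.1.1]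
  exact hz.1.2.le

lemma integral_ballMeasure (hn : 1 ≤ n) (hγ : ∀ i, 0 < γ i) (hq : 0 < q)
    {g : EuclideanSpace ℝ (Fin n) → ℝ} (hg : Measurable g) {C : ℝ}
    (hC : ∀ y, ‖y‖ ≤ 1 → |g y| ≤ C) :
    Integrable (fun ρ => ∫ y, g (ρ • y) ∂(sphMeasure γ)) (radialMeasure (homDim γ / 2) q) ∧
      ∫ y, g y ∂(ballMeasure γ q) =
        ∫ ρ, ∫ y, g (ρ • y) ∂(sphMeasure γ) ∂(radialMeasure (homDim γ / 2) q) := by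
  have h1 := isProbabilityMeasure_sphMeasure hn hγ
  have h2 := isProbabilityMeasure_radialMeasure
    (show 0 < homDim γ / 2 by linarith [homDim_pos hn hγ]) hq
  have hi : Integrable (fun z : ℝ × EuclideanSpace ℝ (Fin n) => g (z.1 • z.2))
      ((radialMeasure (homDim γ / 2) q).prod (sphMeasure γ)) := by
    refine Integrable.of_bound (hg.comp measurable_smul_pair).aestronglyMeasurable C ?_
    filter_upwards [ae_prod_radial_sph hn hγ hq] with z hz
    refine hC _ ?_
    rw [norm_smul, hz.2.2, mul_one, Real.norm_eq_abs, abs_of_pos hz.1.1]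
    exact hz.1.2.le
  refine ⟨hi.integral_prod_left, ?_⟩
  rw [ballMeasure, integral_map measurable_smul_pair.aemeasurable hg.aestronglyMeasurable,
    integral_prod _ hi]

/-- The ball means satisfy the Darboux equation: after the one for the spherical means, the
difference of the two sides is the integral of an exact derivative in the radius. -/
lemma hasDarbouxIdentity_ballMeasure (hn : 1 ≤ n) (hγ : ∀ i, 0 < γ i) (hq : 0 < q) :
    HasDarbouxIdentity γ (homDim γ - 1 + 2 * q) (ballMeasure γ q) := by
  intro w hw he t ht
  have hN1 := homDim_pos hn hγ
  have h1 := isProbabilityMeasure_sphMeasure hn hγ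
  have h2 := isProbabilityMeasure_radialMeasure
    (show 0 < homDim γ / 2 by linarith) hq
  have hdarb := hasDarbouxIdentity_sphMeasure hn hγ w hw he
  have hp : 0 < homDim γ / 2 := by linarith
  set N := homDim γ with hN
  set L := radialMeasure (N / 2) q with hL
  set m : ℝ → ℝ := fun s => ∫ y, w (s • y) ∂(sphMeasure γ) with hm
  have hmC : ContDiff ℝ 2 m := contDiff_integral_of_compact
    (isCompact_closedBall (0 : EuclideanSpace ℝ (Fin n)) 1)
    (closedBall_compl_null ((ae_sphMeasure γ).mono fun y hy => hy.2.le)) 2 (contDiff_comp_smul hw)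
  have hm1 : ContDiff ℝ 1 (deriv m) :=
    (contDiff_succ_iff_deriv.1 (show ContDiff ℝ (1 + 1) m from hmC)).2.2
  have hd1 : ∀ s, HasDerivAt m (deriv m s) s := fun s =>
    (hmC.differentiable two_ne_zero s).hasDerivAt
  have hd2 : ∀ s, HasDerivAt (deriv m) (deriv (deriv m) s) s := fun s =>
    (hm1.differentiable one_ne_zero s).hasDerivAt
  have hK : L (Icc 0 1)ᶜ = 0 := by
    rw [← mem_ae_iff]
    filter_upwards [ae_radialMeasure (N / 2) q] with ρ hρ using ⟨hρ.1.le, hρ.2.le⟩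
  -- the means over the ball are radial averages of the spherical means
  have hM : (fun t => ∫ y, w (t • y) ∂(ballMeasure γ q)) = fun t => ∫ ρ, m (t * ρ) ∂L := by
    funext s
    obtain ⟨C, hC⟩ := (isCompact_closedBall (0 : EuclideanSpace ℝ (Fin n)) 1
      ).exists_bound_of_continuousOn (f := fun y => w (s • y))
      (hw.continuous.comp (continuous_const_smul s)).continuousOn
    rw [(integral_ballMeasure hn hγ hq (g := fun y => w (s • y))
      (hw.continuous.comp (continuous_const_smul s)).measurable fun y hy => hC y (by simpa using hy)).2]
    simp only [hm, hL, hN, smul_smul]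
  obtain ⟨C, hC⟩ := he.abs_laplaceBessel_le hw γ t
  obtain ⟨hiR, hR⟩ := integral_ballMeasure hn hγ hq (g := fun y => laplaceBessel γ w (t • y))
    ((measurable_laplaceBessel hw γ).comp (measurable_const_smul t)) (C := C) fun y hy => by
      refine hC _ ?_
      rw [norm_smul, Real.norm_eq_abs, abs_of_pos ht]
      exact mul_le_of_le_one_right ht.le hy
  have hh : ContDiff ℝ 2 fun z : ℝ × ℝ => m (z.1 * z.2) :=
    hmC.comp (contDiff_fst.mul contDiff_snd)
  have hiL := integrable_of_continuous_of_compact isCompact_Icc hK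
    (continuous_besselOp_slice hh (N - 1 + 2 * q) t)
  rw [hM, besselOp_integral isCompact_Icc hK hh, hR, ← sub_eq_zero, ← integral_sub hiL hiR]
  have hbes : ∀ ρ, besselOp (N - 1 + 2 * q) (fun s => m (s * ρ)) t =
      deriv (deriv m) (t * ρ) * ρ ^ 2 + (N - 1 + 2 * q) / t * (deriv m (t * ρ) * ρ) := by
    intro ρ
    have e1 : deriv (fun s => m (s * ρ)) = fun s => deriv m (s * ρ) * ρ := by
      funext s
      exact (HasDerivAt.comp s (hd1 (s * ρ)) (hasDerivAt_mul_const ρ)).deriv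
    have e2 : deriv (fun s => deriv m (s * ρ) * ρ) t = deriv (deriv m) (t * ρ) * ρ * ρ :=
      ((HasDerivAt.comp (h := fun s => s * ρ) t (hd2 (t * ρ)) (hasDerivAt_mul_const ρ)
        ).mul_const ρ).deriv
    rw [besselOp, e1, e2]
    ring
  have hlap : ∀ ρ, 0 < ρ → ∫ y, laplaceBessel γ w (t • ρ • y) ∂(sphMeasure γ) =
      deriv (deriv m) (t * ρ) + (N - 1) / (t * ρ) * deriv m (t * ρ) := by
    intro ρ hρ
    rw [← besselOp, hdarb (t * ρ) (mul_pos ht hρ)]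
    simp only [smul_smul]
  -- `Φ` vanishes at both ends, and its derivative is the difference of the two sides times the
  -- radial density, up to the factor `-t / c`
  set Φ : ℝ → ℝ := fun ρ => ρ ^ (N - 1) * (1 - ρ ^ 2) ^ q * deriv m (t * ρ) with hΦ
  set c := 2 / ProbabilityTheory.beta (N / 2) q with hc
  have hpt : ∀ ρ ∈ Ioo (0 : ℝ) 1, HasDerivAt Φ (-(t / c) * (c * (ρ ^ (2 * (N / 2) - 1) *
      (1 - ρ ^ 2) ^ (q - 1)) * (besselOp (N - 1 + 2 * q) (fun s => m (s * ρ)) t -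
        ∫ y, laplaceBessel γ w (t • ρ • y) ∂(sphMeasure γ)))) ρ := by
    intro ρ hρ
    have hρ0 : (0 : ℝ) < ρ := hρ.1
    have hρ1 : 0 < 1 - ρ ^ 2 := by nlinarith [hρ.1, hρ.2]
    have k1 := Real.hasDerivAt_rpow_const (x := ρ) (p := N - 1) (Or.inl hρ0.ne')
    have k2 : HasDerivAt (fun ρ : ℝ => 1 - ρ ^ 2) (-(2 * ρ)) ρ := by
      refine ((hasDerivAt_const ρ (1 : ℝ)).sub (hasDerivAt_pow 2 ρ)).congr_deriv ?_
      norm_num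
    have k3 := k2.rpow_const (p := q) (Or.inl hρ1.ne')
    have k4 : HasDerivAt (fun ρ => deriv m (t * ρ)) (deriv (deriv m) (t * ρ) * t) ρ :=
      (hd2 (t * ρ)).comp ρ (hasDerivAt_const_mul t)
    refine ((k1.mul k3).mul k4).congr_deriv ?_
    have hc0 : c ≠ 0 := (div_pos two_pos (ProbabilityTheory.beta_pos hp hq)).ne'
    rw [hbes, hlap ρ hρ0, Pi.mul_apply, show 2 * (N / 2) - 1 = N - 1 by ring,
      Real.rpow_sub_one hρ0.ne' (N - 1)]
    have e : (1 - ρ ^ 2) ^ q = (1 - ρ ^ 2) ^ (q - 1) * (1 - ρ ^ 2) := by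
      rw [Real.rpow_sub_one hρ1.ne', div_mul_cancel₀ _ hρ1.ne']
    rw [e]
    field_simp
    ring
  have hΦc : ContinuousOn Φ (Icc 0 1) := by
    have k1 : Continuous fun ρ : ℝ => ρ ^ (N - 1) := Real.continuous_rpow_const (by linarith)
    have k2 : Continuous fun ρ : ℝ => (1 - ρ ^ 2) ^ q :=
      (Real.continuous_rpow_const hq.le).comp (by fun_prop)
    exact ((k1.mul k2).mul (hm1.continuous.comp (continuous_const_mul t))).continuousOn
  have hint := (integrable_densityMeasure (measurable_radialDensity _ _)
    (radialDensity_nonneg hp hq)).1 (hiL.sub hiR)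
  have hftc := intervalIntegral.integral_eq_sub_of_hasDerivAt_of_le zero_le_one hΦc hpt
    ((intervalIntegrable_iff_integrableOn_Ioo_of_le zero_le_one).2 (hint.const_mul _))
  rw [intervalIntegral.integral_of_le zero_le_one, integral_Ioc_eq_integral_Ioo,
    integral_const_mul] at hftc
  have hb : Φ 1 - Φ 0 = 0 := by
    simp only [hΦ]
    rw [Real.zero_rpow (by linarith : N - 1 ≠ 0), one_pow, sub_self, Real.zero_rpow hq.ne']
    ring
  rw [hb] at hftc
  have hc0 : -(t / c) ≠ 0 := neg_ne_zero.2
    (div_pos ht (div_pos two_pos (ProbabilityTheory.beta_pos hp hq))).ne'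
  rw [hL, radialMeasure, integral_densityMeasure (measurable_radialDensity _ _)
    (radialDensity_nonneg hp hq)]
  exact (mul_eq_zero.1 hftc).resolve_left hc0

/-- Polar coordinates in the integral over the ball part. -/
lemma setIntegral_ballPart (hn : 1 ≤ n) (hγ : ∀ i, 0 < γ i) (hq : 0 < q)
    {H : EuclideanSpace ℝ (Fin n) → ℝ} (hH : Continuous H) :
    IntegrableOn (fun y => H y * (1 - ‖y‖ ^ 2) ^ (q - 1) * weight γ y) (ballPart n) ∧
      ∫ y in ballPart n, H y * (1 - ‖y‖ ^ 2) ^ (q - 1) * weight γ y =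
        weightedArea γ * (ProbabilityTheory.beta (homDim γ / 2) q / 2) *
          ∫ y, H y ∂(ballMeasure γ q) := by
  have hp : 0 < homDim γ / 2 := by linarith [homDim_pos hn hγ]
  have hA := weightedArea_pos hn hγ
  have hB := ProbabilityTheory.beta_pos hp hq
  obtain ⟨C, hC⟩ := (isCompact_closedBall (0 : EuclideanSpace ℝ (Fin n)) 1
    ).exists_bound_of_continuousOn hH.continuousOn
  have hball : MeasurableSet (Metric.closedBall (0 : EuclideanSpace ℝ (Fin n)) 1) :=
    Metric.isClosed_closedBall.measurableSet
  have hbp : ballPart n = orthant n ∩ Metric.closedBall 0 1 := by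
    ext y
    simp [ballPart]
  -- cutting off outside the ball separates a bounded factor `H₁` from a radial factor `κ`
  set H₁ := (Metric.closedBall (0 : EuclideanSpace ℝ (Fin n)) 1).indicator H with hH₁
  set κ : ℝ → ℝ := (Iic 1).indicator fun ρ => (1 - ρ ^ 2) ^ (q - 1) with hκ
  have hprod : (fun y => weight γ y * (H₁ y * κ ‖y‖)) =
      (Metric.closedBall (0 : EuclideanSpace ℝ (Fin n)) 1).indicator
        fun y => H y * (1 - ‖y‖ ^ 2) ^ (q - 1) * weight γ y := by
    funext y
    by_cases hy : ‖y‖ ≤ 1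
    · rw [indicator_of_mem (by simpa using hy), hH₁, hκ, indicator_of_mem (by simpa using hy),
        indicator_of_mem (by simpa using hy)]
      ring
    · rw [indicator_of_notMem (by simpa using hy), hH₁, indicator_of_notMem (by simpa using hy)]
      ring
  have hbeta : IntegrableOn (fun ρ : ℝ => ρ ^ (homDim γ - 1) * κ ρ) (Ioi 0) := by
    have e : (fun ρ : ℝ => ρ ^ (homDim γ - 1) * κ ρ) =
        (Iic 1).indicator fun ρ : ℝ => ρ ^ (2 * (homDim γ / 2) - 1) * (1 - ρ ^ 2) ^ (q - 1) := by
      funext ρ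
      rw [show 2 * (homDim γ / 2) - 1 = homDim γ - 1 by ring]
      by_cases h : ρ ∈ Iic (1 : ℝ)
      · rw [hκ, indicator_of_mem h, indicator_of_mem h]
      · rw [hκ, indicator_of_notMem h, indicator_of_notMem h, mul_zero]
    rw [e, IntegrableOn, integrable_indicator_iff measurableSet_Iic, IntegrableOn,
      Measure.restrict_restrict measurableSet_Iic, inter_comm, Ioi_inter_Iic]
    exact (integrableOn_Ioc_iff_integrableOn_Ioo).2 (integral_beta_sq hp hq).1
  have hint := integrableOn_orthant_of_radial hn hγ (hH.measurable.indicator hball) (C := |C|)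
    (fun y => by
      by_cases hy : y ∈ Metric.closedBall (0 : EuclideanSpace ℝ (Fin n)) 1
      · rw [indicator_of_mem hy]
        exact (hC y hy).trans (le_abs_self C)
      · rw [indicator_of_notMem hy, abs_zero]
        exact abs_nonneg _) hbeta
  have hpolar := setIntegral_orthant_polar hn γ hint
  rw [← hH₁, hprod] at hint hpolar
  refine ⟨?_, ?_⟩
  · rw [hbp, inter_comm, IntegrableOn, ← Measure.restrict_restrict hball]
    exact (integrable_indicator_iff hball).1 hint
  rw [hbp, ← setIntegral_indicator hball, hpolar,
    (integral_ballMeasure hn hγ hq hH.measurable fun y hy => hC y (by simpa using hy)).2,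
    radialMeasure, integral_densityMeasure (measurable_radialDensity _ _)
    (radialDensity_nonneg hp hq), ← integral_const_mul]
  have e : ∀ ρ ∈ Ioi (0 : ℝ), ρ ^ (homDim γ - 1) * κ ρ *
      ∫ θ in spherePart n, weight γ (θ : EuclideanSpace ℝ (Fin n)) *
        H₁ (ρ • (θ : EuclideanSpace ℝ (Fin n))) ∂(surfaceMeasure n) =
      (Iic 1).indicator (fun ρ => weightedArea γ * (ProbabilityTheory.beta (homDim γ / 2) q / 2) *
        (2 / ProbabilityTheory.beta (homDim γ / 2) q *
          (ρ ^ (2 * (homDim γ / 2) - 1) * (1 - ρ ^ 2) ^ (q - 1)) *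
          ∫ y, H (ρ • y) ∂(sphMeasure γ))) ρ := by
    intro ρ hρ
    by_cases h : ρ ∈ Iic (1 : ℝ)
    · rw [indicator_of_mem h, hκ, indicator_of_mem h, integral_sphMeasure hn hγ,
        show 2 * (homDim γ / 2) - 1 = homDim γ - 1 by ring]
      have e' : ∀ θ : Metric.sphere (0 : EuclideanSpace ℝ (Fin n)) 1,
          H₁ (ρ • (θ : EuclideanSpace ℝ (Fin n))) = H (ρ • (θ : EuclideanSpace ℝ (Fin n))) := by
        intro θ
        rw [hH₁, indicator_of_mem]
        rw [mem_closedBall_zero_iff, norm_smul, Real.norm_eq_abs, abs_of_pos hρ]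
        simpa using h
      simp only [e']
      field_simp
    · rw [indicator_of_notMem h, hκ, indicator_of_notMem h]
      ring
  rw [setIntegral_congr_fun measurableSet_Ioi e, setIntegral_indicator measurableSet_Iic,
    Ioi_inter_Iic, integral_Ioc_eq_integral_Ioo]

end Ball

/-! ### Averaged translations solve the Cauchy problem -/

section Existence

variable {n : ℕ} {γ : Fin n → ℝ}

lemma setCoord_mem_closedOrthant {x : EuclideanSpace ℝ (Fin n)} (hx : x ∈ closedOrthant n)
    (i : Fin n) {s : ℝ} (hs : 0 ≤ s) : setCoord x i s ∈ closedOrthant n := by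
  intro j
  rw [setCoord_apply]
  split_ifs
  exacts [hs, hx j]

lemma GloballyEven.evenInEach {w : EuclideanSpace ℝ (Fin n) → ℝ} (he : GloballyEven w)
    (hw : ContDiff ℝ 1 w) : EvenInEach w := by
  intro i x _
  have h := (hasDerivAt_comp_setCoord hw x i 0).hasDerivWithinAt (s := Ici 0)
  rw [he.partialDeriv_eq_zero hw] at h
  exact h.derivWithin (uniqueDiffOn_Ici 0 0 self_mem_Ici)

/-- The extension of a function on the closed orthant to the whole space by even reflections. -/
def evenExt (f : EuclideanSpace ℝ (Fin n) → ℝ) (x : EuclideanSpace ℝ (Fin n)) : ℝ :=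
  f (sqrtVec x 0)

lemma evenExt_eq (f : EuclideanSpace ℝ (Fin n) → ℝ) {x : EuclideanSpace ℝ (Fin n)}
    (hx : x ∈ closedOrthant n) : evenExt f x = f x := by
  have : sqrtVec x 0 = x := by
    ext i
    rw [sqrtVec_apply]
    simp [Real.sqrt_sq (hx i)]
  rw [evenExt, this]

lemma globallyEven_evenExt (f : EuclideanSpace ℝ (Fin n) → ℝ) : GloballyEven (evenExt f) := by
  intro i x s
  have : sqrtVec (setCoord x i (-s)) 0 = sqrtVec (setCoord x i s) 0 := by
    ext j
    rw [sqrtVec_apply, sqrtVec_apply, setCoord_apply, setCoord_apply]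
    split_ifs <;> simp
  rw [evenExt, evenExt, this]

lemma contDiff_evenExt {f : EuclideanSpace ℝ (Fin n) → ℝ} (hf : IsC2Even f) :
    ContDiff ℝ 2 (evenExt f) :=
  (contDiff_comp_sqrtVec hf).comp
    (contDiff_id.prodMk (contDiff_const (c := (0 : EuclideanSpace ℝ (Fin n)))))

lemma isC2Even_evenExt {f : EuclideanSpace ℝ (Fin n) → ℝ} (hf : IsC2Even f) :
    IsC2Even (evenExt f) :=
  ⟨(contDiff_evenExt hf).contDiffOn,
    (globallyEven_evenExt f).evenInEach ((contDiff_evenExt hf).of_le (by norm_num))⟩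

lemma transMean_evenExt (γ : Fin n → ℝ) (f : EuclideanSpace ℝ (Fin n) → ℝ) :
    transMean γ (evenExt f) = transMean γ f := by
  funext x y
  exact integral_congr_ae (Eventually.of_forall fun α => evenExt_eq f (transPoint_mem x y α))

/-- `(Δ_γ)_x` and `(Δ_γ)_y` agree on the generalized translation of `f`. -/
lemma laplaceBessel_transMean_comm (hγ : ∀ i, 0 < γ i) {f : EuclideanSpace ℝ (Fin n) → ℝ}
    (hf : IsC2Even f) {x y : EuclideanSpace ℝ (Fin n)} (hx : x ∈ orthant n) (hy : y ∈ orthant n) :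
    laplaceBessel γ (fun x' => transMean γ f x' y) x = laplaceBessel γ (transMean γ f x) y := by
  rw [← transMean_evenExt γ f]
  exact Finset.sum_congr rfl fun i _ => besselOp_transMean_left hγ (isC2Even_evenExt hf)
    (contDiff_evenExt hf) (globallyEven_evenExt f) hx hy i

/-- Averaging the generalized translations over the dilates of a measure with the Darboux identity
solves the Cauchy problem. -/
lemma isSolution_of_hasDarbouxIdentity (hγ : ∀ i, 0 < γ i) {f : EuclideanSpace ℝ (Fin n) → ℝ}
    (hf : IsC2Even f) {k : ℝ} {μ : Measure (EuclideanSpace ℝ (Fin n))} [IsProbabilityMeasure μ]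
    (hμ : ∀ᵐ y ∂μ, y ∈ orthant n ∧ ‖y‖ ≤ 1) (hD : HasDarbouxIdentity γ k μ) :
    IsSolution γ k f fun x t => ∫ y, transMean γ f x (t • y) ∂μ := by
  have hK := isCompact_closedBall (0 : EuclideanSpace ℝ (Fin n)) 1
  have hμ' := closedBall_compl_null (hμ.mono fun y hy => hy.2)
  have hT := contDiff_transMean hγ hf
  have hTx : ∀ x, ContDiff ℝ 2 (transMean γ f x) := fun x =>
    hT.comp (contDiff_const.prodMk contDiff_id)
  have hE : ∀ x, GloballyEven (transMean γ f x) := transMean_even_right hγ hf.1.continuousOn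
  have hU : ContDiff ℝ 2 fun p : EuclideanSpace ℝ (Fin n) × ℝ =>
      ∫ y, transMean γ f p.1 (p.2 • y) ∂μ :=
    contDiff_integral_of_compact hK hμ' 2
      (H := fun q : (EuclideanSpace ℝ (Fin n) × ℝ) × EuclideanSpace ℝ (Fin n) =>
        transMean γ f q.1.1 (q.1.2 • q.2))
      (hT.comp ((contDiff_fst.comp contDiff_fst).prodMk
        ((contDiff_snd.comp contDiff_fst).smul contDiff_snd)))
  have hxt : ∀ t, ContDiff ℝ 2 fun x => ∫ y, transMean γ f x (t • y) ∂μ := fun t =>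
    hU.comp (contDiff_id.prodMk contDiff_const)
  refine ⟨hU.contDiffOn, fun t _ => ?_, fun x hx t ht => ?_, fun x hx => ?_, fun x _ => ?_⟩
  · refine GloballyEven.evenInEach (fun i x s => ?_) ((hxt t).of_le (by norm_num))
    refine integral_congr_ae (Eventually.of_forall fun y => ?_)
    dsimp only
    rw [transMean_comm, transMean_comm γ f (setCoord x i s)]
    exact hE (t • y) i x s
  -- the equation: the Darboux identity in `y`, then `Δ_γ` is moved from `y` to `x`
  · rw [hD _ (hTx x) (hE x) t ht, laplaceBessel_integral hK hμ'
      (h := fun q : EuclideanSpace ℝ (Fin n) × EuclideanSpace ℝ (Fin n) =>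
        transMean γ f q.1 (t • q.2))
      (hT.comp (contDiff_fst.prodMk (contDiff_snd.const_smul t)))]
    refine integral_congr_ae ?_
    filter_upwards [hμ] with y hy
    exact (laplaceBessel_transMean_comm hγ hf hx ((smul_mem_orthant_iff ht).2 hy.1)).symm
  · simp only [zero_smul, transMean_zero hγ hx]
    simp
  · have h1 := hasDerivAt_integral_of_compact hK hμ'
      (contDiff_comp_smul ((hTx x).of_le (by norm_num : (1 : WithTop ℕ∞) ≤ 2))) 0
    have h2 : ∫ y, fderiv ℝ (fun q : ℝ × EuclideanSpace ℝ (Fin n) =>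
        transMean γ f x (q.1 • q.2)) (0, y) (1, 0) ∂μ = 0 := by
      refine integral_eq_zero_of_ae (Eventually.of_forall fun y => ?_)
      dsimp only [Pi.zero_apply]
      rw [fderiv_comp_smul ((hTx x).of_le (by norm_num)), zero_smul, fderiv_self_eq_sum]
      refine Finset.sum_eq_zero fun i _ => ?_
      have h3 := (hE x).partialDeriv_eq_zero ((hTx x).of_le (by norm_num)) i 0
      have h4 : setCoord (0 : EuclideanSpace ℝ (Fin n)) i 0 = 0 := by
        ext j
        simp [setCoord_apply]
      rw [h4] at h3
      rw [h3, mul_zero]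
    rw [h2] at h1
    exact h1.hasDerivWithinAt.derivWithin (uniqueDiffOn_Ici 0 0 self_mem_Ici)

lemma besselOp_congr {g h : ℝ → ℝ} {s : ℝ} (H : g =ᶠ[𝓝 s] h) (κ : ℝ) :
    besselOp κ g s = besselOp κ h s := by
  rw [besselOp, besselOp, H.deriv.deriv_eq, H.deriv_eq]

/-- At an interior point the operator only sees values of the function on the closed orthant. -/
lemma laplaceBessel_congr {g h : EuclideanSpace ℝ (Fin n) → ℝ}
    (H : ∀ x ∈ closedOrthant n, g x = h x) (γ : Fin n → ℝ) {x : EuclideanSpace ℝ (Fin n)}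
    (hx : x ∈ orthant n) : laplaceBessel γ g x = laplaceBessel γ h x := by
  refine Finset.sum_congr rfl fun i _ => besselOp_congr ?_ _
  filter_upwards [lt_mem_nhds (hx i)] with s hs
  exact H _ (setCoord_mem_closedOrthant (orthant_subset hx) i hs.le)

lemma IsSolution.congr {k : ℝ} {f : EuclideanSpace ℝ (Fin n) → ℝ}
    {u v : EuclideanSpace ℝ (Fin n) → ℝ → ℝ} (hu : IsSolution γ k f u)
    (h : ∀ x ∈ closedOrthant n, ∀ t, 0 ≤ t → v x t = u x t) : IsSolution γ k f v := by
  refine ⟨hu.contDiffOn.congr fun p hp => h _ hp.1 _ hp.2, fun t ht i x hx => ?_,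
    fun x hx t ht => ?_, fun x hx => ?_, fun x hx => ?_⟩
  · refine Eq.trans ?_ (hu.even t ht i x hx)
    exact derivWithin_congr (fun s hs => h _ (setCoord_mem_closedOrthant hx i hs) t ht)
      (h _ (setCoord_mem_closedOrthant hx i le_rfl) t ht)
  · rw [laplaceBessel_congr (fun x hx => h x hx t ht.le) γ hx, ← hu.equation x hx t ht]
    refine besselOp_congr ?_ k
    filter_upwards [lt_mem_nhds ht] with s hs using h x (orthant_subset hx) s hs.le
  · rw [h x hx 0 le_rfl, hu.initial_value x hx]
  · refine Eq.trans ?_ (hu.initial_deriv x hx)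
    exact derivWithin_congr (fun s hs => h x hx s hs) (h x hx 0 le_rfl)

lemma sphericalMean_eq (hn : 1 ≤ n) (hγ : ∀ i, 0 < γ i) {f : EuclideanSpace ℝ (Fin n) → ℝ}
    (hf : ContinuousOn f (closedOrthant n)) {x : EuclideanSpace ℝ (Fin n)}
    (hx : x ∈ closedOrthant n) (t : ℝ) :
    sphericalMean γ f x t = ∫ y, transMean γ f x (t • y) ∂(sphMeasure γ) := by
  rw [sphericalMean, integral_sphMeasure hn hγ]
  congr 2
  funext θ
  rw [meanIntegrand, translate_eq_transMean hγ hf hx, mul_comm]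

lemma integrableOn_meanIntegrand (hγ : ∀ i, 0 < γ i) {f : EuclideanSpace ℝ (Fin n) → ℝ}
    (hf : IsC2Even f) {x : EuclideanSpace ℝ (Fin n)} (hx : x ∈ closedOrthant n) (t : ℝ) :
    IntegrableOn (meanIntegrand γ f x t) (spherePart n) (surfaceMeasure n) := by
  have e : meanIntegrand γ f x t = fun θ => transMean γ f x (t • θ.1) * weight γ θ.1 := by
    funext θ
    rw [meanIntegrand, translate_eq_transMean hγ hf.1.continuousOn hx]
  have h1 : Continuous fun y : EuclideanSpace ℝ (Fin n) => transMean γ f x (t • y) * weight γ y :=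
    ((contDiff_transMean hγ hf).continuous.comp
      (continuous_const.prodMk (continuous_const_smul t))).mul (continuous_weight hγ)
  rw [e]
  exact ((h1.comp continuous_subtype_val).continuousOn.integrableOn_compact
    isCompact_univ).mono_set (subset_univ _)

lemma ballIntegrand_eq (hγ : ∀ i, 0 < γ i) {f : EuclideanSpace ℝ (Fin n) → ℝ}
    (hf : IsC2Even f) {x : EuclideanSpace ℝ (Fin n)} (hx : x ∈ closedOrthant n) (k t : ℝ) :
    ballIntegrand γ k f x t = fun y => transMean γ f x (t • y) *
      (1 - ‖y‖ ^ 2) ^ ((k - (homDim γ - 1)) / 2 - 1) * weight γ y := by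
  funext y
  rw [ballIntegrand, translate_eq_transMean hγ hf.1.continuousOn hx, homDim]
  congr 3
  ring

/-- The constant of the formula is the reciprocal of the total mass of the weight, which is the weighted
area of the sphere times half a Beta function. -/
lemma ballFormula_eq (hn : 1 ≤ n) (hγ : ∀ i, 0 < γ i) {f : EuclideanSpace ℝ (Fin n) → ℝ}
    (hf : IsC2Even f) {x : EuclideanSpace ℝ (Fin n)} (hx : x ∈ closedOrthant n) {k : ℝ}
    (hk : homDim γ - 1 < k) (t : ℝ) :
    IntegrableOn (ballIntegrand γ k f x t) (ballPart n) ∧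
      ballFormula γ k f x t =
        ∫ y, transMean γ f x (t • y) ∂(ballMeasure γ ((k - (homDim γ - 1)) / 2)) := by
  have hq : 0 < (k - (homDim γ - 1)) / 2 := by linarith
  have hN := homDim_pos hn hγ
  have hH : Continuous fun y : EuclideanSpace ℝ (Fin n) => transMean γ f x (t • y) :=
    (contDiff_transMean hγ hf).continuous.comp
      (continuous_const.prodMk (continuous_const_smul t))
  obtain ⟨h1, h2⟩ := setIntegral_ballPart hn hγ hq hH
  rw [ballFormula, ballIntegrand_eq hγ hf hx]
  refine ⟨h1, ?_⟩
  suffices hC : 2 ^ n * Real.Gamma ((k + 1) / 2) /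
      (Real.Gamma ((k - n - ∑ i, γ i + 1) / 2) * ∏ i, Real.Gamma ((γ i + 1) / 2)) *
      (weightedArea γ * (ProbabilityTheory.beta (homDim γ / 2)
        ((k - (homDim γ - 1)) / 2) / 2)) = 1 by
    rw [h2, ← mul_assoc, hC, one_mul]
  have g1 := (Real.Gamma_pos_of_pos hq).ne'
  have g2 := (Real.Gamma_pos_of_pos (show 0 < homDim γ / 2 by linarith)).ne'
  have g3 := (Real.Gamma_pos_of_pos (show 0 < (k + 1) / 2 by linarith)).ne'
  have g4 : ∏ i, Real.Gamma ((γ i + 1) / 2) ≠ 0 := Finset.prod_ne_zero_iff.2 fun i _ =>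
    (Real.Gamma_pos_of_pos (show 0 < (γ i + 1) / 2 by linarith [hγ i])).ne'
  have e1 : (k - n - ∑ i, γ i + 1) / 2 = (k - (homDim γ - 1)) / 2 := by rw [homDim]; ring
  have e2 : homDim γ / 2 + (k - (homDim γ - 1)) / 2 = (k + 1) / 2 := by ring
  rw [weightedArea, ProbabilityTheory.beta, e1, e2, ← homDim, Real.rpow_sub_one two_ne_zero,
    Real.rpow_natCast]
  field_simp

end Existence

/-! ### The energy estimate in one space dimension -/

section Energy

lemma hasDerivAt_slice_right {d : ℝ × ℝ → ℝ} (hd : ContDiff ℝ 1 d) (t r : ℝ) :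
    HasDerivAt (fun r => d (t, r)) (fderiv ℝ d (t, r) (0, 1)) r := by
  have h1 : HasDerivAt (fun r : ℝ => (t, r)) ((0 : ℝ), (1 : ℝ)) r :=
    (hasDerivAt_const r t).prodMk (hasDerivAt_id r)
  exact ((hd.differentiable one_ne_zero (t, r)).hasFDerivAt).comp_hasDerivAt r h1

lemma contDiff_fderiv_slice_right {d : ℝ × ℝ → ℝ} (hd : ContDiff ℝ 2 d) :
    ContDiff ℝ 1 fun q : ℝ × ℝ => fderiv ℝ d q (0, 1) :=
  (hd.fderiv_right (m := 1) (by norm_num)).clm_apply contDiff_const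

lemma fderiv_slice_comm {d : ℝ × ℝ → ℝ} (hd : ContDiff ℝ 2 d) (z : ℝ × ℝ) :
    fderiv ℝ (fun q => fderiv ℝ d q (1, 0)) z (0, 1) =
      fderiv ℝ (fun q => fderiv ℝ d q (0, 1)) z (1, 0) := by
  have h1 : DifferentiableAt ℝ (fderiv ℝ d) z :=
    (hd.fderiv_right (m := 1) (by norm_num)).differentiable one_ne_zero z
  have h2 : ∀ u, fderiv ℝ (fun q => fderiv ℝ d q u) z =
      (fderiv ℝ (fderiv ℝ d) z).flip u := by
    intro u
    rw [fderiv_clm_apply h1 (differentiableAt_const u)]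
    simp
  rw [h2, h2]
  exact hd.contDiffAt.isSymmSndFDerivAt (by simp) _ _

lemma besselOp_slice_right {d : ℝ × ℝ → ℝ} (hd : ContDiff ℝ 2 d) (ν t r : ℝ) :
    besselOp ν (fun r => d (t, r)) r =
      fderiv ℝ (fun q : ℝ × ℝ => fderiv ℝ d q (0, 1)) (t, r) (0, 1) +
        ν / r * fderiv ℝ d (t, r) (0, 1) := by
  have e : deriv (fun r => d (t, r)) = fun r => fderiv ℝ d (t, r) (0, 1) := by
    funext r
    exact (hasDerivAt_slice_right (hd.of_le (by norm_num)) t r).deriv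
  rw [besselOp, e, (hasDerivAt_slice_right (contDiff_fderiv_slice_right hd) t r).deriv]

/-- Uniqueness for the Euler–Poisson–Darboux equation in one space variable, on the axis `r = 0`.
The energy `∫ (d_t² + d_r²)/2 · r^ν ψ(R - t - r) dr` with an increasing cut-off `ψ` vanishing on
the negative half-line does not increase: the flux through the characteristic `r = R - t` and the
damping term `k/t · d_t²` have the right sign. -/
lemma eq_zero_of_besselOp_eq {d : ℝ × ℝ → ℝ} (hd : ContDiff ℝ 2 d) {k ν : ℝ} (hk : 0 ≤ k)
    (hν : 0 < ν) (heven : ∀ t r, d (-t, r) = d (t, r)) (h0 : ∀ r, d (0, r) = 0)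
    (heq : ∀ t, 0 < t → ∀ r, 0 < r →
      besselOp k (fun t => d (t, r)) t = besselOp ν (fun r => d (t, r)) r)
    {T : ℝ} (hT : 0 ≤ T) : d (T, 0) = 0 := by
  have hd1 : ContDiff ℝ 1 d := hd.of_le (by norm_num)
  -- `p = d_t` and `s = d_r`
  set p : ℝ × ℝ → ℝ := fun q => fderiv ℝ d q (1, 0) with hp
  set s : ℝ × ℝ → ℝ := fun q => fderiv ℝ d q (0, 1) with hs
  have hpC : ContDiff ℝ 1 p := contDiff_fderiv_slice hd
  have hsC : ContDiff ℝ 1 s := contDiff_fderiv_slice_right hd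
  -- evenness in time makes the initial velocity vanish
  have hp0 : ∀ r, p (0, r) = 0 := by
    intro r
    have h1 : HasDerivAt (fun t => d (t, r)) (p (0, r)) 0 := hasDerivAt_slice hd1 0 r
    have h2 : HasDerivAt (fun t => d (t, r)) (-p (0, r)) 0 := by
      have h3 : HasDerivAt (fun t => d (t, r)) (p (0, r)) (-0) := by rwa [neg_zero]
      have h4 := HasDerivAt.comp (h := fun t : ℝ => -t) (0 : ℝ) h3 (hasDerivAt_neg 0)
      have h5 : ((fun t => d (t, r)) ∘ fun t : ℝ => -t) = fun t => d (t, r) :=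
        funext fun t => heven t r
      rw [h5] at h4
      simpa using h4
    linarith [h1.unique h2]
  have hs0 : ∀ r, s (0, r) = 0 := by
    intro r
    have h1 : HasDerivAt (fun r => d (0, r)) (s (0, r)) r := hasDerivAt_slice_right hd1 0 r
    have h2 : (fun r => d (0, r)) = fun _ => 0 := funext h0
    rw [h2] at h1
    exact h1.unique (hasDerivAt_const r 0)
  -- Any `R > T` serves: at time `T` the domain `0 < r < R - T` still reaches the axis `r = 0`.
  set R := T + 1 with hR
  have hR0 : 0 < R := by linarith
  have hψC : ContDiff ℝ 1 expNegInvGlue := expNegInvGlue.contDiff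
  have hψd : ∀ x, HasDerivAt expNegInvGlue (deriv expNegInvGlue x) x := fun x =>
    (hψC.differentiable one_ne_zero x).hasDerivAt
  have hψ' : ∀ x, 0 ≤ deriv expNegInvGlue x := fun x => expNegInvGlue.monotone.deriv_nonneg
  -- the weighted measure `r ^ ν dr` on `(0, R)`
  have hwm : Measurable fun r : ℝ => r ^ ν := by fun_prop
  have hw0 : ∀ᵐ r ∂(volume.restrict (Ioo 0 R)), 0 ≤ r ^ ν := by
    filter_upwards [ae_restrict_mem measurableSet_Ioo] with r hr using Real.rpow_nonneg hr.1.le _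
  have hwc : Continuous fun r : ℝ => r ^ ν := Real.continuous_rpow_const hν.le
  set L := densityMeasure (volume.restrict (Ioo 0 R)) fun r : ℝ => r ^ ν with hL
  have hLfin : IsFiniteMeasure L := isFiniteMeasure_withDensity_ofReal
    ((hwc.integrableOn_Icc (a := 0) (b := R)).mono_set Ioo_subset_Icc_self).2
  have hLK : L (Icc 0 R)ᶜ = 0 := by
    rw [← mem_ae_iff]
    refine densityMeasure_absolutelyContinuous.ae_le ?_
    filter_upwards [ae_restrict_mem measurableSet_Ioo] with r hr using ⟨hr.1.le, hr.2.le⟩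
  set h : ℝ × ℝ → ℝ := fun q =>
    (p q ^ 2 + s q ^ 2) / 2 * expNegInvGlue (R - q.1 - q.2) with hh
  have hhC : ContDiff ℝ 1 h :=
    (((hpC.pow 2).add (hsC.pow 2)).div_const 2).mul
      (hψC.comp ((contDiff_const.sub contDiff_fst).sub contDiff_snd))
  have hhnn : ∀ q, 0 ≤ h q := fun q => mul_nonneg (by positivity) (expNegInvGlue.nonneg _)
  set E : ℝ → ℝ := fun t => ∫ r, h (t, r) ∂L with hE
  have hEd : ∀ t, HasDerivAt E (∫ r, fderiv ℝ h (t, r) (1, 0) ∂L) t := fun t =>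
    hasDerivAt_integral_of_compact isCompact_Icc hLK hhC t
  have hE0 : E 0 = 0 := by
    refine integral_eq_zero_of_ae (Eventually.of_forall fun r => ?_)
    simp only [hh, hp0, hs0]
    simp
  have hdec : ∀ t, 0 < t → ∫ r, fderiv ℝ h (t, r) (1, 0) ∂L ≤ 0 := by
    intro t ht
    -- The energy flux; it is zero at `r = 0` by the weight and at `r = R` by the cut-off.
    set G : ℝ → ℝ := fun r => p (t, r) * (r ^ ν * s (t, r)) * expNegInvGlue (R - t - r) with hG
    have hGc : ContinuousOn G (Icc 0 R) := by
      have c1 : Continuous fun r => p (t, r) := hpC.continuous.comp (Continuous.prodMk_right t)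
      have c2 : Continuous fun r => s (t, r) := hsC.continuous.comp (Continuous.prodMk_right t)
      have c3 : Continuous fun r => expNegInvGlue (R - t - r) :=
        hψC.continuous.comp (by fun_prop)
      exact ((c1.mul (hwc.mul c2)).mul c3).continuousOn
    have hGd : ∀ r ∈ Ioo 0 R, HasDerivAt G
        ((fderiv ℝ s (t, r) (1, 0) * (r ^ ν * s (t, r)) + p (t, r) *
          (ν * (r ^ ν / r) * s (t, r) + r ^ ν * fderiv ℝ s (t, r) (0, 1))) *
            expNegInvGlue (R - t - r) +
          p (t, r) * (r ^ ν * s (t, r)) * (deriv expNegInvGlue (R - t - r) * -1)) r := by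
      intro r hr
      have d1 := hasDerivAt_slice_right hpC t r
      rw [show fderiv ℝ p (t, r) (0, 1) = fderiv ℝ s (t, r) (1, 0) from
        fderiv_slice_comm hd (t, r)] at d1
      have d2 := hasDerivAt_slice_right hsC t r
      have d3 := Real.hasDerivAt_rpow_const (x := r) (p := ν) (Or.inl hr.1.ne')
      rw [Real.rpow_sub_one hr.1.ne'] at d3
      have d4 : HasDerivAt (fun r => expNegInvGlue (R - t - r))
          (deriv expNegInvGlue (R - t - r) * -1) r :=
        HasDerivAt.comp (h := fun r => R - t - r) r (hψd _)
          ((hasDerivAt_id r).const_sub (R - t))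
      exact (d1.mul (d3.mul d2)).mul d4
    have hht : ∀ r, fderiv ℝ h (t, r) (1, 0) =
        (p (t, r) * fderiv ℝ p (t, r) (1, 0) + s (t, r) * fderiv ℝ s (t, r) (1, 0)) *
            expNegInvGlue (R - t - r) -
          (p (t, r) ^ 2 + s (t, r) ^ 2) / 2 * deriv expNegInvGlue (R - t - r) := by
      intro r
      refine (hasDerivAt_slice hhC t r).unique ?_
      have d1 := hasDerivAt_slice hpC t r
      have d2 := hasDerivAt_slice hsC t r
      have d4 : HasDerivAt (fun t => expNegInvGlue (R - t - r))
          (deriv expNegInvGlue (R - t - r) * -1) t :=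
        HasDerivAt.comp (h := fun t => R - t - r) t (hψd _)
          (((hasDerivAt_id t).const_sub R).sub_const r)
      refine ((((d1.pow 2).add (d2.pow 2)).div_const 2).mul d4).congr_deriv ?_
      simp only [Pi.add_apply, Pi.pow_apply]
      norm_num
      ring
    -- The energy density changes at most by the divergence of the flux: the difference consists of
    -- the damping term and of `ψ' (p - s)² / 2`.
    have hle : ∀ r ∈ Ioo 0 R, r ^ ν * fderiv ℝ h (t, r) (1, 0) ≤
        (fderiv ℝ s (t, r) (1, 0) * (r ^ ν * s (t, r)) + p (t, r) *
          (ν * (r ^ ν / r) * s (t, r) + r ^ ν * fderiv ℝ s (t, r) (0, 1))) *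
            expNegInvGlue (R - t - r) +
          p (t, r) * (r ^ ν * s (t, r)) * (deriv expNegInvGlue (R - t - r) * -1) := by
      intro r hr
      have e := heq t ht r hr.1
      rw [besselOp_slice hd, besselOp_slice_right hd] at e
      have e' : fderiv ℝ p (t, r) (1, 0) =
          fderiv ℝ s (t, r) (0, 1) + ν / r * s (t, r) - k / t * p (t, r) := by
        linarith
      have n1 : 0 ≤ r ^ ν := Real.rpow_nonneg hr.1.le _
      have n2 : 0 ≤ k / t := div_nonneg hk ht.le
      have n3 := expNegInvGlue.nonneg (R - t - r)
      have n4 := hψ' (R - t - r)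
      rw [hht, e', ← sub_nonneg]
      have n5 : 0 ≤ r ^ ν * (k / t * p (t, r) ^ 2 * expNegInvGlue (R - t - r) +
          deriv expNegInvGlue (R - t - r) * ((p (t, r) - s (t, r)) ^ 2 / 2)) := by positivity
      refine n5.trans_eq ?_
      ring
    have hφi : IntegrableOn (fun r => r ^ ν * fderiv ℝ h (t, r) (1, 0)) (Icc 0 R) := by
      have c1 : Continuous fun r => fderiv ℝ h (t, r) (1, 0) :=
        ((hhC.continuous_fderiv one_ne_zero).comp (Continuous.prodMk_right t)).clm_apply
          continuous_const
      exact (hwc.mul c1).integrableOn_Icc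
    have hfin := intervalIntegral.integral_le_sub_of_hasDeriv_right_of_le hR0.le hGc
      (fun r hr => (hGd r hr).hasDerivWithinAt) hφi hle
    rw [intervalIntegral.integral_of_le hR0.le, integral_Ioc_eq_integral_Ioo] at hfin
    rw [hL, integral_densityMeasure hwm hw0]
    refine hfin.trans_eq ?_
    simp only [hG]
    rw [Real.zero_rpow hν.ne', expNegInvGlue.zero_of_nonpos (by linarith)]
    ring
  have hanti : AntitoneOn E (Ici 0) := by
    refine antitoneOn_of_deriv_nonpos (convex_Ici 0)
      (fun t _ => (hEd t).continuousAt.continuousWithinAt)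
      (fun t _ => (hEd t).differentiableAt.differentiableWithinAt) fun t ht => ?_
    rw [interior_Ici] at ht
    rw [(hEd t).deriv]
    exact hdec t ht
  have hE' : ∀ t, 0 ≤ t → E t = 0 := fun t ht => le_antisymm
    ((hanti self_mem_Ici ht ht).trans_eq hE0) (integral_nonneg fun r => hhnn _)
  -- zero energy forces `d_t = 0` in the characteristic triangle `r < R - t`
  have hpz : ∀ t, 0 ≤ t → ∀ r ∈ Ioo 0 (R - t), p (t, r) = 0 := by
    intro t ht r hr
    have e1 := hE' t ht
    simp only [hE, hL] at e1
    have c1 : Continuous fun r => r ^ ν * h (t, r) :=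
      hwc.mul (hhC.continuous.comp (Continuous.prodMk_right t))
    rw [integral_densityMeasure hwm hw0, setIntegral_eq_zero_iff_of_nonneg_ae] at e1
    · have e2 := Measure.eqOn_open_of_ae_eq e1 isOpen_Ioo c1.continuousOn continuousOn_const
        (show r ∈ Ioo 0 R from ⟨hr.1, by linarith [hr.2]⟩)
      have e3 := (mul_eq_zero.1 e2).resolve_left (Real.rpow_pos_of_pos hr.1 ν).ne'
      have e4 := (mul_eq_zero.1 e3).resolve_right
        (expNegInvGlue.pos_of_pos (by dsimp only; linarith [hr.2])).ne'
      have e5 : p (t, r) ^ 2 = 0 := by nlinarith [sq_nonneg (p (t, r)), sq_nonneg (s (t, r))]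
      exact pow_eq_zero_iff two_ne_zero |>.1 e5
    · filter_upwards [hw0] with r hr using mul_nonneg hr (hhnn _)
    · exact c1.integrableOn_Icc.mono_set Ioo_subset_Icc_self
  have hzero : ∀ r ∈ Ioo (0 : ℝ) 1, d (T, r) = 0 := by
    intro r hr
    have hc := constant_of_has_deriv_right_zero (f := fun t => d (t, r)) (a := 0) (b := T)
      (hd.continuous.comp (Continuous.prodMk_left r)).continuousOn fun t ht => by
        have h1 := (hasDerivAt_slice hd1 t r).hasDerivWithinAt (s := Ici t)
        rwa [show fderiv ℝ d (t, r) (1, 0) = 0 from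
          hpz t ht.1 r ⟨hr.1, by linarith [hr.2, ht.2]⟩] at h1
    rw [hc T ⟨hT, le_rfl⟩, h0]
  have hcl : (0 : ℝ) ∈ closure (Ioo (0 : ℝ) 1) := by
    rw [closure_Ioo zero_ne_one]
    exact ⟨le_rfl, zero_le_one⟩
  exact (EqOn.closure hzero (hd.continuous.comp (Continuous.prodMk_right T)) continuous_const) hcl

end Energy

/-! ### Uniqueness by spherical means of a solution -/

section Uniqueness

variable {n : ℕ} {γ : Fin n → ℝ}

/-- Generalized translations commute with the Laplace–Bessel operator. -/
lemma integral_laplaceBessel_transPoint (hγ : ∀ i, 0 < γ i) {f : EuclideanSpace ℝ (Fin n) → ℝ}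
    (hf : IsC2Even f) {x y : EuclideanSpace ℝ (Fin n)} (hx : x ∈ orthant n) (hy : y ∈ orthant n) :
    ∫ α, laplaceBessel γ f (transPoint x y α) ∂(angleMeasure γ) =
      laplaceBessel γ (transMean γ f x) y := by
  have hprob := isProbabilityMeasure_angleMeasure hγ
  have hF := contDiff_evenExt hf
  have hE := globallyEven_evenExt f
  have hc : Continuous (transPoint x y) :=
    continuous_transPoint.comp ((continuous_const (y := (x, y))).prodMk continuous_id)
  obtain ⟨R, hR⟩ := (isCompact_angleBox (n := n)).exists_bound_of_continuousOn hc.continuousOn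
  have hmem : ∀ᵐ α ∂(angleMeasure γ), transPoint x y α ∈ orthant n := by
    filter_upwards [ae_angleMeasure_mem hγ] with α hα i using triDist_pos (x i) (hy i) (hα i)
  have hbox : ∀ᵐ α ∂(angleMeasure γ), α ∈ angleBox n := by
    filter_upwards [ae_angleMeasure_mem hγ] with α hα i _ using Ioo_subset_Icc_self (hα i)
  have h1 : ∫ α, laplaceBessel γ f (transPoint x y α) ∂(angleMeasure γ) =
      ∫ α, laplaceBessel γ (evenExt f) (transPoint x y α) ∂(angleMeasure γ) := by
    refine integral_congr_ae ?_
    filter_upwards [hmem] with α hα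
    exact laplaceBessel_congr (fun z hz => (evenExt_eq f hz).symm) γ hα
  rw [h1, ← transMean_evenExt γ f]
  simp only [laplaceBessel]
  rw [integral_finsetSum]
  · exact Finset.sum_congr rfl fun i _ =>
      (besselOp_transMean_right hγ (isC2Even_evenExt hf) hF hE hx hy i).symm
  · intro i _
    obtain ⟨C, hC⟩ := hE.abs_besselOp_le hF (γ i) R
    refine Integrable.of_bound
      ((measurable_besselOp_setCoord hF (γ i) i).comp hc.measurable).aestronglyMeasurable C ?_
    filter_upwards [hbox] with α hα using hC i _ (hR α hα)

lemma IsSolution.isC2Even {k : ℝ} {f : EuclideanSpace ℝ (Fin n) → ℝ}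
    {u : EuclideanSpace ℝ (Fin n) → ℝ → ℝ} (hu : IsSolution γ k f u) {t : ℝ} (ht : 0 ≤ t) :
    IsC2Even fun x => u x t :=
  ⟨hu.contDiffOn.comp (contDiff_id.prodMk contDiff_const).contDiffOn fun _ hx => ⟨hx, ht⟩,
    hu.even t ht⟩

/-- The spherical means `M_r[u(·, t)](x)` at a fixed centre `x` as a function of `(t, r)`. Time is
reflected evenly, the radius may have either sign. -/
def meanProfile (γ : Fin n → ℝ) (u : EuclideanSpace ℝ (Fin n) → ℝ → ℝ)
    (x : EuclideanSpace ℝ (Fin n)) (q : ℝ × ℝ) : ℝ :=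
  ∫ y, transMean γ (fun z => u z |q.1|) x (q.2 • y) ∂(sphMeasure γ)

lemma IsSolution.contDiff_comp_transPoint_abs {k : ℝ} {f : EuclideanSpace ℝ (Fin n) → ℝ}
    {u : EuclideanSpace ℝ (Fin n) → ℝ → ℝ} (hu : IsSolution γ k f u)
    (x : EuclideanSpace ℝ (Fin n)) :
    ContDiff ℝ 2 fun q : ((ℝ × ℝ) × EuclideanSpace ℝ (Fin n)) × (Fin n → ℝ) =>
      u (transPoint x (q.1.1.2 • q.1.2) q.2) |q.1.1.1| := by
  have h := contDiff_comp_sqrtVec_abs hu.contDiffOn hu.even hu.initial_deriv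
  have hg : ContDiff ℝ 2 fun q : ((ℝ × ℝ) × EuclideanSpace ℝ (Fin n)) × (Fin n → ℝ) =>
      (((WithLp.toLp 2 fun i => x i - (q.1.1.2 • q.1.2) i * Real.cos (q.2 i) :
          EuclideanSpace ℝ (Fin n)),
        (WithLp.toLp 2 fun i => (q.1.1.2 • q.1.2) i * Real.sin (q.2 i) :
          EuclideanSpace ℝ (Fin n))), q.1.1.1) := by
    simp only [PiLp.smul_apply, smul_eq_mul]
    fun_prop
  exact h.comp hg

lemma IsSolution.contDiff_transMean_abs (hγ : ∀ i, 0 < γ i) {k : ℝ}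
    {f : EuclideanSpace ℝ (Fin n) → ℝ} {u : EuclideanSpace ℝ (Fin n) → ℝ → ℝ}
    (hu : IsSolution γ k f u) (x : EuclideanSpace ℝ (Fin n)) :
    ContDiff ℝ 2 fun q : (ℝ × ℝ) × EuclideanSpace ℝ (Fin n) =>
      transMean γ (fun z => u z |q.1.1|) x (q.1.2 • q.2) := by
  have := isProbabilityMeasure_angleMeasure hγ
  exact contDiff_integral_of_compact isCompact_angleBox (angleMeasure_compl hγ) 2
    (hu.contDiff_comp_transPoint_abs x)

lemma IsSolution.contDiff_meanProfile (hn : 1 ≤ n) (hγ : ∀ i, 0 < γ i) {k : ℝ}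
    {f : EuclideanSpace ℝ (Fin n) → ℝ} {u : EuclideanSpace ℝ (Fin n) → ℝ → ℝ}
    (hu : IsSolution γ k f u) (x : EuclideanSpace ℝ (Fin n)) :
    ContDiff ℝ 2 (meanProfile γ u x) := by
  have := isProbabilityMeasure_sphMeasure hn hγ
  exact contDiff_integral_of_compact
    (isCompact_closedBall (0 : EuclideanSpace ℝ (Fin n)) 1)
    (closedBall_compl_null ((ae_sphMeasure γ).mono fun y hy => hy.2.le)) 2
    (hu.contDiff_transMean_abs hγ x)

/-- The spherical means of a solution solve an Euler–Poisson–Darboux equation in `(t, r)`: both sides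
equal the mean of `(B_k)_t u = Δ_γ u`, by the Darboux identity on the right. -/
lemma IsSolution.besselOp_meanProfile (hn : 1 ≤ n) (hγ : ∀ i, 0 < γ i) {k : ℝ}
    {f : EuclideanSpace ℝ (Fin n) → ℝ} {u : EuclideanSpace ℝ (Fin n) → ℝ → ℝ}
    (hu : IsSolution γ k f u) {x : EuclideanSpace ℝ (Fin n)} (hx : x ∈ orthant n) {t r : ℝ}
    (ht : 0 < t) (hr : 0 < r) :
    besselOp k (fun t => meanProfile γ u x (t, r)) t =
      besselOp (homDim γ - 1) (fun r => meanProfile γ u x (t, r)) r := by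
  have h1 := isProbabilityMeasure_sphMeasure hn hγ
  have h2 := isProbabilityMeasure_angleMeasure hγ
  have hut := hu.isC2Even ht.le
  have hw : ContDiff ℝ 2 (transMean γ (fun z => u z t) x) :=
    (contDiff_transMean hγ hut).comp (contDiff_const.prodMk contDiff_id)
  have hr' : (fun r => meanProfile γ u x (t, r)) = fun r =>
      ∫ y, transMean γ (fun z => u z t) x (r • y) ∂(sphMeasure γ) := by
    funext r
    simp only [meanProfile, abs_of_pos ht]
  rw [hr', hasDarbouxIdentity_sphMeasure hn hγ _ hw
    (transMean_even_right hγ hut.1.continuousOn x) r hr]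
  have c1 : ContDiff ℝ 2 fun q : ℝ × EuclideanSpace ℝ (Fin n) =>
      transMean γ (fun z => u z |q.1|) x (r • q.2) :=
    (hu.contDiff_transMean_abs hγ x).comp
      (f := fun q : ℝ × EuclideanSpace ℝ (Fin n) => ((q.1, r), q.2)) (by fun_prop)
  have e1 : besselOp k (fun t => meanProfile γ u x (t, r)) t =
      ∫ y, besselOp k (fun t => transMean γ (fun z => u z |t|) x (r • y)) t ∂(sphMeasure γ) :=
    besselOp_integral (isCompact_closedBall (0 : EuclideanSpace ℝ (Fin n)) 1)
      (closedBall_compl_null ((ae_sphMeasure γ).mono fun y hy => hy.2.le))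
      c1 k t
  rw [e1]
  refine integral_congr_ae ?_
  filter_upwards [ae_sphMeasure γ] with y hy
  have hry : r • y ∈ orthant n := (smul_mem_orthant_iff hr).2 hy.1
  have c2 : ContDiff ℝ 2 fun q : ℝ × (Fin n → ℝ) => u (transPoint x (r • y) q.2) |q.1| :=
    (hu.contDiff_comp_transPoint_abs x).comp
      (f := fun q : ℝ × (Fin n → ℝ) => (((q.1, r), y), q.2)) (by fun_prop)
  have e2 : besselOp k (fun t => transMean γ (fun z => u z |t|) x (r • y)) t =
      ∫ α, besselOp k (fun t => u (transPoint x (r • y) α) |t|) t ∂(angleMeasure γ) :=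
    besselOp_integral isCompact_angleBox (angleMeasure_compl hγ)
      c2 k t
  rw [e2, ← integral_laplaceBessel_transPoint hγ hut hx hry]
  refine integral_congr_ae ?_
  filter_upwards [ae_angleMeasure_mem hγ] with α hα
  have hmem : transPoint x (r • y) α ∈ orthant n := fun i => triDist_pos (x i) (hry i) (hα i)
  rw [← hu.equation _ hmem t ht]
  refine besselOp_congr ?_ k
  filter_upwards [lt_mem_nhds ht] with s hs
  rw [abs_of_pos hs]

/-- At radius `0` the spherical mean is the value at the centre. -/
lemma meanProfile_zero_right (hn : 1 ≤ n) (hγ : ∀ i, 0 < γ i)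
    (u : EuclideanSpace ℝ (Fin n) → ℝ → ℝ) {x : EuclideanSpace ℝ (Fin n)}
    (hx : x ∈ closedOrthant n) {t : ℝ} (ht : 0 ≤ t) : meanProfile γ u x (t, 0) = u x t := by
  have h1 := isProbabilityMeasure_sphMeasure hn hγ
  simp only [meanProfile, zero_smul, transMean_zero hγ hx, abs_of_nonneg ht]
  simp

lemma IsSolution.meanProfile_zero_left {k : ℝ} {f : EuclideanSpace ℝ (Fin n) → ℝ}
    {u : EuclideanSpace ℝ (Fin n) → ℝ → ℝ} (hu : IsSolution γ k f u)
    (x : EuclideanSpace ℝ (Fin n)) (r : ℝ) :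
    meanProfile γ u x (0, r) = ∫ y, transMean γ f x (r • y) ∂(sphMeasure γ) := by
  simp only [meanProfile, transMean, abs_zero, hu.initial_value _ (transPoint_mem _ _ _)]

lemma besselOp_sub {g h : ℝ → ℝ} (hg : ContDiff ℝ 2 g) (hh : ContDiff ℝ 2 h) (κ s : ℝ) :
    besselOp κ (fun s => g s - h s) s = besselOp κ g s - besselOp κ h s := by
  have hg' : ContDiff ℝ 1 (deriv g) :=
    (contDiff_succ_iff_deriv.1 (show ContDiff ℝ (1 + 1) g from hg)).2.2
  have hh' : ContDiff ℝ 1 (deriv h) :=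
    (contDiff_succ_iff_deriv.1 (show ContDiff ℝ (1 + 1) h from hh)).2.2
  have e : deriv (fun s => g s - h s) = fun s => deriv g s - deriv h s := funext fun s =>
    deriv_fun_sub (hg.differentiable two_ne_zero s) (hh.differentiable two_ne_zero s)
  rw [besselOp, e, deriv_fun_sub (hg'.differentiable one_ne_zero s)
    (hh'.differentiable one_ne_zero s), besselOp, besselOp]
  ring

lemma closedOrthant_subset_closure : closedOrthant n ⊆ closure (orthant n) := by
  intro x hx
  have hc : Continuous fun ε : ℝ => x + ε • (WithLp.toLp 2 fun _ => 1 :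
      EuclideanSpace ℝ (Fin n)) := by fun_prop
  have h1 : Tendsto (fun ε : ℝ => x + ε • (WithLp.toLp 2 fun _ => 1 :
      EuclideanSpace ℝ (Fin n))) (𝓝[>] 0) (𝓝 x) := by
    have h2 := (hc.tendsto 0).mono_left (nhdsWithin_le_nhds (s := Ioi 0))
    simpa using h2
  refine mem_closure_of_tendsto h1 ?_
  filter_upwards [self_mem_nhdsWithin] with ε hε i
  have hε' : (0 : ℝ) < ε := hε
  have := hx i
  simp only [PiLp.add_apply, PiLp.smul_apply, smul_eq_mul, mul_one]
  linarith

/-- Two solutions with the same initial data agree: the difference of their spherical means about `x`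
vanishes on the axis `r = 0`. -/
lemma IsSolution.unique (hn : 1 ≤ n) (hγ : ∀ i, 0 < γ i) {k : ℝ} (hk : 0 ≤ k)
    {f : EuclideanSpace ℝ (Fin n) → ℝ} {u v : EuclideanSpace ℝ (Fin n) → ℝ → ℝ}
    (hu : IsSolution γ k f u) (hv : IsSolution γ k f v) {x : EuclideanSpace ℝ (Fin n)}
    (hx : x ∈ closedOrthant n) {t : ℝ} (ht : 0 ≤ t) : v x t = u x t := by
  have hmain : EqOn (fun x => v x t) (fun x => u x t) (orthant n) := by
    intro x hx
    have hU := hu.contDiff_meanProfile hn hγ x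
    have hV := hv.contDiff_meanProfile hn hγ x
    have h := eq_zero_of_besselOp_eq (d := fun q => meanProfile γ v x q - meanProfile γ u x q)
      (hV.sub hU) hk (show 0 < homDim γ - 1 by linarith [homDim_pos hn hγ])
      (fun t r => by simp only [meanProfile, abs_neg])
      (fun r => by rw [hu.meanProfile_zero_left, hv.meanProfile_zero_left, sub_self])
      (fun t ht r hr => by
        rw [besselOp_sub (g := fun t => meanProfile γ v x (t, r))
            (h := fun t => meanProfile γ u x (t, r))
            (hV.comp (contDiff_id.prodMk contDiff_const))
            (hU.comp (contDiff_id.prodMk contDiff_const)),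
          besselOp_sub (g := fun r => meanProfile γ v x (t, r))
            (h := fun r => meanProfile γ u x (t, r))
            (hV.comp (contDiff_const.prodMk contDiff_id))
            (hU.comp (contDiff_const.prodMk contDiff_id)),
          hu.besselOp_meanProfile hn hγ hx ht hr, hv.besselOp_meanProfile hn hγ hx ht hr]) ht
    rw [meanProfile_zero_right hn hγ v (orthant_subset hx) ht,
      meanProfile_zero_right hn hγ u (orthant_subset hx) ht] at h
    exact sub_eq_zero.1 h
  -- the equation is only available at interior centres; the faces follow by continuity
  exact hmain.of_subset_closure (hv.isC2Even ht).1.continuousOn (hu.isC2Even ht).1.continuousOn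
    orthant_subset closedOrthant_subset_closure hx

end Uniqueness

end EPD

end

theorem theorem3p1 (n : ℕ) (hn : 1 ≤ n) (γ : Fin n → ℝ) (hγ : ∀ i, 0 < γ i)
    (f : EuclideanSpace ℝ (Fin n) → ℝ) (hf : EPD.IsC2Even f) :
    ((∀ x ∈ EPD.closedOrthant n, ∀ t : ℝ, 0 ≤ t →
        MeasureTheory.IntegrableOn (EPD.meanIntegrand γ f x t) (EPD.spherePart n)
          (EPD.surfaceMeasure n)) ∧
      EPD.IsTheSolution γ ((n : ℝ) + ∑ i, γ i - 1) f (EPD.sphericalMean γ f)) ∧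
    ∀ k : ℝ, (n : ℝ) + ∑ i, γ i - 1 < k →
      (∀ x ∈ EPD.closedOrthant n, ∀ t : ℝ, 0 ≤ t →
        MeasureTheory.IntegrableOn (EPD.ballIntegrand γ k f x t) (EPD.ballPart n)) ∧
      EPD.IsTheSolution γ k f (EPD.ballFormula γ k f) := by
  have hN : 0 < EPD.homDim γ - 1 := by linarith [EPD.homDim_pos hn hγ]
  refine ⟨⟨fun x hx t _ => EPD.integrableOn_meanIntegrand hγ hf hx t, ?_⟩, fun k hk =>
    ⟨fun x hx t _ => (EPD.ballFormula_eq hn hγ hf hx hk t).1, ?_⟩⟩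
  · have := EPD.isProbabilityMeasure_sphMeasure hn hγ
    have hs : EPD.IsSolution γ (EPD.homDim γ - 1) f (EPD.sphericalMean γ f) :=
      (EPD.isSolution_of_hasDarbouxIdentity hγ hf
        ((EPD.ae_sphMeasure γ).mono fun y hy => ⟨hy.1, hy.2.le⟩)
        (EPD.hasDarbouxIdentity_sphMeasure hn hγ)).congr
        fun x hx t _ => EPD.sphericalMean_eq hn hγ hf.1.continuousOn hx t
    exact ⟨hs, fun v hv x hx t ht => hs.unique hn hγ hN.le hv hx ht⟩
  · have hk' : EPD.homDim γ - 1 < k := hk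
    have hq : 0 < (k - (EPD.homDim γ - 1)) / 2 := by linarith
    have := EPD.isProbabilityMeasure_ballMeasure hn hγ hq
    have hD := EPD.hasDarbouxIdentity_ballMeasure hn hγ hq
    rw [show EPD.homDim γ - 1 + 2 * ((k - (EPD.homDim γ - 1)) / 2) = k by ring] at hD
    have hs : EPD.IsSolution γ k f (EPD.ballFormula γ k f) :=
      (EPD.isSolution_of_hasDarbouxIdentity hγ hf (EPD.ae_ballMeasure hn hγ hq) hD).congr
        fun x hx t _ => (EPD.ballFormula_eq hn hγ hf hx hk t).2
    exact ⟨hs, fun v hv x hx t ht => hs.unique hn hγ (hN.trans hk').le hv hx ht⟩
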